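/- Let $\Gamma\subset\mathbb R^2$ be a finite connected graph embedded in the plane: multiple edges are allowed and loops are not, the vertices are distinct points, the edges are simple (continuous) arcs joining their ends, no arc passes through a vertex other than its ends, and two different arcs meet only at common ends. For an orientation $K$ of the edges and a bounded face $f$ (a bounded connected component of $\mathbb R^2\setminus\Gamma$), orient the boundary $\partial f$ counterclockwise, i.e. with $f$ on its left, and let $n^K(\partial f)$ be the number of edges that $\partial f$ traverses against the orientation $K$; an edge with $f$ on both of its sides is traversed by $\partial f$ once in each direction, hence counts once. Call $K$ a Kasteleyn orientation if $n^K(\partial f)$ is odd for every bounded face $f$. A dimer configuration on a graph is a set of edges such that every vertex is an end of exactly one of them. Call $K$ Pfaffian if, for every cycle $C$ of even length in $\Gamma$ (two parallel edges form a cycle of length $2$) such that the graph $\Gamma\setminus C$ obtained by deleting the vertices of $C$ admits a dimer configuration, the number $n^K(C)$ of edges of $C$ whose orientation by $K$ differs from a fixed orientation of $C$ is odd. 1. $\Gamma$ admits a Kasteleyn orientation. 2. Every Kasteleyn orientation $K$ of $\Gamma$ is Pfaffian. Moreover, if $\Gamma$ has $2n$ vertices, enumerated by $1,\dots,2n$ in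 any way, and $\nu$ is a positive real-valued function on the edges, then $$Z(\Gamma;\nu)=|\mathrm{Pf}(A^K)|.$$ Here $Z(\Gamma;\nu)=\sum_D\prod_{e\in D}\nu(e)$ is the sum over all dimer configurations $D$ on $\Gamma$. The matrix $A^K=(a_{ij})$ is the $2n\times 2n$ skew-symmetric matrix with $a_{ij}=\sum_e\varepsilon_{ij}(e)\nu(e)$, the sum being over all edges $e$ between $i$ and $j$, where $\varepsilon_{ij}(e)=1$ if $K$ orients $e$ from $i$ to $j$ and $-1$ otherwise. Finally, $\mathrm{Pf}(A)=\frac{1}{2^n n!}\sum_{\sigma\in S_{2n}}\mathrm{sgn}(\sigma)\,a_{\sigma(1)\sigma(2)}\cdots a_{\sigma(2n-1)\sigma(2n)}$. -/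

import Mathlib

open scoped Graph

noncomputable section

/-! ### Dimers and Pfaffian orientations on multigraphs -/

/-- The Pfaffian of a matrix of size `2n`, as the normalised signed sum over permutations. -/
def pfaffian {n : ℕ} (A : Matrix (Fin (2 * n)) (Fin (2 * n)) ℝ) : ℝ :=
  1 / (2 ^ n * (n.factorial : ℝ)) *
    ∑ σ : Equiv.Perm (Fin (2 * n)), ((Equiv.Perm.sign σ : ℤ) : ℝ) *
      ∏ i : Fin n, A (σ ⟨2 * i.1, by omega⟩) (σ ⟨2 * i.1 + 1, by omega⟩)

namespace Graph

variable {α β : Type*}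

/-- Any two vertices are joined by a walk. -/
def Preconnected (G : Graph α β) : Prop :=
  ∀ x y : V(G), Relation.ReflTransGen G.Adj (x : α) (y : α)

/-- A dimer configuration (perfect matching): a set `D` of edges such that each vertex is an end of
exactly one edge in `D`. -/
def IsDimer (G : Graph α β) (D : Set E(G)) : Prop :=
  ∀ v : V(G), ∃! e : E(G), e ∈ D ∧ G.Inc e v

open Classical in
/-- The dimer partition function: the sum over all dimer configurations of the product of the
weights of their edges. -/
def dimerPartition (G : Graph α β) [Fintype E(G)] (ν : E(G) → ℝ) : ℝ :=
  ∑ D ∈ (Finset.univ : Finset (Finset E(G))).filter (fun D : Finset E(G) => G.IsDimer (D : Set E(G))),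
    ∏ e ∈ D, ν e

/-- An orientation of a graph: every edge is directed from one of its ends to the other. -/
structure Orientation (G : Graph α β) where
  tail : E(G) → V(G)
  head : E(G) → V(G)
  isLink : ∀ e : E(G), G.IsLink e (tail e) (head e)

open Classical in
/-- The weighted skew-adjacency matrix of an orientation, with respect to an enumeration `x` of the
vertices. The entry at `(i, j)` is the sum, over all edges between `x i` and `x j`, of the weight of
the edge with sign `1` if it is directed from `x i` to `x j`, and `-1` otherwise. -/
def Orientation.skewAdj {G : Graph α β} [Fintype E(G)] (K : G.Orientation) {m : ℕ}
    (x : Fin m ≃ V(G)) (ν : E(G) → ℝ) : Matrix (Fin m) (Fin m) ℝ :=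
  Matrix.of fun i j =>
    ∑ e : E(G), if G.IsLink e (x i) (x j) then
      (if K.tail e = x i ∧ K.head e = x j then 1 else -1) * ν e else 0

/-- A (directed) cycle of length `m` in a multigraph: distinct vertices `vert i` and distinct edges
`edge i` joining `vert i` to `vert (i + 1)`, indices modulo `m`. Two parallel edges form a cycle of
length two. -/
structure Cycle (G : Graph α β) (m : ℕ) [NeZero m] where
  vert : Fin m → V(G)
  edge : Fin m → E(G)
  isLink : ∀ i, G.IsLink (edge i) (vert i) (vert (i + 1))
  vert_injective : Function.Injective vert
  edge_injective : Function.Injective edge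

/-- The number of edges of a cycle that the cycle runs through against the orientation `K`. -/
def Orientation.nCycle {G : Graph α β} (K : G.Orientation) {m : ℕ} [NeZero m]
    (C : G.Cycle m) : ℕ :=
  Nat.card {i : Fin m // K.tail (C.edge i) = C.vert (i + 1) ∧ K.head (C.edge i) = C.vert i}

/-- Pfaffian (admissible) orientations: for every cycle `C` of even length such that the graph
obtained by deleting the vertices of `C` has a dimer configuration, the number of edges of `C`
directed against `C` is odd. -/
def Orientation.IsPfaffian {G : Graph α β} (K : G.Orientation) : Prop :=
  ∀ (m : ℕ) [NeZero m], Even m → ∀ C : G.Cycle m,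
    (∃ D, (G.deleteVerts (Set.range fun i => (C.vert i : α))).IsDimer D) → Odd (K.nCycle C)

end Graph

/-! ### Winding numbers and the left-hand side of a plane curve -/

/-- The closed curve `γ` avoids `z` and has winding number `k` around `z`: there is a continuous
logarithm of `γ - z` along the curve whose total increment is `2πik`. -/
def HasWinding {a : ℂ} (γ : Path a a) (z : ℂ) (k : ℤ) : Prop :=
  ∃ l : C(unitInterval, ℂ), (∀ t, Complex.exp (l t) = γ t - z) ∧
    l 1 - l 0 = 2 * Real.pi * Complex.I * k

/-- The set `f` lies along the left-hand side of the arc `γ`, for the standard orientation of the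
plane. When one crosses a directed curve once, from its right to its left, the winding number of
the curve around the moving point increases by one. So we require this: `γ` has an interior point
`p = γ t` such that, after `γ` is closed up by a curve `c` that does not pass through `p`, arbitrarily
close to `p` there are points with winding number `k`, and also points of `f` with winding number
`k + 1`. (Neither the choice of `c` nor `k` matters, since changing `c` adds to the winding number
a function that is constant near `p`.) -/
def IsOnLeft {a b : ℂ} (γ : Path a b) (f : Set ℂ) : Prop :=
  ∃ t ∈ Set.Ioo (0 : unitInterval) 1, ∃ c : Path b a, γ t ∉ Set.range c ∧
    ∃ k : ℤ, γ t ∈ closure {z | HasWinding (γ.trans c) z k} ∧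
      γ t ∈ closure {z | z ∈ f ∧ HasWinding (γ.trans c) z (k + 1)}

/-! ### Graphs embedded in the plane -/

namespace Graph

variable {α β : Type*}

/-- An embedding of a multigraph in the plane `ℝ² = ℂ`: vertices are distinct points, every edge is
a simple arc (the image of an injective continuous path) that joins its ends, an arc passes through
no vertex other than the ends of its edge, and two different arcs meet only in vertices.
(A graph with a loop has no such embedding.) -/
structure PlaneEmbedding (G : Graph α β) where
  pos : V(G) → ℂ
  arc : E(G) → Set ℂ
  pos_injective : Function.Injective pos
  exists_path : ∀ (e : E(G)) (x y : V(G)), G.IsLink e x y →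
    ∃ γ : Path (pos x) (pos y), Function.Injective γ ∧ Set.range γ = arc e
  inc_of_mem : ∀ (e : E(G)) (v : V(G)), pos v ∈ arc e → G.Inc e v
  inter_subset : ∀ e e' : E(G), e ≠ e' → arc e ∩ arc e' ⊆ Set.range pos

namespace PlaneEmbedding

variable {G : Graph α β} (Γ : G.PlaneEmbedding)

/-- The drawing: the set of all points on vertices and edges. -/
def support : Set ℂ := Set.range Γ.pos ∪ ⋃ e, Γ.arc e

/-- The faces are the connected components of the complement of the drawing. -/
def IsFace (f : Set ℂ) : Prop :=
  ∃ z ∈ Γ.supportᶜ, f = connectedComponentIn Γ.supportᶜ z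

/-- The counterclockwise boundary of `f` runs through the edge `e` against the orientation `K`:
the set `f` lies on the left-hand side of `e` when `e` is traversed from its head to its tail. -/
def BoundaryAgainst (K : G.Orientation) (f : Set ℂ) (e : E(G)) : Prop :=
  ∃ γ : Path (Γ.pos (K.head e)) (Γ.pos (K.tail e)),
    Function.Injective γ ∧ Set.range γ = Γ.arc e ∧ IsOnLeft γ f

/-- The number of edges that the boundary `∂f`, directed counterclockwise (with the face on the
left), runs through against the orientation `K`. An edge with the same face on both of its sides is
run through by `∂f` twice, once in either direction, and hence counts exactly once. -/
def nBoundary (K : G.Orientation) (f : Set ℂ) : ℕ :=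
  Nat.card {e : E(G) // Γ.BoundaryAgainst K f e}

/-- Kasteleyn orientations: `n^K(∂f)` is odd for every bounded face `f`. -/
def IsKasteleyn (K : G.Orientation) : Prop :=
  ∀ f : Set ℂ, Γ.IsFace f → Bornology.IsBounded f → Odd (Γ.nBoundary K f)

end PlaneEmbedding

end Graph

end

open scoped Graph

noncomputable section

open Set Complex Topology Filter

/-! ### Continuous logarithms -/

open Set Complex Topology Filter

/-! Plane topology is reduced to one tool, continuous logarithms. If a product of integral powers of
`x - zᵢ`, with the `zᵢ` off a closed set `K`, has a continuous logarithm on `K`, then the exponent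
belonging to a bounded component containing only one of the `zᵢ` vanishes (`eq_zero_of_hasLogOn`,
Eilenberg's criterion). Conversely, whether such a logarithm exists on a graph can be read off from
the increments along its cycles. This shows that an arc has exactly two sides near an interior point
(`exists_sides`), that each edge has one face on its right and one on its left
(`exists_sidePair_forall`), that winding numbers of chains jump by the coefficient of the edge
crossed (`windingNumber_left_sub_right`), and that a cycle has an inside and an outside
(`exists_windingNumber_values`).

Existence of Kasteleyn orientations is linear algebra over `ZMod 2`. Reversing an edge changes the
boundary counts of its two adjacent faces, so parities are prescribed by a linear system. Its rows
are independent: a dependency, extended by zero to the unbounded face, takes equal values across all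
edges, so it is zero.

Kasteleyn implies Pfaffian by a count inside a cycle `C`. Join all other vertices to `C` by a
spanning forest, so that cycle and forest form the `frame`. The faces inside form a tree under
adjacency across the inner edges outside the frame, so they exceed those edges by one
(`card_innerFace`). Summing the odd numbers `n^K(∂f)` over these faces counts each edge having an
inner face on its right once. Modulo 2 this gives `n^K(C)`, plus the number of inner vertices, plus
the number of inner edges outside the frame. The inner vertices are matched among themselves by the
dimer configuration of the complement of `C`, hence even in number, and `n^K(C)` is odd.

For the formula, expand the Pfaffian over orderings of matchings (`pfaffian_skewAdj`). Each dimer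
configuration occurs `2^n n!` times with one sign. Two configurations are connected by exchanging
edges along alternating cycles. Rotating an even cycle has sign `-1`, the orientation signs around
it multiply to `-1` since `K` is Pfaffian, and so all terms have the same sign (`pairingSign_eq`).
-/

/-- The function `h` has a continuous logarithm on the set `K`. -/
def HasLogOn {X : Type*} [TopologicalSpace X] (h : X → ℂ) (K : Set X) : Prop :=
  ∃ L : X → ℂ, ContinuousOn L K ∧ ∀ x ∈ K, exp (L x) = h x

theorem two_pi_I_ne_zero' : (2 * Real.pi * I : ℂ) ≠ 0 := by
  simp [Real.pi_ne_zero]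

theorem exists_int_of_exp_eq {u v : ℂ} (h : exp u = exp v) : ∃ k : ℤ, u = v + 2 * Real.pi * I * k := by
  obtain ⟨k, hk⟩ := Complex.exp_eq_exp_iff_exists_int.1 h
  exact ⟨k, by rw [hk]; ring⟩

theorem exp_add_two_pi_mul_int (u : ℂ) (k : ℤ) : exp (u + 2 * Real.pi * I * k) = exp u :=
  Complex.exp_eq_exp_iff_exists_int.2 ⟨k, by ring⟩

/-- Discreteness of the periods of `exp` makes the difference of two continuous logarithms constant
on a preconnected set. -/
theorem isDiscrete_range_two_pi : DiscreteTopology (range fun k : ℤ => (2 * Real.pi * I * k : ℂ)) := by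
  have h : Topology.IsClosedEmbedding (fun k : ℤ => (2 * Real.pi * I * k : ℂ)) := by
    refine Metric.isClosedEmbedding_of_pairwise_le_dist (ε := 1) one_pos ?_
    intro k l hkl
    have h1 : (1:ℝ) ≤ |((k - l : ℤ) : ℝ)| := by
      rw [← Int.cast_abs]; exact_mod_cast Int.one_le_abs (sub_ne_zero.2 hkl)
    have h2 : (2 * Real.pi * I * k - 2 * Real.pi * I * l : ℂ) = (2 * Real.pi * (k - l : ℤ) : ℝ) * I := by
      push_cast; ring
    simp only [dist_eq_norm]
    rw [h2, norm_mul, norm_I, mul_one, norm_real, Real.norm_eq_abs, abs_mul, abs_of_pos (by positivity)]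
    nlinarith [Real.pi_gt_three]
  exact h.isEmbedding.toHomeomorph.symm.isEmbedding.discreteTopology

theorem IsPreconnected.eq_add_of_exp_eq {X : Type*} [TopologicalSpace X] {S : Set X}
    (hS : IsPreconnected S) {f g : X → ℂ} (hf : ContinuousOn f S) (hg : ContinuousOn g S)
    (h : ∀ x ∈ S, exp (f x) = exp (g x)) : ∃ k : ℤ, ∀ x ∈ S, f x = g x + 2 * Real.pi * I * k := by
  have := isDiscrete_range_two_pi
  obtain ⟨y, ⟨k, rfl⟩, hy⟩ := hS.eqOn_const_of_mapsTo (f := fun x => f x - g x)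
    (T := range fun k : ℤ => (2 * Real.pi * I * k : ℂ)) ⟨this⟩ (hf.sub hg) (by
      intro x hx
      obtain ⟨k, hk⟩ := exists_int_of_exp_eq (h x hx)
      exact ⟨k, by simp [hk]⟩) ⟨_, 0, rfl⟩
  exact ⟨k, fun x hx => by have := hy hx; simp at this; rw [← this]; ring⟩

theorem IsPreconnected.sub_eq_of_exp_eq {X : Type*} [TopologicalSpace X] {S : Set X}
    (hS : IsPreconnected S) {f g : X → ℂ} (hf : ContinuousOn f S) (hg : ContinuousOn g S)
    (h : ∀ x ∈ S, exp (f x) = exp (g x)) {x y : X} (hx : x ∈ S) (hy : y ∈ S) :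
    f x - f y = g x - g y := by
  obtain ⟨k, hk⟩ := hS.eq_add_of_exp_eq hf hg h
  rw [hk x hx, hk y hy]; ring

theorem IsPreconnected.eq_of_exp_eq {X : Type*} [TopologicalSpace X] {S : Set X}
    (hS : IsPreconnected S) {f g : X → ℂ} (hf : ContinuousOn f S) (hg : ContinuousOn g S)
    (h : ∀ x ∈ S, exp (f x) = exp (g x)) {x y : X} (hx : x ∈ S) (hy : y ∈ S) (hxy : f y = g y) :
    f x = g x := by
  have := hS.sub_eq_of_exp_eq hf hg h hx hy
  rw [hxy] at this
  linear_combination this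

theorem Convex.isSimplyConnected' {E : Type*} [AddCommGroup E] [Module ℝ E] [TopologicalSpace E]
    [ContinuousAdd E] [ContinuousSMul ℝ E] {s : Set E} (hs : Convex ℝ s) (hne : s.Nonempty) :
    IsSimplyConnected s := by
  have := hs.contractibleSpace hne
  exact (inferInstance : SimplyConnectedSpace s)

theorem Convex.hasLogOn {E : Type*} [NormedAddCommGroup E] [NormedSpace ℝ E] {s : Set E}
    (hs : Convex ℝ s) (ho : IsOpen s) {g : E → ℂ} (hg : ContinuousOn g s) (h0 : ∀ x ∈ s, g x ≠ 0) :
    HasLogOn g s := by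
  rcases s.eq_empty_or_nonempty with rfl | hne
  · exact ⟨0, by simp, by simp⟩
  obtain ⟨f, hf, hfe⟩ := exists_continuousOn_eqOn_exp_comp (hs.isSimplyConnected' hne) ho hg
    (by rintro ⟨x, hx, h⟩; exact h0 x hx h)
  exact ⟨f, hf, fun x hx => hfe hx⟩

theorem hasLogOn_Icc {g : ℝ → ℂ} {s t : ℝ} (hg : ContinuousOn g (Icc s t))
    (h0 : ∀ x ∈ Icc s t, g x ≠ 0) : HasLogOn g (Icc s t) := by
  rcases lt_or_ge t s with hst | hst
  · exact ⟨0, by simp [Icc_eq_empty_of_lt hst], by simp [Icc_eq_empty_of_lt hst]⟩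
  have hc : Continuous fun x => g (projIcc s t hst x) := by
    have := continuousOn_iff_continuous_domRestrict.1 hg
    exact this.comp continuous_projIcc
  obtain ⟨L, hL, hLe⟩ := (convex_univ (𝕜 := ℝ) (E := ℝ)).hasLogOn isOpen_univ hc.continuousOn
    (fun x _ => h0 _ (projIcc s t hst x).2)
  refine ⟨L, hL.mono (subset_univ _), fun x hx => ?_⟩
  rw [hLe x trivial]
  simp only [projIcc_of_mem hst hx]

theorem HasLogOn.mono {X : Type*} [TopologicalSpace X] {h : X → ℂ} {K K' : Set X}
    (H : HasLogOn h K) (hK : K' ⊆ K) : HasLogOn h K' := by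
  obtain ⟨L, hL, hLe⟩ := H
  exact ⟨L, hL.mono hK, fun x hx => hLe x (hK hx)⟩

/-- The quotient of the differences to two points in a convex set is never a nonpositive number
outside of the set. -/
theorem sub_div_sub_mem_slitPlane {B : Set ℂ} (hB : Convex ℝ B) {x z w : ℂ} (hz : z ∈ B) (hw : w ∈ B)
    (hx : x ∉ B) : (x - z) / (x - w) ∈ slitPlane := by
  by_contra hn
  rw [mem_slitPlane_iff_not_le_zero, not_not] at hn
  obtain ⟨hre, him⟩ := Complex.le_def.1 hn
  set q := (x - z) / (x - w) with hq
  have hq' : q = ((q.re : ℝ) : ℂ) := by apply Complex.ext <;> simp_all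
  set c : ℝ := -q.re
  have hc : 0 ≤ c := by simpa [c] using hre
  have hxw : x - w ≠ 0 := by
    intro h; apply hx; rw [sub_eq_zero.1 h]; exact hw
  have h1 : x - z = -(c:ℂ) * (x - w) := by
    have : q = -(c:ℂ) := by rw [hq']; simp [c]
    rw [← this, hq]; field_simp
  apply hx
  -- If the quotient is `-c` with `c ≥ 0`, solving for `x` puts it on the segment from `z` to `w`.
  have h2 : x = (1/(1+c)) • z + (c/(1+c)) • w := by
    have : (1 + (c:ℂ)) ≠ 0 := by exact_mod_cast (by positivity : (1 + c) ≠ 0)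
    simp only [real_smul]; push_cast
    field_simp
    linear_combination h1
  rw [h2]
  exact hB hz hw (by positivity) (by positivity) (by field_simp)

theorem exp_log_sub_div_sub {B : Set ℂ} (hB : Convex ℝ B) {x z w : ℂ} (hz : z ∈ B) (hw : w ∈ B)
    (hx : x ∉ B) : exp (log ((x - z) / (x - w))) = (x - z) / (x - w) :=
  exp_log (slitPlane_ne_zero (sub_div_sub_mem_slitPlane hB hz hw hx))

theorem continuousOn_log_sub_div_sub {B : Set ℂ} (hB : Convex ℝ B) {z w : ℂ} (hz : z ∈ B)
    (hw : w ∈ B) : ContinuousOn (fun x => log ((x - z) / (x - w))) Bᶜ := by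
  refine ContinuousOn.clog ?_ fun x hx => sub_div_sub_mem_slitPlane hB hz hw hx
  refine ContinuousOn.div (by fun_prop) (by fun_prop) ?_
  intro x hx h
  exact hx (by rw [sub_eq_zero.1 h]; exact hw)

/-! ### Increments of the logarithm along a curve -/

open Classical in
/-- The increment of a continuous logarithm of `γ - z` along the interval `[s, t]`. -/
def logInc (γ : ℝ → ℂ) (s t : ℝ) (z : ℂ) : ℂ :=
  if h : HasLogOn (fun x => γ x - z) (Icc s t) then h.choose t - h.choose s else 0

theorem logInc_eq {γ : ℝ → ℂ} {s t : ℝ} (hst : s ≤ t) {z : ℂ} {l : ℝ → ℂ}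
    (hl : ContinuousOn l (Icc s t)) (he : ∀ x ∈ Icc s t, exp (l x) = γ x - z) :
    logInc γ s t z = l t - l s := by
  have h : HasLogOn (fun x => γ x - z) (Icc s t) := ⟨l, hl, he⟩
  rw [logInc, dif_pos h]
  obtain ⟨h1, h2⟩ := h.choose_spec
  exact isPreconnected_Icc.sub_eq_of_exp_eq h1 hl (fun x hx => by rw [h2 x hx, he x hx])
    (right_mem_Icc.2 hst) (left_mem_Icc.2 hst)

theorem hasLogOn_curve {γ : ℝ → ℂ} {s t : ℝ} {z : ℂ} (hγ : ContinuousOn γ (Icc s t))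
    (hz : z ∉ γ '' Icc s t) : HasLogOn (fun x => γ x - z) (Icc s t) :=
  hasLogOn_Icc (hγ.sub continuousOn_const) fun x hx h => hz ⟨x, hx, sub_eq_zero.1 h⟩

theorem exp_logInc {γ : ℝ → ℂ} {s t : ℝ} {z : ℂ} (hst : s ≤ t) (hγ : ContinuousOn γ (Icc s t))
    (hz : z ∉ γ '' Icc s t) : exp (logInc γ s t z) = (γ t - z) / (γ s - z) := by
  obtain ⟨l, hl, he⟩ := hasLogOn_curve hγ hz
  rw [logInc_eq hst hl he, exp_sub, he _ (right_mem_Icc.2 hst), he _ (left_mem_Icc.2 hst)]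

theorem logInc_add {γ : ℝ → ℂ} {s t u : ℝ} {z : ℂ} (hst : s ≤ t) (htu : t ≤ u)
    (hγ : ContinuousOn γ (Icc s u)) (hz : z ∉ γ '' Icc s u) :
    logInc γ s t z + logInc γ t u z = logInc γ s u z := by
  obtain ⟨l, hl, he⟩ := hasLogOn_curve hγ hz
  rw [logInc_eq (hst.trans htu) hl he,
    logInc_eq hst (hl.mono (Icc_subset_Icc_right htu)) fun x hx => he x (Icc_subset_Icc_right htu hx),
    logInc_eq htu (hl.mono (Icc_subset_Icc_left hst)) fun x hx => he x (Icc_subset_Icc_left hst hx)]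
  ring

/-- A continuous logarithm of `(x - z) / (x - w)` on a curve compares the increments at `z`, `w`. -/
theorem logInc_sub_logInc {γ : ℝ → ℂ} {s t : ℝ} {z w : ℂ} (hst : s ≤ t)
    (hγ : ContinuousOn γ (Icc s t)) (hw : w ∉ γ '' Icc s t) {L : ℝ → ℂ}
    (hL : ContinuousOn L (Icc s t))
    (he : ∀ x ∈ Icc s t, exp (L x) = (γ x - z) / (γ x - w)) :
    logInc γ s t z - logInc γ s t w = L t - L s := by
  obtain ⟨l, hl, hle⟩ := hasLogOn_curve hγ hw
  rw [logInc_eq hst hl hle, logInc_eq hst (l := fun x => l x + L x) (hl.add hL) ?_]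
  · ring
  · intro x hx
    have : γ x - w ≠ 0 := fun h => hw ⟨x, hx, sub_eq_zero.1 h⟩
    rw [exp_add, hle x hx, he x hx]; field_simp

theorem logInc_sub_logInc_of_convex {γ : ℝ → ℂ} {s t : ℝ} {z w : ℂ} (hst : s ≤ t)
    (hγ : ContinuousOn γ (Icc s t)) {B : Set ℂ} (hB : Convex ℝ B) (hz : z ∈ B) (hw : w ∈ B)
    (h : Disjoint B (γ '' Icc s t)) :
    logInc γ s t z - logInc γ s t w
      = log ((γ t - z) / (γ t - w)) - log ((γ s - z) / (γ s - w)) := by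
  have hm : MapsTo γ (Icc s t) Bᶜ := fun x hx hxB => h.le_bot ⟨hxB, x, hx, rfl⟩
  exact logInc_sub_logInc (L := fun x => log ((γ x - z) / (γ x - w))) hst hγ
    (fun hw' => h.le_bot ⟨hw, hw'⟩)
    ((continuousOn_log_sub_div_sub hB hz hw).comp hγ hm)
    (fun x hx => exp_log_sub_div_sub hB hz hw (hm hx))

/-- Moving `z` within a ball disjoint from the curve changes the increment by principal logarithms
at the two ends, which are continuous in `z`. -/
theorem continuousOn_logInc {γ : ℝ → ℂ} {s t : ℝ} (hst : s ≤ t) (hγ : ContinuousOn γ (Icc s t)) :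
    ContinuousOn (logInc γ s t) (γ '' Icc s t)ᶜ := by
  have hK : IsClosed (γ '' Icc s t) := (isCompact_Icc.image_of_continuousOn hγ).isClosed
  intro w hw
  obtain ⟨r, hr, hB⟩ := Metric.isOpen_iff.1 hK.isOpen_compl w hw
  apply ContinuousAt.continuousWithinAt
  have hd : Disjoint (Metric.ball w r) (γ '' Icc s t) := disjoint_compl_right_iff_subset.2 hB |>.mono_right (by simp)
  have hs : γ s - w ≠ 0 := fun h => hw ⟨s, left_mem_Icc.2 hst, sub_eq_zero.1 h⟩
  have ht : γ t - w ≠ 0 := fun h => hw ⟨t, right_mem_Icc.2 hst, sub_eq_zero.1 h⟩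
  have key : ContinuousAt (fun z => logInc γ s t w +
      (log ((γ t - z) / (γ t - w)) - log ((γ s - z) / (γ s - w)))) w := by
    refine continuousAt_const.add (ContinuousAt.sub ?_ ?_)
    · exact ContinuousAt.clog (by fun_prop) (by simp [div_self ht])
    · exact ContinuousAt.clog (by fun_prop) (by simp [div_self hs])
  refine key.congr ?_
  filter_upwards [Metric.ball_mem_nhds w hr] with z hz
  rw [← logInc_sub_logInc_of_convex hst hγ (convex_ball w r) hz (Metric.mem_ball_self hr) hd]
  ring

/-! ### Separation of the plane -/

theorem frontier_connectedComponentIn_subset {K : Set ℂ} (hK : IsClosed K) (z : ℂ) :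
    frontier (connectedComponentIn Kᶜ z) ⊆ K := by
  intro x hx
  by_contra hxK
  have ho : ∀ y, IsOpen (connectedComponentIn Kᶜ y) := fun y => hK.isOpen_compl.connectedComponentIn
  have hxx : x ∈ connectedComponentIn Kᶜ x := mem_connectedComponentIn hxK
  have hcl := frontier_subset_closure hx
  obtain ⟨y, hy1, hy2⟩ := mem_closure_iff.1 hcl _ (ho x) hxx
  have h1 := connectedComponentIn_eq hy1
  have h2 := connectedComponentIn_eq hy2
  rw [h2, ← h1] at hx
  exact (ho x).inter_frontier_eq.le ⟨hxx, hx⟩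

theorem isPreconnected_norm_gt (R : ℝ) (hR : 0 < R) : IsPreconnected {z : ℂ | R < ‖z‖} := by
  have h : {z : ℂ | R < ‖z‖} = exp '' {w : ℂ | Real.log R < w.re} := by
    ext z
    constructor
    · intro hz
      have hz' : R < ‖z‖ := hz
      have h0 : z ≠ 0 := by rintro rfl; simp at hz'; linarith
      refine ⟨log z, ?_, exp_log h0⟩
      rw [mem_ofPred_eq, log_re]
      exact Real.log_lt_log hR hz'
    · rintro ⟨w, hw, rfl⟩
      rw [mem_ofPred_eq] at hw ⊢
      rwa [norm_exp, ← Real.log_lt_iff_lt_exp hR]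
  rw [h]
  exact (convex_halfSpace_re_gt _).isPreconnected.image _ continuous_exp.continuousOn

/-- The winding number argument behind the separation theorems. -/
theorem eq_zero_of_log_frontier {U : Set ℂ} (hU : IsOpen U) (hb : Bornology.IsBounded U) {z₀ : ℂ}
    (hz₀ : z₀ ∈ U) {g : ℂ → ℂ} (hg : ContinuousOn g (closure U)) (hg0 : ∀ z ∈ closure U, g z ≠ 0)
    {n : ℤ} (h : HasLogOn (fun z => (z - z₀) ^ n * g z) (frontier U)) : n = 0 := by
  classical
  obtain ⟨L₀, hL₀, hLe⟩ := h
  -- Tietze extension of the given logarithm to the whole plane.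
  obtain ⟨L, hL⟩ := ContinuousMap.exists_restrict_eq (isClosed_frontier (s := U))
    ⟨_, continuousOn_iff_continuous_domRestrict.1 hL₀⟩
  have hLL : ∀ z ∈ frontier U, L z = L₀ z := fun z hz => by
    simpa using congr($hL ⟨z, hz⟩)
  -- `F` is continuous and zero-free on the plane punctured at `z₀`. Its winding around `z₀` is `n`
  -- on small circles, but `0` on large ones, where it is an exponential.
  set F : ℂ → ℂ := fun z => if z ∈ closure U then (z - z₀) ^ n * g z else exp (L z) with hF
  have hF0 : ∀ z, z ≠ z₀ → F z ≠ 0 := by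
    intro z hz
    by_cases hzU : z ∈ closure U
    · simp only [hF, if_pos hzU]
      exact mul_ne_zero (zpow_ne_zero _ (sub_ne_zero.2 hz)) (hg0 z hzU)
    · simp only [hF, if_neg hzU]; exact exp_ne_zero _
  have hFc : ContinuousOn F {z₀}ᶜ := by
    refine ContinuousOn.if' ?_ ?_ ?_ ?_
    · rintro a ⟨ha, hf⟩
      have hfa : a ∈ frontier U := frontier_closure_subset hf
      refine Tendsto.mono_left ?_ (nhdsWithin_mono _ inter_subset_right)
      have : ContinuousWithinAt (fun z => (z - z₀) ^ n * g z) (closure U) a := by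
        refine ContinuousWithinAt.mul (ContinuousWithinAt.zpow₀ (by fun_prop) _ (Or.inl ?_))
          (hg a (frontier_subset_closure hfa))
        exact sub_ne_zero.2 ha
      rw [if_pos (frontier_subset_closure hfa)]
      exact this
    · rintro a ⟨ha, hf⟩
      have hfa : a ∈ frontier U := frontier_closure_subset hf
      have he : exp (L₀ a) = (a - z₀) ^ n * g a := hLe a hfa
      rw [if_pos (frontier_subset_closure hfa), ← he, ← hLL a hfa]
      exact ((by fun_prop : Continuous fun z => exp (L z)).tendsto a).mono_left nhdsWithin_le_nhds
    · rintro a ⟨ha, hac⟩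
      refine ContinuousWithinAt.mul (ContinuousWithinAt.zpow₀ (by fun_prop) _ (Or.inl ?_))
          ((hg a hac).mono inter_subset_right)
      exact sub_ne_zero.2 ha
    · fun_prop
  -- pass to polar coordinates
  have hexp : ∀ w : ℂ, z₀ + exp w ≠ z₀ := fun w h => exp_ne_zero w (by simp at h)
  obtain ⟨M, hM, hMe⟩ := (convex_univ (𝕜 := ℝ) (E := ℂ)).hasLogOn isOpen_univ
    (g := fun w => F (z₀ + exp w))
    (hFc.comp (f := fun w => z₀ + exp w) (by fun_prop) fun w _ => hexp w)
    (fun w _ => hF0 _ (hexp w))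
  have hMc : Continuous M := continuousOn_univ.1 hM
  have hMe' : ∀ w, exp (M w) = F (z₀ + exp w) := fun w => hMe w trivial
  -- periodicity of `M` holds far away
  obtain ⟨R, hR⟩ := hb.closure.subset_ball z₀
  have hfar : ∀ w : ℂ, R ≤ Real.exp w.re → z₀ + exp w ∉ closure U := by
    intro w hw hm
    have := hR hm
    rw [Metric.mem_ball, dist_eq_norm, add_sub_cancel_left, norm_exp] at this
    linarith
  have hfar' : ∀ w : ℂ, R ≤ w.re → F (z₀ + exp w) = exp (L (z₀ + exp w)) := by
    intro w hw
    simp only [hF, if_neg (hfar w (hw.trans (by linarith [Real.add_one_le_exp w.re])))]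
  obtain ⟨k, hk⟩ := (isPreconnected_univ (α := ℂ)).eq_add_of_exp_eq
    (f := fun w => M (w + 2 * Real.pi * I)) (g := M) (by fun_prop) (by fun_prop) (by
      intro w _
      simp only [hMe', exp_periodic w])
  have h1 : M (R + 2 * Real.pi * I) - M R = 0 := by
    have := (convex_halfSpace_re_ge R).isPreconnected.sub_eq_of_exp_eq (f := M)
      (g := fun w => L (z₀ + exp w)) (by fun_prop) (by fun_prop)
      (fun w hw => by rw [hMe', hfar' w hw]) (x := R + 2 * Real.pi * I) (y := R)
      (by simp) (by simp)
    rw [this]; simp [exp_periodic (R : ℂ)]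
  -- the increment near `z₀`
  obtain ⟨r, hr, hrU⟩ := Metric.isOpen_iff.1 hU z₀ hz₀
  obtain ⟨l, hl, hle⟩ := (convex_ball z₀ r).hasLogOn Metric.isOpen_ball
    (hg.mono (hrU.trans subset_closure)) (fun x hx => hg0 x (subset_closure (hrU hx)))
  have hnear : ∀ w : ℂ, w.re < Real.log r → z₀ + exp w ∈ Metric.ball z₀ r := by
    intro w hw
    rw [Metric.mem_ball, dist_eq_norm, add_sub_cancel_left, norm_exp]
    rwa [← Real.lt_log_iff_exp_lt hr]
  set c : ℂ := ((Real.log r - 1 : ℝ) : ℂ) with hc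
  have h2 : M (c + 2 * Real.pi * I) - M c = n * (2 * Real.pi * I) := by
    have := (convex_halfSpace_re_lt (Real.log r)).isPreconnected.sub_eq_of_exp_eq (f := M)
      (g := fun w => n * w + l (z₀ + exp w)) (by fun_prop)
      (ContinuousOn.add (by fun_prop) (hl.comp (f := fun w => z₀ + exp w) (by fun_prop) hnear))
      (fun w hw => by
        rw [hMe', exp_add, hle _ (hnear w hw), exp_int_mul]
        simp only [hF, if_pos (subset_closure (hrU (hnear w hw))), add_sub_cancel_left])
      (x := c + 2 * Real.pi * I) (y := c) (by simp [hc]) (by simp [hc])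
    rw [this]; simp only [exp_periodic c]; ring
  have h3 := hk R trivial
  have h4 := hk c trivial
  rw [h3] at h1
  rw [h4, show (2 * Real.pi * I * k : ℂ) = 0 by linear_combination h1] at h2
  have : (n : ℂ) = 0 := by
    simpa [Real.pi_ne_zero] using h2.symm
  exact_mod_cast this

/-- Eilenberg's criterion: a product of powers of `x - zᵢ` with a continuous logarithm on a closed
set. -/
theorem eq_zero_of_hasLogOn {K : Set ℂ} (hK : IsClosed K) {z₁ z₂ z₃ : ℂ} (hz₁ : z₁ ∉ K)
    (hz₂ : z₂ ∉ K) (hz₃ : z₃ ∉ K)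
    (hb : Bornology.IsBounded (connectedComponentIn Kᶜ z₁)) (hz₂' : z₂ ∉ connectedComponentIn Kᶜ z₁)
    (hz₃' : z₃ ∉ connectedComponentIn Kᶜ z₁) {n₁ n₂ n₃ : ℤ}
    (h : HasLogOn (fun x => (x - z₁) ^ n₁ * ((x - z₂) ^ n₂ * (x - z₃) ^ n₃)) K) : n₁ = 0 := by
  have hfr := frontier_connectedComponentIn_subset hK z₁
  have hne : ∀ x ∈ closure (connectedComponentIn Kᶜ z₁), x - z₂ ≠ 0 ∧ x - z₃ ≠ 0 := by
    intro x hx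
    rw [closure_eq_self_union_frontier] at hx
    constructor <;>
    · intro h0
      rw [sub_eq_zero] at h0
      subst h0
      rcases hx with hx | hx
      · contradiction
      · exact absurd (hfr hx) (by assumption)
  refine eq_zero_of_log_frontier hK.isOpen_compl.connectedComponentIn hb
    (mem_connectedComponentIn hz₁) ?_ ?_ (h.mono hfr)
  · exact ContinuousOn.mul
      (ContinuousOn.zpow₀ (by fun_prop) _ fun x hx => Or.inl (hne x hx).1)
      (ContinuousOn.zpow₀ (by fun_prop) _ fun x hx => Or.inl (hne x hx).2)
  · exact fun x hx => mul_ne_zero (zpow_ne_zero _ (hne x hx).1) (zpow_ne_zero _ (hne x hx).2)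

/-- An unbounded component meets the exterior of a disc containing `K`, and this exterior is
connected. -/
theorem eq_of_not_isBounded_connectedComponentIn {K : Set ℂ} (hK : IsCompact K) {z w : ℂ}
    (hz : ¬ Bornology.IsBounded (connectedComponentIn Kᶜ z))
    (hw : ¬ Bornology.IsBounded (connectedComponentIn Kᶜ w)) :
    connectedComponentIn Kᶜ z = connectedComponentIn Kᶜ w := by
  obtain ⟨R, hR0, hR⟩ := hK.isBounded.exists_pos_norm_le
  have hsub : {x : ℂ | R < ‖x‖} ⊆ Kᶜ := fun x hx hxK => absurd (hR x hxK) (not_le.2 hx)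
  have key : ∀ y, ¬ Bornology.IsBounded (connectedComponentIn Kᶜ y) →
      ∃ x, R < ‖x‖ ∧ connectedComponentIn Kᶜ y = connectedComponentIn Kᶜ x := by
    intro y hy
    by_contra! hcon
    apply hy
    refine isBounded_iff_forall_norm_le.2 ⟨R, fun x hx => ?_⟩
    by_contra! hlt
    exact hcon x hlt (connectedComponentIn_eq hx)
  obtain ⟨x, hx, hzx⟩ := key z hz
  obtain ⟨y, hy, hwy⟩ := key w hw
  rw [hzx, hwy]
  exact connectedComponentIn_eq
    ((isPreconnected_norm_gt R hR0).subset_connectedComponentIn hx hsub hy)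

/-- Two points are not separated by a compact set on which `(x - z) / (x - w)` has a continuous
logarithm. -/
theorem connectedComponentIn_eq_of_hasLogOn {K : Set ℂ} (hK : IsCompact K) {z w : ℂ} (hz : z ∉ K)
    (hw : w ∉ K) (h : HasLogOn (fun x => (x - z) / (x - w)) K) :
    connectedComponentIn Kᶜ z = connectedComponentIn Kᶜ w := by
  by_contra hne
  have hdis : ∀ x ∈ connectedComponentIn Kᶜ z, x ∉ connectedComponentIn Kᶜ w := fun x hx hx' =>
    hne ((connectedComponentIn_eq hx).trans (connectedComponentIn_eq hx').symm)
  -- Of two distinct components at least one is bounded; Eilenberg's criterion, with the exponents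
  -- `1` and `-1`, is applied to that one.
  by_cases hbz : Bornology.IsBounded (connectedComponentIn Kᶜ z)
  · have := eq_zero_of_hasLogOn (n₁ := 1) (n₂ := -1) (n₃ := 0) hK.isClosed hz hw hw hbz
      (fun h' => hdis _ h' (mem_connectedComponentIn hw))
      (fun h' => hdis _ h' (mem_connectedComponentIn hw)) (by simpa [div_eq_mul_inv] using h)
    exact one_ne_zero this
  · have hbw : Bornology.IsBounded (connectedComponentIn Kᶜ w) := by
      by_contra hbw
      exact hne (eq_of_not_isBounded_connectedComponentIn hK hbz hbw)
    have := eq_zero_of_hasLogOn (n₁ := -1) (n₂ := 1) (n₃ := 0) hK.isClosed hw hz hz hbw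
      (fun h' => hdis _ (mem_connectedComponentIn hz) h')
      (fun h' => hdis _ (mem_connectedComponentIn hz) h')
      (by simpa [div_eq_mul_inv, mul_comm] using h)
    norm_num at this

/-! ### The two sides of an arc -/

/-- Gluing on two closed sets. The conclusion that `L₂` is extended without change keeps prescribed
values at vertices fixed while arcs are added one by one. -/
theorem exists_log_union {h : ℂ → ℂ} {K₁ K₂ : Set ℂ} (h₁ : IsClosed K₁) (h₂ : IsClosed K₂)
    {L₁ L₂ : ℂ → ℂ} (hL₁ : ContinuousOn L₁ K₁) (hL₂ : ContinuousOn L₂ K₂)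
    (he₁ : ∀ x ∈ K₁, exp (L₁ x) = h x) (he₂ : ∀ x ∈ K₂, exp (L₂ x) = h x)
    (heq : ∀ x ∈ K₁, x ∈ K₂ → L₁ x = L₂ x) :
    ∃ L : ℂ → ℂ, ContinuousOn L (K₁ ∪ K₂) ∧ (∀ x ∈ K₁ ∪ K₂, exp (L x) = h x) ∧ EqOn L L₂ K₂ := by
  classical
  have e₁ : EqOn (K₁.piecewise L₁ L₂) L₁ K₁ := K₁.piecewise_eqOn L₁ L₂
  have e₂ : EqOn (K₁.piecewise L₁ L₂) L₂ K₂ := by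
    intro x hx
    by_cases hx1 : x ∈ K₁
    · rw [piecewise_eq_of_mem _ _ _ hx1, heq x hx1 hx]
    · rw [piecewise_eq_of_notMem _ _ _ hx1]
  refine ⟨K₁.piecewise L₁ L₂, (hL₁.congr e₁).union_of_isClosed (hL₂.congr e₂) h₁ h₂, ?_, e₂⟩
  rintro x (hx | hx)
  · rw [e₁ hx, he₁ x hx]
  · rw [e₂ hx, he₂ x hx]

theorem hasLogOn_union {h : ℂ → ℂ} {K₁ K₂ : Set ℂ} (h₁ : IsClosed K₁) (h₂ : IsClosed K₂)
    {L₁ L₂ : ℂ → ℂ} (hL₁ : ContinuousOn L₁ K₁) (hL₂ : ContinuousOn L₂ K₂)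
    (he₁ : ∀ x ∈ K₁, exp (L₁ x) = h x) (he₂ : ∀ x ∈ K₂, exp (L₂ x) = h x)
    (heq : ∀ x ∈ K₁, x ∈ K₂ → L₁ x = L₂ x) : HasLogOn h (K₁ ∪ K₂) := by
  obtain ⟨L, hL, he, -⟩ := exists_log_union h₁ h₂ hL₁ hL₂ he₁ he₂ heq
  exact ⟨L, hL, he⟩

/-- A continuous map from a compact space to a Hausdorff space is closed, hence a quotient map onto
its image. It carries logarithms from the parameter interval to the arc. -/
theorem continuousOn_image_of_comp {X Y Z : Type*} [TopologicalSpace X] [TopologicalSpace Y]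
    [T2Space Y] [TopologicalSpace Z] {γ : X → Y} {K : Set X} (hK : IsCompact K)
    (hγ : ContinuousOn γ K) {f : Y → Z} (hf : ContinuousOn (fun x => f (γ x)) K) :
    ContinuousOn f (γ '' K) := by
  have : CompactSpace K := isCompact_iff_compactSpace.1 hK
  rw [continuousOn_iff_isClosed]
  intro C hC
  refine ⟨γ '' (K ∩ (fun x => f (γ x)) ⁻¹' C), ?_, ?_⟩
  · obtain ⟨D, hD, hDe⟩ := continuousOn_iff_isClosed.1 hf C hC
    rw [inter_comm, hDe]
    exact ((hK.inter_left hD).image_of_continuousOn (hγ.mono inter_subset_right)).isClosed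
  · ext y
    constructor
    · rintro ⟨hy, x, hx, rfl⟩
      exact ⟨⟨x, ⟨hx, hy⟩, rfl⟩, x, hx, rfl⟩
    · rintro ⟨⟨x, ⟨hx, hxC⟩, rfl⟩, -⟩
      exact ⟨hxC, x, hx, rfl⟩

/-- A simple pole has no roots on a punctured disc. -/
theorem eq_one_of_pow_eq_div {q : ℂ} {ρ : ℝ} (hρ : 0 < ρ) {R h : ℂ → ℂ} {r : ℕ}
    (hR : ContinuousOn R (Metric.ball q ρ \ {q})) (hh : ContinuousOn h (Metric.ball q ρ))
    (hh0 : ∀ z ∈ Metric.ball q ρ, h z ≠ 0)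
    (hpow : ∀ z ∈ Metric.ball q ρ \ {q}, R z ^ r = h z / (q - z)) : r = 1 := by
  obtain ⟨l, hl, hle⟩ := (convex_ball q ρ).hasLogOn Metric.isOpen_ball hh hh0
  have hmem : ∀ w : ℂ, w.re < Real.log ρ → q + exp w ∈ Metric.ball q ρ \ {q} := by
    intro w hw
    refine ⟨?_, fun h => exp_ne_zero w (by simp at h)⟩
    rw [Metric.mem_ball, dist_eq_norm, add_sub_cancel_left, norm_exp]
    rwa [← Real.lt_log_iff_exp_lt hρ]
  have hR0 : ∀ w : ℂ, w.re < Real.log ρ → R (q + exp w) ≠ 0 ∨ r = 0 := by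
    intro w hw
    by_contra! hcon
    have := hpow _ (hmem w hw)
    rw [hcon.1, zero_pow hcon.2] at this
    have h2 := hh0 _ (hmem w hw).1
    rw [eq_comm, div_eq_zero_iff] at this
    rcases this with h3 | h3
    · exact h2 h3
    · simp at h3
  have hconv := convex_halfSpace_re_lt (Real.log ρ)
  have hopen : IsOpen {w : ℂ | w.re < Real.log ρ} := isOpen_lt continuous_re continuous_const
  set c : ℂ := ((Real.log ρ - 1 : ℝ) : ℂ) with hc
  have hcm : c ∈ {w : ℂ | w.re < Real.log ρ} := by simp [hc]
  have hcm' : c + 2 * Real.pi * I ∈ {w : ℂ | w.re < Real.log ρ} := by simp [hc]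
  have hlc : ContinuousOn (fun w => l (q + exp w)) {w : ℂ | w.re < Real.log ρ} :=
    hl.comp (f := fun w => q + exp w) (by fun_prop) fun w hw => (hmem w hw).1
  have hexp : ∀ w : ℂ, w.re < Real.log ρ →
      exp (l (q + exp w) - w - Real.pi * I) = h (q + exp w) / (q - (q + exp w)) := by
    intro w hw
    rw [exp_sub, exp_sub, hle _ (hmem w hw).1, exp_pi_mul_I]
    have := exp_ne_zero w
    rw [sub_add_cancel_left]; field_simp
  -- For `r = 0` the right-hand side would be the constant `1`, yet its logarithm has increment
  -- `-2πi` around `q`.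
  rcases eq_or_ne r 0 with rfl | hr
  · have := hconv.isPreconnected.sub_eq_of_exp_eq (f := fun _ => 0)
      (g := fun w => l (q + exp w) - w - Real.pi * I) (by fun_prop)
      ((hlc.sub continuousOn_id).sub continuousOn_const)
      (fun w hw => by rw [hexp w hw, ← hpow _ (hmem w hw)]; simp) hcm' hcm
    simp only [exp_periodic c] at this
    exact absurd (by linear_combination this) two_pi_I_ne_zero'
  obtain ⟨M, hM, hMe⟩ := hconv.hasLogOn hopen (g := fun w => R (q + exp w))
    (hR.comp (f := fun w => q + exp w) (by fun_prop) hmem)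
    (fun w hw => (hR0 w hw).resolve_right hr)
  have h1 := hconv.isPreconnected.sub_eq_of_exp_eq (f := fun w => r * M w)
      (g := fun w => l (q + exp w) - w - Real.pi * I) (by fun_prop)
      ((hlc.sub continuousOn_id).sub continuousOn_const)
      (fun w hw => by rw [hexp w hw, ← hpow _ (hmem w hw), exp_nat_mul, hMe w hw]) hcm' hcm
  simp only [exp_periodic c] at h1
  obtain ⟨k, hk⟩ := exists_int_of_exp_eq (u := M (c + 2 * Real.pi * I)) (v := M c)
    (by rw [hMe _ hcm', hMe _ hcm]; simp only [exp_periodic c])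
  rw [hk] at h1
  -- Around `q`, a logarithm of `R` increases by `2πik`, and one of `h z / (q - z)` by `-2πi`; so
  -- `rk = -1`.
  have h2 : (2 * Real.pi * I : ℂ) * ((r * k : ℤ) : ℂ) = 2 * Real.pi * I * ((-1 : ℤ) : ℂ) := by
    push_cast; linear_combination h1
  have h3 : (r : ℤ) * k = -1 := by exact_mod_cast mul_left_cancel₀ two_pi_I_ne_zero' h2
  have : (r : ℤ) ∣ 1 := ⟨-k, by linarith⟩
  exact_mod_cast Int.eq_one_of_dvd_one (by positivity) this

section Arc

variable {γ : ℝ → ℂ} {t : ℝ}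

/-- Near an interior point of an arc, the increment of the logarithm along the arc is not constant
modulo `r > 1`. -/
theorem eq_one_of_logInc_congr (hγ : Continuous γ) (hinj : InjOn γ (Icc 0 1)) (ht : t ∈ Ioo (0:ℝ) 1)
    {ε : ℝ} (hε : 0 < ε) {g : ℂ → ℂ} (hg : ContinuousOn g (Metric.ball (γ t) ε))
    (hge : ∀ z ∈ Metric.ball (γ t) ε, exp (g z) = (γ 1 - z) / (γ 0 - z)) {r : ℕ} (hr : r ≠ 0)
    (hc : ∀ z ∈ Metric.ball (γ t) ε \ γ '' Icc 0 1, ∃ j : ℤ,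
      logInc γ 0 1 z = g z + 2 * Real.pi * I * (r * j)) : r = 1 := by
  classical
  have hB : γ ⁻¹' Metric.ball (γ t) ε ∈ 𝓝 t := hγ.continuousAt (Metric.ball_mem_nhds _ hε)
  obtain ⟨d, hd, hdB⟩ := Metric.mem_nhds_iff.1 hB
  set u := max (t / 2) (t - d / 2) with hu
  set v := min ((t + 1) / 2) (t + d / 2) with hv
  have hut : u < t := max_lt (by linarith [ht.1]) (by linarith)
  have hu0 : 0 < u := lt_max_of_lt_left (by linarith [ht.1])
  have htv : t < v := lt_min (by linarith [ht.2]) (by linarith)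
  have hv1 : v < 1 := min_lt_of_left_lt (by linarith [ht.2])
  have huB : γ u ∈ Metric.ball (γ t) ε := hdB (by
    rw [Metric.mem_ball, Real.dist_eq, abs_lt]
    have := le_max_right (t / 2) (t - d / 2)
    constructor <;> linarith)
  have huv : u < v := hut.trans htv
  have iu : u ∈ Icc (0:ℝ) 1 := ⟨hu0.le, (huv.trans hv1).le⟩
  have iv : v ∈ Icc (0:ℝ) 1 := ⟨(hu0.trans huv).le, hv1.le⟩
  have i0 : (0:ℝ) ∈ Icc (0:ℝ) 1 := by simp
  have i1 : (1:ℝ) ∈ Icc (0:ℝ) 1 := by simp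
  -- The arc is cut at `u` and `v`. Near `γ u` the middle piece and the rest `Y` meet only in `γ u`,
  -- so on a small punctured disc the complements of the two form an open cover.
  set Y := γ '' Icc 0 u ∪ γ '' Icc v 1 with hY
  have hXc : IsClosed (γ '' Icc u v) := (isCompact_Icc.image hγ).isClosed
  have hYc : IsClosed Y := (isCompact_Icc.image hγ).isClosed.union (isCompact_Icc.image hγ).isClosed
  -- a small disc around `γ u`
  have hnv : γ u ∉ γ '' Icc v 1 := by
    rintro ⟨x, hx, hxe⟩
    have := hinj ⟨iv.1.trans hx.1, hx.2⟩ iu hxe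
    linarith [hx.1]
  have hopen : IsOpen (Metric.ball (γ t) ε ∩ (γ '' Icc v 1)ᶜ) :=
    Metric.isOpen_ball.inter (isCompact_Icc.image hγ).isClosed.isOpen_compl
  obtain ⟨ρ, hρ, hρB⟩ := Metric.isOpen_iff.1 hopen (γ u) ⟨huB, hnv⟩
  have hBε : ∀ z ∈ Metric.ball (γ u) ρ, z ∈ Metric.ball (γ t) ε := fun z hz => (hρB hz).1
  have hBv : ∀ z ∈ Metric.ball (γ u) ρ, z ∉ γ '' Icc v 1 := fun z hz => (hρB hz).2
  have hcov : ∀ z ∈ Metric.ball (γ u) ρ \ {γ u}, z ∈ γ '' Icc u v → z ∉ Y := by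
    rintro z ⟨hz, hzu⟩ ⟨x, hx, rfl⟩ (⟨y, hy, hyx⟩ | h)
    · have := hinj ⟨hy.1, hy.2.trans iu.2⟩ ⟨iu.1.trans hx.1, hx.2.trans iv.2⟩ hyx
      exact hzu (by rw [show x = u by linarith [hy.2, hx.1]]; rfl)
    · exact hBv _ hz h
  have hA : γ '' Icc 0 1 = γ '' Icc u v ∪ Y := by
    rw [hY, ← image_union, ← image_union]
    congr 1
    ext x
    simp only [mem_Icc, mem_union]
    constructor
    · intro hx
      rcases le_total x u with h | h
      · exact Or.inr (Or.inl ⟨hx.1, h⟩)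
      rcases le_total x v with h' | h'
      · exact Or.inl ⟨h, h'⟩
      · exact Or.inr (Or.inr ⟨h', hx.2⟩)
    · rintro (h | h | h) <;> constructor <;> linarith [iu.1, iu.2, iv.1, iv.2]
  set LX : ℂ → ℂ := logInc γ u v with hLX
  set LY : ℂ → ℂ := fun z => g z - logInc γ 0 u z - logInc γ v 1 z with hLY
  have hLXe : ∀ z ∈ Metric.ball (γ u) ρ \ {γ u}, z ∉ γ '' Icc u v →
      exp (LX z) = (γ v - z) / (γ u - z) := fun z hz hz' => exp_logInc huv.le hγ.continuousOn hz'
  have hLYe : ∀ z ∈ Metric.ball (γ u) ρ \ {γ u}, z ∉ Y →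
      exp (LY z) = (γ v - z) / (γ u - z) := by
    intro z hz hz'
    have hz0 : z ∉ γ '' Icc 0 u := fun h => hz' (Or.inl h)
    have hz1 : z ∉ γ '' Icc v 1 := fun h => hz' (Or.inr h)
    rw [hLY, exp_sub, exp_sub, exp_logInc iu.1 hγ.continuousOn hz0,
      exp_logInc iv.2 hγ.continuousOn hz1, hge z (hBε z hz.1)]
    have e0 : γ 0 - z ≠ 0 := fun h => hz0 ⟨0, ⟨le_rfl, iu.1⟩, sub_eq_zero.1 h⟩
    have eu : γ u - z ≠ 0 := fun h => hz0 ⟨u, ⟨iu.1, le_rfl⟩, sub_eq_zero.1 h⟩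
    have ev : γ v - z ≠ 0 := fun h => hz1 ⟨v, ⟨le_rfl, iv.2⟩, sub_eq_zero.1 h⟩
    have e1 : γ 1 - z ≠ 0 := fun h => hz1 ⟨1, ⟨iv.2, le_rfl⟩, sub_eq_zero.1 h⟩
    field_simp
  have hdiff : ∀ z ∈ Metric.ball (γ u) ρ \ {γ u}, z ∉ γ '' Icc u v → z ∉ Y →
      exp (LX z / r) = exp (LY z / r) := by
    intro z hz hzX hzY
    have hzA : z ∉ γ '' Icc 0 1 := by rw [hA]; exact fun h => h.elim hzX hzY
    obtain ⟨j, hj⟩ := hc z ⟨hBε z hz.1, hzA⟩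
    have hzA' : z ∉ γ '' Icc u 1 := fun h => hzA (image_mono (Icc_subset_Icc_left iu.1) h)
    rw [← logInc_add iu.1 iu.2 hγ.continuousOn hzA,
      ← logInc_add huv.le iv.2 hγ.continuousOn hzA'] at hj
    have : LX z / r = LY z / r + 2 * Real.pi * I * j := by
      have hr' : (r : ℂ) ≠ 0 := by exact_mod_cast hr
      field_simp
      rw [hLX, hLY]
      linear_combination hj
    rw [this, exp_add_two_pi_mul_int]
  -- `LX` and `LY` are logarithms of `(γ v - z) / (γ u - z)` off the middle piece and off `Y`. The
  -- congruence modulo `r` makes their `r`-th parts agree after exponentiation, so these glue to an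
  -- `r`-th root of a function with a simple pole at `γ u`.
  set R : ℂ → ℂ := fun z => if z ∈ γ '' Icc u v then exp (LY z / r) else exp (LX z / r) with hR
  have hpow : ∀ w : ℂ, exp (w / r) ^ r = exp w := by
    intro w
    have hr' : (r : ℂ) ≠ 0 := by exact_mod_cast hr
    rw [← exp_nat_mul]; congr 1; field_simp
  have hRY : ∀ z ∈ Metric.ball (γ u) ρ \ {γ u}, z ∉ Y → R z = exp (LY z / r) := by
    intro z hz hzY
    by_cases hzX : z ∈ γ '' Icc u v
    · simp only [hR, if_pos hzX]
    · simp only [hR, if_neg hzX, hdiff z hz hzX hzY]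
  refine eq_one_of_pow_eq_div (q := γ u) hρ (R := R) (h := fun z => γ v - z) ?_ (by fun_prop) ?_ ?_
  · have ho : IsOpen (Metric.ball (γ u) ρ \ {γ u}) := Metric.isOpen_ball.sdiff isClosed_singleton
    have : Metric.ball (γ u) ρ \ {γ u} =
        ((Metric.ball (γ u) ρ \ {γ u}) ∩ (γ '' Icc u v)ᶜ) ∪ ((Metric.ball (γ u) ρ \ {γ u}) ∩ Yᶜ) := by
      rw [← inter_union_distrib_left, eq_comm, inter_eq_left]
      intro z hz
      by_cases hzX : z ∈ γ '' Icc u v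
      · exact Or.inr (hcov z hz hzX)
      · exact Or.inl hzX
    rw [this]
    refine ContinuousOn.union_of_isOpen ?_ ?_ (ho.inter hXc.isOpen_compl) (ho.inter hYc.isOpen_compl)
    · refine ContinuousOn.congr (f := fun z => exp (LX z / r)) ?_ ?_
      · exact (((continuousOn_logInc huv.le hγ.continuousOn).mono inter_subset_right).div_const _).cexp
      · intro z hz
        simp only [hR, if_neg hz.2]
    · refine ContinuousOn.congr (f := fun z => exp (LY z / r)) ?_ fun z hz => hRY z hz.1 hz.2
      refine ContinuousOn.cexp (ContinuousOn.div_const (ContinuousOn.sub (ContinuousOn.sub ?_ ?_) ?_) _)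
      · exact hg.mono fun z hz => hBε z hz.1.1
      · exact (continuousOn_logInc iu.1 hγ.continuousOn).mono fun z hz h => hz.2 (Or.inl h)
      · exact (continuousOn_logInc iv.2 hγ.continuousOn).mono fun z hz h => hz.2 (Or.inr h)
  · intro z hz h
    exact hBv z hz ⟨v, ⟨le_rfl, iv.2⟩, sub_eq_zero.1 h⟩
  · intro z hz
    by_cases hzX : z ∈ γ '' Icc u v
    · rw [hRY z hz (hcov z hz hzX), hpow, hLYe z hz (hcov z hz hzX)]
    · simp only [hR, if_neg hzX]
      rw [hpow, hLXe z hz hzX]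

end Arc

section Arc

variable {γ : ℝ → ℂ} {t : ℝ}

/-- The right-hand side, as a function of `z`, is a logarithm of the same quotient up to a constant
factor and vanishes at `w`; connectedness of `B` fixes the rest. -/
theorem sub_eq_log_sub_log {B : Set ℂ} (hB : Convex ℝ B) {a b : ℂ} {g : ℂ → ℂ}
    (hg : ContinuousOn g B) (hge : ∀ z ∈ B, exp (g z) = (b - z) / (a - z)) {z w : ℂ} (hz : z ∈ B)
    (hw : w ∈ B) :
    g z - g w = log ((b - z) / (b - w)) - log ((a - z) / (a - w)) := by
  -- At `a` the quotient is a division by zero, with value `0`, which no exponential takes.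
  have ha : a ∉ B := fun h => exp_ne_zero (g a) (by rw [hge a h]; simp)
  have hb : b ∉ B := fun h => exp_ne_zero (g b) (by rw [hge b h]; simp)
  have hne : ∀ {c x : ℂ}, c ∉ B → x ∈ B → c - x ≠ 0 := fun hc hx h =>
    hc (by rw [sub_eq_zero.1 h]; exact hx)
  have hcont : ∀ c : ℂ, c ∉ B → ContinuousOn (fun x => log ((c - x) / (c - w))) B := fun c hc =>
    ContinuousOn.clog (by fun_prop) fun x hx => sub_div_sub_mem_slitPlane hB hx hw hc
  have := hB.isPreconnected.eq_of_exp_eq (f := g)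
    (g := fun x => log ((b - x) / (b - w)) - log ((a - x) / (a - w)) + g w) hg
    (((hcont b hb).sub (hcont a ha)).add continuousOn_const) (by
      intro x hx
      rw [exp_add, exp_sub, exp_log_sub_div_sub hB hx hw hb, exp_log_sub_div_sub hB hx hw ha,
        hge x hx, hge w hw]
      have := hne ha hx; have := hne hb hx; have := hne ha hw; have := hne hb hw
      field_simp) hz hw (by
      rw [div_self (hne hb hw), div_self (hne ha hw)]; simp)
  rw [this]; ring

/-- The two end pieces avoid `B`, so their increments vary by principal logarithms, as does `g`.
What remains of the variation of the whole increment belongs to the middle piece. -/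
theorem logInc_middle (hγ : Continuous γ) {B : Set ℂ} (hB : Convex ℝ B) {g : ℂ → ℂ}
    (hg : ContinuousOn g B) (hge : ∀ z ∈ B, exp (g z) = (γ 1 - z) / (γ 0 - z)) {u v : ℝ}
    (h0u : 0 ≤ u) (huv : u ≤ v) (hv1 : v ≤ 1) (hd₀ : Disjoint B (γ '' Icc 0 u))
    (hd₁ : Disjoint B (γ '' Icc v 1)) {z w : ℂ} (hz : z ∈ B) (hw : w ∈ B)
    (hzA : z ∉ γ '' Icc 0 1) (hwA : w ∉ γ '' Icc 0 1) :
    logInc γ u v z - logInc γ u v w =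
      log ((γ v - z) / (γ v - w)) - log ((γ u - z) / (γ u - w))
        + ((logInc γ 0 1 z - g z) - (logInc γ 0 1 w - g w)) := by
  have hsplit : ∀ x, x ∉ γ '' Icc 0 1 →
      logInc γ 0 1 x = logInc γ 0 u x + (logInc γ u v x + logInc γ v 1 x) := by
    intro x hx
    have hx' : x ∉ γ '' Icc u 1 := fun h => hx (image_mono (Icc_subset_Icc_left h0u) h)
    rw [logInc_add huv hv1 hγ.continuousOn hx', logInc_add h0u (huv.trans hv1) hγ.continuousOn hx]
  have h1 := logInc_sub_logInc_of_convex h0u hγ.continuousOn hB hz hw hd₀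
  have h2 := logInc_sub_logInc_of_convex hv1 hγ.continuousOn hB hz hw hd₁
  have h3 := sub_eq_log_sub_log hB hg hge hz hw
  rw [hsplit z hzA, hsplit w hwA]
  linear_combination - h1 - h2 + h3

/-- Outside the small disc, principal logarithms of `(x - zᵢ) / (x - z₃)` work because the exponents
add up to zero. Along the middle piece a logarithm is lifted from `γ u`; the weighted condition on
the increments says exactly that it fits again at `γ v`. Three points are admitted in order to
exclude a third side. The circle encloses the components. -/
theorem exists_ball_hasLogOn (hγ : Continuous γ) (hinj : InjOn γ (Icc 0 1)) (ht : t ∈ Ioo (0:ℝ) 1)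
    {η : ℝ} (hη : 0 < η) {g : ℂ → ℂ} (hg : ContinuousOn g (Metric.ball (γ t) η))
    (hge : ∀ z ∈ Metric.ball (γ t) η, exp (g z) = (γ 1 - z) / (γ 0 - z)) :
    ∃ δ, 0 < δ ∧ δ < η ∧ ∀ z₁ ∈ Metric.ball (γ t) δ \ γ '' Icc 0 1,
      ∀ z₂ ∈ Metric.ball (γ t) δ \ γ '' Icc 0 1, ∀ z₃ ∈ Metric.ball (γ t) δ \ γ '' Icc 0 1,
      ∀ n₁ n₂ n₃ : ℤ, n₁ + n₂ + n₃ = 0 → n₁ * (logInc γ 0 1 z₁ - g z₁) +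
        n₂ * (logInc γ 0 1 z₂ - g z₂) + n₃ * (logInc γ 0 1 z₃ - g z₃) = 0 →
      HasLogOn (fun x => (x - z₁) ^ n₁ * ((x - z₂) ^ n₂ * (x - z₃) ^ n₃))
        (γ '' Icc 0 1 ∪ Metric.sphere (γ t) η) := by
  have hB : γ ⁻¹' Metric.ball (γ t) η ∈ 𝓝 t := hγ.continuousAt (Metric.ball_mem_nhds _ hη)
  obtain ⟨d, hd, hdB⟩ := Metric.mem_nhds_iff.1 hB
  set u := max (t / 2) (t - d / 2) with hu
  set v := min ((t + 1) / 2) (t + d / 2) with hv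
  have hut : u < t := max_lt (by linarith [ht.1]) (by linarith)
  have hu0 : 0 < u := lt_max_of_lt_left (by linarith [ht.1])
  have htv : t < v := lt_min (by linarith [ht.2]) (by linarith)
  have hv1 : v < 1 := min_lt_of_left_lt (by linarith [ht.2])
  have huvB : ∀ x ∈ Icc u v, γ x ∈ Metric.ball (γ t) η := fun x hx => hdB (by
    rw [Metric.mem_ball, Real.dist_eq, abs_lt]
    have h1 := le_max_right (t / 2) (t - d / 2)
    have h2 := min_le_right ((t + 1) / 2) (t + d / 2)
    constructor <;> linarith [hx.1, hx.2])
  have huv : u < v := hut.trans htv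
  have iu : u ∈ Icc (0:ℝ) 1 := ⟨hu0.le, (huv.trans hv1).le⟩
  have iv : v ∈ Icc (0:ℝ) 1 := ⟨(hu0.trans huv).le, hv1.le⟩
  have c0 : IsClosed (γ '' Icc 0 u) := (isCompact_Icc.image hγ).isClosed
  have c1 : IsClosed (γ '' Icc v 1) := (isCompact_Icc.image hγ).isClosed
  have cm : IsClosed (γ '' Icc u v) := (isCompact_Icc.image hγ).isClosed
  have ht' : t ∈ Icc (0:ℝ) 1 := ⟨ht.1.le, ht.2.le⟩
  have hpn : γ t ∈ (γ '' Icc 0 u)ᶜ ∩ (γ '' Icc v 1)ᶜ := by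
    constructor
    · rintro ⟨x, hx, hxe⟩
      have := hinj ⟨hx.1, hx.2.trans iu.2⟩ ht' hxe
      linarith [hx.2]
    · rintro ⟨x, hx, hxe⟩
      have := hinj ⟨iv.1.trans hx.1, hx.2⟩ ht' hxe
      linarith [hx.1]
  obtain ⟨δ₀, hδ₀, hδB⟩ := Metric.isOpen_iff.1 (c0.isOpen_compl.inter c1.isOpen_compl) _ hpn
  refine ⟨min δ₀ (η / 2), lt_min hδ₀ (by linarith), min_lt_of_right_lt (by linarith), ?_⟩
  set δ := min δ₀ (η / 2) with hδ
  have hδη : Metric.ball (γ t) δ ⊆ Metric.ball (γ t) η :=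
    Metric.ball_subset_ball ((min_le_right _ _).trans (by linarith))
  have hδ0 : ∀ x ∈ Metric.ball (γ t) δ, x ∉ γ '' Icc 0 u := fun x hx =>
    (hδB (Metric.ball_subset_ball (min_le_left _ _) hx)).1
  have hδ1 : ∀ x ∈ Metric.ball (γ t) δ, x ∉ γ '' Icc v 1 := fun x hx =>
    (hδB (Metric.ball_subset_ball (min_le_left _ _) hx)).2
  intro z₁ hz₁ z₂ hz₂ z₃ hz₃ n₁ n₂ n₃ hn hm
  have hconv := convex_ball (γ t) δ
  set Λ : ℂ → ℂ := fun x => n₁ * log ((x - z₁) / (x - z₃)) + n₂ * log ((x - z₂) / (x - z₃)) with hΛ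
  set K := γ '' Icc 0 u ∪ γ '' Icc v 1 ∪ Metric.sphere (γ t) η with hK
  have hKB : K ⊆ (Metric.ball (γ t) δ)ᶜ := by
    rintro x ((hx | hx) | hx) hxB
    · exact hδ0 x hxB hx
    · exact hδ1 x hxB hx
    · have := hδη hxB
      rw [Metric.mem_ball] at this
      exact this.ne hx
  have hΛc : ContinuousOn Λ K :=
    ((continuousOn_const.mul (continuousOn_log_sub_div_sub hconv hz₁.1 hz₃.1)).add
      (continuousOn_const.mul (continuousOn_log_sub_div_sub hconv hz₂.1 hz₃.1))).mono hKB
  have hΛe : ∀ x ∈ K, exp (Λ x) = (x - z₁) ^ n₁ * ((x - z₂) ^ n₂ * (x - z₃) ^ n₃) := by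
    intro x hx
    have hxB := hKB hx
    have h3 : x - z₃ ≠ 0 := fun h => hxB (by rw [sub_eq_zero.1 h]; exact hz₃.1)
    rw [hΛ, exp_add, exp_int_mul, exp_int_mul, exp_log_sub_div_sub hconv hz₁.1 hz₃.1 hxB,
      exp_log_sub_div_sub hconv hz₂.1 hz₃.1 hxB, show n₃ = -n₁ + -n₂ by linarith,
      zpow_add₀ h3, zpow_neg, zpow_neg, div_zpow, div_zpow]
    ring
  have hnA : ∀ {z}, z ∉ γ '' Icc 0 1 → z ∉ γ '' Icc u v := fun hz h =>
    hz (image_mono (Icc_subset_Icc iu.1 iv.2) h)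
  obtain ⟨l₁, hl₁, he₁⟩ := hasLogOn_curve hγ.continuousOn (hnA hz₁.2)
  obtain ⟨l₂, hl₂, he₂⟩ := hasLogOn_curve hγ.continuousOn (hnA hz₂.2)
  obtain ⟨l₃, hl₃, he₃⟩ := hasLogOn_curve hγ.continuousOn (hnA hz₃.2)
  have uuv : u ∈ Icc u v := left_mem_Icc.2 huv.le
  have vuv : v ∈ Icc u v := right_mem_Icc.2 huv.le
  have hle : ∀ s ∈ Icc u v, exp (n₁ * l₁ s + n₂ * l₂ s + n₃ * l₃ s) =
      (γ s - z₁) ^ n₁ * ((γ s - z₂) ^ n₂ * (γ s - z₃) ^ n₃) := by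
    intro s hs
    rw [exp_add, exp_add, exp_int_mul, exp_int_mul, exp_int_mul, he₁ s hs, he₂ s hs, he₃ s hs]
    ring
  have huK : γ u ∈ K := Or.inl (Or.inl ⟨u, ⟨iu.1, le_rfl⟩, rfl⟩)
  obtain ⟨k, hk⟩ := exists_int_of_exp_eq ((hΛe _ huK).trans (hle u uuv).symm)
  -- The multiple of `2πi` makes the lifted logarithm start with the value of `Λ` at `γ u`.
  set l : ℝ → ℂ := fun s => n₁ * l₁ s + n₂ * l₂ s + n₃ * l₃ s + 2 * Real.pi * I * k with hl
  have hlc : ContinuousOn l (Icc u v) := by fun_prop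
  have hlu : l u = Λ (γ u) := hk.symm
  have hd₀ : Disjoint (Metric.ball (γ t) δ) (γ '' Icc 0 u) := disjoint_left.2 hδ0
  have hd₁ : Disjoint (Metric.ball (γ t) δ) (γ '' Icc v 1) := disjoint_left.2 hδ1
  have hmid₁ := logInc_middle hγ hconv (hg.mono hδη) (fun z hz => hge z (hδη hz)) iu.1 huv.le iv.2
    hd₀ hd₁ hz₁.1 hz₃.1 hz₁.2 hz₃.2
  have hmid₂ := logInc_middle hγ hconv (hg.mono hδη) (fun z hz => hge z (hδη hz)) iu.1 huv.le iv.2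
    hd₀ hd₁ hz₂.1 hz₃.1 hz₂.2 hz₃.2
  rw [logInc_eq huv.le hl₁ he₁, logInc_eq huv.le hl₃ he₃] at hmid₁
  rw [logInc_eq huv.le hl₂ he₂, logInc_eq huv.le hl₃ he₃] at hmid₂
  have hlv : l v = Λ (γ v) := by
    have hn' : (n₃ : ℂ) = -n₁ - n₂ := by
      rw [show n₃ = -n₁ - n₂ by linarith]; push_cast; ring
    have hlu' := hlu
    simp only [hl, hΛ] at hlu' ⊢
    rw [hn'] at hm hlu' ⊢
    linear_combination hlu' + (n₁ : ℂ) * hmid₁ + (n₂ : ℂ) * hmid₂ + hm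
  -- transport to the plane
  set f : ℂ → ℂ := fun x => l (Function.invFunOn γ (Icc u v) x) with hf
  have hfγ : ∀ s ∈ Icc u v, f (γ s) = l s := by
    intro s hs
    have := (hinj.mono (Icc_subset_Icc iu.1 iv.2)).leftInvOn_invFunOn hs
    simp only [hf, this]
  have hunion := hasLogOn_union (h := fun x => (x - z₁) ^ n₁ * ((x - z₂) ^ n₂ * (x - z₃) ^ n₃))
    cm ((c0.union c1).union Metric.isClosed_sphere) (L₁ := f) (L₂ := Λ)
    (continuousOn_image_of_comp isCompact_Icc hγ.continuousOn (hlc.congr hfγ)) hΛc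
    (by
      rintro _ ⟨s, hs, rfl⟩
      rw [hfγ s hs, ← hle s hs, exp_add_two_pi_mul_int]) hΛe (by
      rintro _ ⟨s, hs, rfl⟩ hsK
      rw [hfγ s hs]
      rcases hsK with (⟨x, hx, hxe⟩ | ⟨x, hx, hxe⟩) | hS
      · have := hinj ⟨hx.1, hx.2.trans iu.2⟩ ⟨iu.1.trans hs.1, hs.2.trans iv.2⟩ hxe
        rw [show s = u by linarith [hx.2, hs.1], hlu]
      · have := hinj ⟨iv.1.trans hx.1, hx.2⟩ ⟨iu.1.trans hs.1, hs.2.trans iv.2⟩ hxe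
        rw [show s = v by linarith [hx.1, hs.2], hlv]
      -- The middle piece lies inside the open ball of radius `η`, so it never meets the circle.
      · exact absurd hS (Metric.mem_ball.1 (huvB s hs)).ne)
  refine hunion.mono ?_
  rintro x (⟨s, hs, rfl⟩ | hx)
  · rcases le_total s u with h | h
    · exact Or.inr (Or.inl (Or.inl ⟨s, ⟨hs.1, h⟩, rfl⟩))
    rcases le_total s v with h' | h'
    · exact Or.inl ⟨s, ⟨h, h'⟩, rfl⟩
    · exact Or.inr (Or.inl (Or.inr ⟨s, ⟨h', hs.2⟩, rfl⟩))
  · exact Or.inr (Or.inr hx)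

/-- The local structure of the plane at an interior point of an arc `γ`: there are two sides, which
are told apart by the increment of the logarithm along the arc. -/
theorem exists_sides (hγ : Continuous γ) (hinj : InjOn γ (Icc 0 1)) (ht : t ∈ Ioo (0:ℝ) 1)
    {η : ℝ} (hη : 0 < η) {g : ℂ → ℂ} (hg : ContinuousOn g (Metric.ball (γ t) η))
    (hge : ∀ z ∈ Metric.ball (γ t) η, exp (g z) = (γ 1 - z) / (γ 0 - z)) :
    ∃ k : ℤ, ∃ δ, 0 < δ ∧ δ < η ∧
      (∀ z ∈ Metric.ball (γ t) δ \ γ '' Icc 0 1, logInc γ 0 1 z = g z + 2 * Real.pi * I * k ∨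
        logInc γ 0 1 z = g z + 2 * Real.pi * I * (k + 1)) ∧
      (∀ ε > 0, ∃ z ∈ Metric.ball (γ t) ε \ γ '' Icc 0 1,
        logInc γ 0 1 z = g z + 2 * Real.pi * I * k) ∧
      (∀ ε > 0, ∃ z ∈ Metric.ball (γ t) ε \ γ '' Icc 0 1,
        logInc γ 0 1 z = g z + 2 * Real.pi * I * (k + 1)) ∧
      ∀ z ∈ Metric.ball (γ t) δ \ γ '' Icc 0 1, ∀ w ∈ Metric.ball (γ t) δ \ γ '' Icc 0 1,
        logInc γ 0 1 z - g z = logInc γ 0 1 w - g w →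
        w ∈ connectedComponentIn (Metric.ball (γ t) η \ γ '' Icc 0 1) z := by
  set A := γ '' Icc 0 1 with hA
  have hAc : IsCompact A := isCompact_Icc.image hγ
  obtain ⟨δ, hδ, hδη, hlog⟩ := exists_ball_hasLogOn hγ hinj ht hη hg hge
  have hδη' : Metric.ball (γ t) δ ⊆ Metric.ball (γ t) η := Metric.ball_subset_ball hδη.le
  have hint : ∀ z ∈ Metric.ball (γ t) η \ A, ∃ m : ℤ, logInc γ 0 1 z = g z + 2 * Real.pi * I * m := by
    intro z hz
    exact exists_int_of_exp_eq (by
      rw [exp_logInc zero_le_one hγ.continuousOn hz.2, hge z hz.1])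
  choose! m hm using hint
  have hmd : ∀ z ∈ Metric.ball (γ t) δ \ A, logInc γ 0 1 z = g z + 2 * Real.pi * I * m z :=
    fun z hz => hm z ⟨hδη' hz.1, hz.2⟩
  -- The added circle keeps the components of points near `γ t` bounded and inside the ball where
  -- `g` is defined.
  set K := A ∪ Metric.sphere (γ t) η with hK
  have hKc : IsCompact K := hAc.union (isCompact_sphere _ _)
  have hnK : ∀ z ∈ Metric.ball (γ t) δ \ A, z ∉ K := by
    rintro z hz (h | h)
    · exact hz.2 h
    · exact (Metric.mem_ball.1 (hδη' hz.1)).ne h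
  have hcomp : ∀ z ∈ Metric.ball (γ t) δ \ A,
      connectedComponentIn Kᶜ z ⊆ Metric.ball (γ t) η \ A := by
    intro z hz x hx
    have hpre := isPreconnected_connectedComponentIn (F := Kᶜ) (x := z)
    have hsub := connectedComponentIn_subset Kᶜ z
    refine ⟨?_, fun h => hsub hx (Or.inl h)⟩
    have hcov : connectedComponentIn Kᶜ z ⊆
        Metric.ball (γ t) η ∪ (Metric.closedBall (γ t) η)ᶜ := by
      intro y hy
      by_contra hn
      rw [mem_union, not_or, notMem_compl_iff] at hn
      exact hsub hy (Or.inr (le_antisymm hn.2 (not_lt.1 hn.1)))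
    have := hpre.subset_left_of_subset_union Metric.isOpen_ball Metric.isClosed_closedBall.isOpen_compl
      (disjoint_compl_right_iff_subset.2 Metric.ball_subset_closedBall) hcov
      ⟨z, mem_connectedComponentIn (hnK z hz), hδη' hz.1⟩
    exact this hx
  have hconst : ∀ z ∈ Metric.ball (γ t) δ \ A, ∀ w ∈ Metric.ball (γ t) δ \ A,
      w ∈ connectedComponentIn Kᶜ z → m w = m z := by
    intro z hz w hw hwz
    have hpre := isPreconnected_connectedComponentIn (F := Kᶜ) (x := z)
    have hsub := hcomp z hz
    have := hpre.sub_eq_of_exp_eq (f := logInc γ 0 1) (g := g)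
      ((continuousOn_logInc zero_le_one hγ.continuousOn).mono fun x hx => (hsub hx).2)
      (hg.mono fun x hx => (hsub hx).1) (fun x hx => by
        rw [exp_logInc zero_le_one hγ.continuousOn (hsub hx).2, hge x (hsub hx).1]) hwz
      (mem_connectedComponentIn (hnK z hz))
    rw [hmd z hz, hmd w hw] at this
    have h2 : (2 * Real.pi * I : ℂ) * m w = 2 * Real.pi * I * m z := by linear_combination this
    exact_mod_cast mul_left_cancel₀ two_pi_I_ne_zero' h2
  have hsame : ∀ z ∈ Metric.ball (γ t) δ \ A, ∀ w ∈ Metric.ball (γ t) δ \ A, m z = m w →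
      connectedComponentIn Kᶜ z = connectedComponentIn Kᶜ w := by
    intro z hz w hw hzw
    refine connectedComponentIn_eq_of_hasLogOn hKc (hnK z hz) (hnK w hw) ?_
    have := hlog z hz w hw w hw 1 (-1) 0 (by norm_num) (by
      rw [hmd z hz, hmd w hw, hzw]; push_cast; ring)
    simpa [div_eq_mul_inv] using this
  -- The exponents `m z₂ - m z₃`, `m z₃ - m z₁`, `m z₁ - m z₂` satisfy both linear conditions of
  -- `hlog`. Eilenberg's criterion at `z₁` then forces the first of them to vanish.
  have hthree : ∀ z₁ ∈ Metric.ball (γ t) δ \ A, ∀ z₂ ∈ Metric.ball (γ t) δ \ A,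
      ∀ z₃ ∈ Metric.ball (γ t) δ \ A, m z₁ ≠ m z₂ → m z₁ ≠ m z₃ → m z₂ = m z₃ := by
    intro z₁ h₁ z₂ h₂ z₃ h₃ h12 h13
    have := eq_zero_of_hasLogOn hKc.isClosed (hnK _ h₁) (hnK _ h₂) (hnK _ h₃)
      (Metric.isBounded_ball.subset fun x hx => (hcomp z₁ h₁ hx).1)
      (fun h => h12 (hconst z₁ h₁ z₂ h₂ h).symm) (fun h => h13 (hconst z₁ h₁ z₃ h₃ h).symm)
      (hlog z₁ h₁ z₂ h₂ z₃ h₃ (m z₂ - m z₃) (m z₃ - m z₁) (m z₁ - m z₂) (by ring) (by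
        rw [hmd _ h₁, hmd _ h₂, hmd _ h₃]; push_cast; ring))
    linarith
  -- No neighbourhood of `γ t` has all values of `m` in one residue class modulo `r ≠ ±1`. For `r =
  -- 0` this says that `m` is not constant there, which follows from the case of modulus `2`.
  have hnc : ∀ ε, 0 < ε → ε ≤ η → ∀ k r : ℤ, r ≠ 1 → r ≠ -1 →
      ¬ ∀ z ∈ Metric.ball (γ t) ε \ A, ∃ j : ℤ, m z = k + r * j := by
    have aux : ∀ ε, 0 < ε → ε ≤ η → ∀ (k : ℤ) (r : ℕ), r ≠ 0 → r ≠ 1 →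
      ¬ ∀ z ∈ Metric.ball (γ t) ε \ A, ∃ j : ℤ, m z = k + r * j := by
      intro ε hε hεη k r hr0 hr1 hcon
      have hsub := Metric.ball_subset_ball (x := γ t) hεη
      refine hr1 (eq_one_of_logInc_congr hγ hinj ht hε (g := fun z => g z + 2 * Real.pi * I * k)
        ((hg.mono hsub).add continuousOn_const) (fun z hz => ?_) hr0 fun z hz => ?_)
      · rw [exp_add_two_pi_mul_int, hge z (hsub hz)]
      · obtain ⟨j, hj⟩ := hcon z hz
        refine ⟨j, ?_⟩
        rw [hm z ⟨hsub hz.1, hz.2⟩, hj]; push_cast; ring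
    intro ε hε hεη k r h1 h2 hcon
    rcases eq_or_ne r 0 with rfl | hr
    · exact aux ε hε hεη k 2 (by norm_num) (by norm_num) fun z hz => by
        obtain ⟨j, hj⟩ := hcon z hz
        exact ⟨0, by simpa using hj⟩
    · refine aux ε hε hεη k r.natAbs (by simpa using hr) (by omega) fun z hz => ?_
      obtain ⟨j, hj⟩ := hcon z hz
      refine ⟨r.sign * j, ?_⟩
      rw [hj, ← mul_assoc, mul_comm (r.natAbs : ℤ), Int.sign_mul_natAbs]
  -- two consecutive values
  obtain ⟨k, a, ha, b, hb, hak, hbk⟩ : ∃ k : ℤ, ∃ a ∈ Metric.ball (γ t) δ \ A,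
      ∃ b ∈ Metric.ball (γ t) δ \ A, m a = k ∧ m b = k + 1 := by
    obtain ⟨a, ha⟩ : (Metric.ball (γ t) δ \ A).Nonempty := by
      by_contra hne
      rw [not_nonempty_iff_eq_empty] at hne
      exact hnc δ hδ hδη.le 0 0 (by norm_num) (by norm_num) (by simp [hne])
    obtain ⟨b, hb, hab⟩ : ∃ b ∈ Metric.ball (γ t) δ \ A, m b ≠ m a := by
      by_contra! hcon
      exact hnc δ hδ hδη.le (m a) 0 (by norm_num) (by norm_num) fun z hz => ⟨0, by simp [hcon z hz]⟩
    have hr : m b - m a = 1 ∨ m b - m a = -1 := by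
      by_contra! hcon
      refine hnc δ hδ hδη.le (m a) (m b - m a) hcon.1 hcon.2 fun z hz => ?_
      by_cases hza : m z = m a
      · exact ⟨0, by simp [hza]⟩
      · exact ⟨1, by rw [hthree a ha z hz b hb (Ne.symm hza) hab.symm]; ring⟩
    rcases hr with hr | hr
    · exact ⟨m a, a, ha, b, hb, rfl, by linarith⟩
    · exact ⟨m b, b, hb, a, ha, rfl, by linarith⟩
  have htwo : ∀ z ∈ Metric.ball (γ t) δ \ A, m z = k ∨ m z = k + 1 := by
    intro z hz
    by_cases hza : m z = m a
    · exact Or.inl (hza.trans hak)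
    · exact Or.inr ((hthree a ha z hz b hb (Ne.symm hza) (by omega)).trans hbk)
  have hacc : ∀ ε > 0, ∀ k', (∀ z ∈ Metric.ball (γ t) δ \ A, m z = k + (k + 1 - k') ∨ m z = k') →
      ∃ z ∈ Metric.ball (γ t) ε \ A, logInc γ 0 1 z = g z + 2 * Real.pi * I * k' := by
    intro ε hε k' hk'
    by_contra! hcon
    have hmin : Metric.ball (γ t) (min ε δ) ⊆ Metric.ball (γ t) δ :=
      Metric.ball_subset_ball (min_le_right _ _)
    refine hnc (min ε δ) (lt_min hε hδ) ((min_le_right _ _).trans hδη.le) (k + (k + 1 - k')) 0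
      (by norm_num) (by norm_num) fun z hz => ⟨0, ?_⟩
    rcases hk' z ⟨hmin hz.1, hz.2⟩ with h | h
    · simpa using h
    · refine absurd ?_ (hcon z ⟨Metric.ball_subset_ball (min_le_left _ _) hz.1, hz.2⟩)
      rw [hmd z ⟨hmin hz.1, hz.2⟩, h]
  refine ⟨k, δ, hδ, hδη, fun z hz => ?_, fun ε hε => ?_, fun ε hε => ?_, fun z hz w hw hzw => ?_⟩
  · rcases htwo z hz with h | h
    · left; rw [hmd z hz, h]
    · right; rw [hmd z hz, h]; push_cast; ring
  · exact hacc ε hε k fun z hz => (htwo z hz).symm.imp (fun h => by rw [h]; ring) id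
  · have := hacc ε hε (k + 1) fun z hz => (htwo z hz).imp (fun h => by rw [h]; ring) id
    push_cast at this
    exact this
  · have hmm : m z = m w := by
      rw [hmd z hz, hmd w hw] at hzw
      have h2 : (2 * Real.pi * I : ℂ) * m z = 2 * Real.pi * I * m w := by linear_combination hzw
      exact_mod_cast mul_left_cancel₀ two_pi_I_ne_zero' h2
    have hw' : w ∈ connectedComponentIn Kᶜ z := by
      rw [hsame z hz w hw hmm]; exact mem_connectedComponentIn (hnK w hw)
    exact isPreconnected_connectedComponentIn.subset_connectedComponentIn
      (mem_connectedComponentIn (hnK z hz)) (hcomp z hz) hw'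

end Arc

/-! ### Winding numbers of closed paths and the sides of an arc -/

theorem path_image_extend {a b : ℂ} (γ : Path a b) : γ.extend '' Icc 0 1 = range γ :=
  γ.image_extend_of_subset Subset.rfl

theorem path_injOn_extend {a b : ℂ} {γ : Path a b} (hγ : Function.Injective γ) :
    InjOn γ.extend (Icc 0 1) := by
  intro s hs t ht hst
  rw [γ.extend_apply hs, γ.extend_apply ht] at hst
  exact congrArg Subtype.val (hγ hst)

theorem trans_apply_extend {a b d : ℂ} (γ : Path a b) (c : Path b d) (t : unitInterval) :
    (γ.trans c) t = if (t : ℝ) ≤ 1 / 2 then γ.extend (2 * t) else c.extend (2 * t - 1) := rfl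

/-- A logarithm along the concatenation consists of rescaled logarithms along its two halves,
shifted to agree at the junction `b`. -/
theorem hasWinding_trans_iff {a b : ℂ} (γ : Path a b) (c : Path b a) (z : ℂ) (k : ℤ) :
    HasWinding (γ.trans c) z k ↔ z ∉ range γ ∧ z ∉ range c ∧
      logInc γ.extend 0 1 z + logInc c.extend 0 1 z = 2 * Real.pi * I * k := by
  constructor
  · rintro ⟨l, hl, hk⟩
    set l' : ℝ → ℂ := fun s => l (projIcc 0 1 zero_le_one s) with hl'
    have hl'c : Continuous l' := l.continuous.comp continuous_projIcc
    have h1 : ∀ s ∈ Icc (0:ℝ) 1, exp (l' (s / 2)) = γ.extend s - z := by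
      intro s hs
      have hm : s / 2 ∈ Icc (0:ℝ) 1 := ⟨by linarith [hs.1], by linarith [hs.2]⟩
      simp only [hl']
      rw [projIcc_of_mem _ hm, hl, trans_apply_extend, if_pos (by simp only; linarith [hs.2])]
      simp only
      rw [mul_div_cancel₀ s two_ne_zero]
    have h2 : ∀ s ∈ Icc (0:ℝ) 1, exp (l' ((s + 1) / 2)) = c.extend s - z := by
      intro s hs
      have hm : (s + 1) / 2 ∈ Icc (0:ℝ) 1 := ⟨by linarith [hs.1], by linarith [hs.2]⟩
      simp only [hl']
      rw [projIcc_of_mem _ hm, hl, trans_apply_extend]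
      simp only
      rcases hs.1.eq_or_lt with rfl | h0
      · rw [if_pos (by norm_num)]; norm_num
      · rw [if_neg (by linarith), mul_div_cancel₀ _ two_ne_zero, add_sub_cancel_right]
    refine ⟨?_, ?_, ?_⟩
    · rw [← path_image_extend]
      rintro ⟨s, hs, rfl⟩
      exact exp_ne_zero _ ((h1 s hs).trans (sub_self _))
    · rw [← path_image_extend]
      rintro ⟨s, hs, rfl⟩
      exact exp_ne_zero _ ((h2 s hs).trans (sub_self _))
    · rw [logInc_eq zero_le_one (l := fun s => l' (s / 2)) (by fun_prop) h1,
        logInc_eq zero_le_one (l := fun s => l' ((s + 1) / 2)) (by fun_prop) h2, ← hk]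
      have e1 : l' ((1 + 1) / 2) = l 1 := by
        rw [hl']; norm_num
      have e2 : l' (0 / 2) = l 0 := by
        rw [hl']; norm_num
      simp only [e1, e2, zero_add]; ring
  · rintro ⟨hz, hzc, hk⟩
    rw [← path_image_extend] at hz hzc
    obtain ⟨l₁, h₁, he₁⟩ := hasLogOn_curve γ.continuous_extend.continuousOn hz
    obtain ⟨l₂, h₂, he₂⟩ := hasLogOn_curve c.continuous_extend.continuousOn hzc
    have i0 : (0:ℝ) ∈ Icc (0:ℝ) 1 := by simp
    have i1 : (1:ℝ) ∈ Icc (0:ℝ) 1 := by simp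
    have hb : exp (l₁ 1 - l₂ 0) = 1 := by
      have : b - z ≠ 0 := fun h => hz ⟨1, i1, by rw [γ.extend_one]; exact sub_eq_zero.1 h⟩
      rw [exp_sub, he₁ 1 i1, he₂ 0 i0]
      simp only [γ.extend_one, c.extend_zero, div_self this]
    refine ⟨⟨fun t => if (t : ℝ) ≤ 1 / 2 then l₁ (projIcc 0 1 zero_le_one (2 * (t : ℝ)))
      else l₂ (projIcc 0 1 zero_le_one (2 * (t : ℝ) - 1)) + (l₁ 1 - l₂ 0), ?_⟩, ?_, ?_⟩
    · have c₁ : Continuous fun s : ℝ => l₁ (projIcc 0 1 zero_le_one s) :=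
        (continuousOn_iff_continuous_domRestrict.1 h₁).comp continuous_projIcc
      have c₂ : Continuous fun s : ℝ => l₂ (projIcc 0 1 zero_le_one s) :=
        (continuousOn_iff_continuous_domRestrict.1 h₂).comp continuous_projIcc
      refine Continuous.if_le (c₁.comp (by fun_prop)) ((c₂.comp (by fun_prop)).add continuous_const)
        continuous_subtype_val continuous_const ?_
      intro t ht
      simp [ht]
    · intro t
      rw [trans_apply_extend]
      simp only [ContinuousMap.coe_mk]
      split_ifs with h
      · have hm : (2 * (t:ℝ)) ∈ Icc (0:ℝ) 1 := ⟨by linarith [t.2.1], by linarith⟩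
        rw [projIcc_of_mem _ hm]
        exact he₁ _ hm
      · have hm : (2 * (t:ℝ) - 1) ∈ Icc (0:ℝ) 1 := ⟨by linarith, by linarith [t.2.2]⟩
        rw [projIcc_of_mem _ hm, exp_add, hb, mul_one]
        exact he₂ _ hm
    · rw [← hk, logInc_eq zero_le_one h₁ he₁, logInc_eq zero_le_one h₂ he₂]
      have : ¬ ((1:ℝ) ≤ 1 / 2) := by norm_num
      simp only [ContinuousMap.coe_mk, Set.Icc.coe_one, Set.Icc.coe_zero, if_neg this]
      norm_num
      ring

/-- Near the point `p`, the set `f₀` has points on the right-hand side of the arc `γ`, and the set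
`f₁` has points on its left-hand side. -/
def TwoSided (γ : ℝ → ℂ) (p : ℂ) (f₀ f₁ : Set ℂ) : Prop :=
  ∃ η > 0, ∃ g : ℂ → ℂ, ContinuousOn g (Metric.ball p η) ∧
    (∀ z ∈ Metric.ball p η, exp (g z) = (γ 1 - z) / (γ 0 - z)) ∧
    (∀ ε > 0, ∃ z ∈ Metric.ball p ε \ γ '' Icc 0 1, z ∈ f₀ ∧ logInc γ 0 1 z = g z) ∧
    (∀ ε > 0, ∃ z ∈ Metric.ball p ε \ γ '' Icc 0 1, z ∈ f₁ ∧
      logInc γ 0 1 z = g z + 2 * Real.pi * I)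

/-- A logarithm `F` on the arc as a point set serves every parametrisation, so the increment depends
only on the image and the ends. -/
theorem logInc_eq_of_image {γ γ' : ℝ → ℂ} (hγ : Continuous γ) (hγ' : Continuous γ')
    (hinj : InjOn γ (Icc 0 1)) (him : γ' '' Icc 0 1 = γ '' Icc 0 1) {z : ℂ}
    (hz : z ∉ γ '' Icc 0 1) : ∃ F : ℂ → ℂ, logInc γ 0 1 z = F (γ 1) - F (γ 0) ∧
      logInc γ' 0 1 z = F (γ' 1) - F (γ' 0) := by
  obtain ⟨l, hl, he⟩ := hasLogOn_curve hγ.continuousOn hz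
  set F : ℂ → ℂ := fun x => l (Function.invFunOn γ (Icc 0 1) x) with hF
  have hFγ : ∀ s ∈ Icc (0:ℝ) 1, F (γ s) = l s := by
    intro s hs
    simp only [hF, hinj.leftInvOn_invFunOn hs]
  have hFc : ContinuousOn F (γ '' Icc 0 1) :=
    continuousOn_image_of_comp isCompact_Icc hγ.continuousOn (hl.congr hFγ)
  have hFe : ∀ x ∈ γ '' Icc 0 1, exp (F x) = x - z := by
    rintro _ ⟨s, hs, rfl⟩
    rw [hFγ s hs, he s hs]
  have hm : MapsTo γ' (Icc 0 1) (γ '' Icc 0 1) := by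
    rw [← him]; exact mapsTo_image _ _
  exact ⟨F, logInc_eq zero_le_one (l := fun s => F (γ s))
    (hFc.comp hγ.continuousOn (mapsTo_image _ _)) (fun x hx => hFe _ ⟨x, hx, rfl⟩),
    logInc_eq zero_le_one (l := fun s => F (γ' s))
    (hFc.comp hγ'.continuousOn hm) (fun x hx => hFe _ (hm hx))⟩

theorem TwoSided.of_image_eq {γ γ' : ℝ → ℂ} (hγ : Continuous γ) (hγ' : Continuous γ')
    (hinj : InjOn γ (Icc 0 1)) (him : γ' '' Icc 0 1 = γ '' Icc 0 1) (h0 : γ' 0 = γ 0)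
    (h1 : γ' 1 = γ 1) {p : ℂ} {f₀ f₁ : Set ℂ} (h : TwoSided γ p f₀ f₁) : TwoSided γ' p f₀ f₁ := by
  have key : ∀ z ∉ γ '' Icc 0 1, logInc γ' 0 1 z = logInc γ 0 1 z := by
    intro z hz
    obtain ⟨F, hF, hF'⟩ := logInc_eq_of_image hγ hγ' hinj him hz
    rw [hF, hF', h0, h1]
  obtain ⟨η, hη, g, hg, hge, ha, hb⟩ := h
  refine ⟨η, hη, g, hg, by rwa [h0, h1], fun ε hε => ?_, fun ε hε => ?_⟩
  · obtain ⟨z, hz, hzf, hzg⟩ := ha ε hε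
    exact ⟨z, by rwa [him], hzf, by rw [key z hz.2, hzg]⟩
  · obtain ⟨z, hz, hzf, hzg⟩ := hb ε hε
    exact ⟨z, by rwa [him], hzf, by rw [key z hz.2, hzg]⟩

theorem TwoSided.of_image_eq_of_reverse {γ γ' : ℝ → ℂ} (hγ : Continuous γ) (hγ' : Continuous γ')
    (hinj : InjOn γ (Icc 0 1)) (him : γ' '' Icc 0 1 = γ '' Icc 0 1) (h0 : γ' 0 = γ 1)
    (h1 : γ' 1 = γ 0) {p : ℂ} {f₀ f₁ : Set ℂ} (h : TwoSided γ p f₀ f₁) : TwoSided γ' p f₁ f₀ := by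
  have key : ∀ z ∉ γ '' Icc 0 1, logInc γ' 0 1 z = - logInc γ 0 1 z := by
    intro z hz
    obtain ⟨F, hF, hF'⟩ := logInc_eq_of_image hγ hγ' hinj him hz
    rw [hF, hF', h0, h1]; ring
  obtain ⟨η, hη, g, hg, hge, ha, hb⟩ := h
  -- Reversal negates increments: the former left value `g + 2πi` becomes the new base value, and
  -- the former right value `g` becomes the new base plus `2πi`.
  refine ⟨η, hη, fun z => - g z - 2 * Real.pi * I, by fun_prop, fun z hz => ?_, fun ε hε => ?_,
    fun ε hε => ?_⟩
  · rw [h0, h1, exp_sub, exp_neg, hge z hz, exp_two_pi_mul_I, div_one, inv_div]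
  · obtain ⟨z, hz, hzf, hzg⟩ := hb ε hε
    exact ⟨z, by rwa [him], hzf, by rw [key z hz.2, hzg]; ring⟩
  · obtain ⟨z, hz, hzf, hzg⟩ := ha ε hε
    exact ⟨z, by rwa [him], hzf, by rw [key z hz.2, hzg]; ring⟩

theorem exists_ball_logInc_add {a b : ℂ} (c : Path b a) {p : ℂ} (hp : p ∉ range c) :
    ∃ η > 0, ContinuousOn (logInc c.extend 0 1) (Metric.ball p η) ∧
      ∀ z ∈ Metric.ball p η, z ∉ range c ∧ exp (logInc c.extend 0 1 z) = (a - z) / (b - z) := by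
  have hcl : IsClosed (range c) := (isCompact_range c.continuous).isClosed
  obtain ⟨η, hη, hB⟩ := Metric.isOpen_iff.1 hcl.isOpen_compl p hp
  refine ⟨η, hη, ?_, fun z hz => ⟨hB hz, ?_⟩⟩
  · refine (continuousOn_logInc zero_le_one c.continuous_extend.continuousOn).mono ?_
    rwa [path_image_extend]
  · rw [exp_logInc zero_le_one c.continuous_extend.continuousOn (by
      rw [path_image_extend]; exact hB hz), c.extend_one, c.extend_zero]

theorem IsOnLeft.exists_twoSided {a b : ℂ} {γ : Path a b} {f : Set ℂ} (h : IsOnLeft γ f) :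
    ∃ t ∈ Ioo (0:ℝ) 1, TwoSided γ.extend (γ.extend t) univ f := by
  obtain ⟨t, ht, c, hc, k, h0, h1⟩ := h
  refine ⟨t, ⟨ht.1, ht.2⟩, ?_⟩
  rw [γ.extend_extends']
  obtain ⟨η, hη, hcont, hexp⟩ := exists_ball_logInc_add c hc
  -- Subtracting the increment along the closing curve turns winding numbers `k` and `k + 1` into
  -- the increments `g` and `g + 2πi` along `γ`.
  refine ⟨η, hη, fun z => 2 * Real.pi * I * k - logInc c.extend 0 1 z, by fun_prop, ?_, ?_, ?_⟩
  · intro z hz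
    have : exp (2 * Real.pi * I * k) = 1 := by
      have := exp_add_two_pi_mul_int 0 k
      rwa [zero_add, exp_zero] at this
    rw [exp_sub, (hexp z hz).2, γ.extend_one, γ.extend_zero, this, one_div, inv_div]
  · intro ε hε
    obtain ⟨z, hz, hzd⟩ := Metric.mem_closure_iff.1 h0 ε hε
    obtain ⟨h1, h2, h3⟩ := (hasWinding_trans_iff γ c z k).1 hz
    exact ⟨z, ⟨by rwa [Metric.mem_ball, dist_comm], by rwa [path_image_extend]⟩, trivial, by
      linear_combination h3⟩
  · intro ε hε
    obtain ⟨z, ⟨hzf, hz⟩, hzd⟩ := Metric.mem_closure_iff.1 h1 ε hε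
    obtain ⟨h1, h2, h3⟩ := (hasWinding_trans_iff γ c z (k + 1)).1 hz
    push_cast at h3
    exact ⟨z, ⟨by rwa [Metric.mem_ball, dist_comm], by rwa [path_image_extend]⟩, hzf, by
      linear_combination h3⟩

theorem TwoSided.isOnLeft {a b : ℂ} {γ : Path a b} (hγ : Function.Injective γ) {f : Set ℂ} {t : ℝ}
    (ht : t ∈ Ioo (0:ℝ) 1) (h : TwoSided γ.extend (γ.extend t) univ f) : IsOnLeft γ f := by
  have ht' : t ∈ Icc (0:ℝ) 1 := ⟨ht.1.le, ht.2.le⟩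
  rw [γ.extend_apply ht'] at h
  set s : unitInterval := ⟨t, ht'⟩ with hs
  have hsa : γ s ≠ a := by
    intro h0
    have := hγ (h0.trans γ.source.symm)
    exact ht.1.ne' (congrArg Subtype.val this)
  have hsb : γ s ≠ b := by
    intro h0
    have := hγ (h0.trans γ.target.symm)
    exact ht.2.ne (congrArg Subtype.val this)
  have hpc := isPathConnected_compl_singleton_of_one_lt_rank (E := ℂ)
    (rank_real_complex ▸ Nat.one_lt_ofNat) (γ s)
  obtain ⟨c, hc⟩ := hpc.joinedIn b hsb.symm a hsa.symm
  have hp : γ s ∉ range c := by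
    rintro ⟨x, hx⟩
    exact hc x hx
  obtain ⟨η', hη', hcont, hexp⟩ := exists_ball_logInc_add c hp
  obtain ⟨η, hη, g, hg, hge, h0, h1⟩ := h
  have hm1 : Metric.ball (γ s) (min η η') ⊆ Metric.ball (γ s) η :=
    Metric.ball_subset_ball (min_le_left _ _)
  have hm2 : Metric.ball (γ s) (min η η') ⊆ Metric.ball (γ s) η' :=
    Metric.ball_subset_ball (min_le_right _ _)
  -- Near `γ s` both `-g` and the increment along `c` are logarithms of the same quotient; the
  -- integer by which they differ is the winding number on the right-hand side.
  obtain ⟨k, hk⟩ := (convex_ball (γ s) (min η η')).isPreconnected.eq_add_of_exp_eq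
    (f := fun z => logInc c.extend 0 1 z) (g := fun z => - g z) (hcont.mono hm2) (hg.mono hm1).neg
    (fun z hz => by
      rw [(hexp z (hm2 hz)).2, exp_neg, hge z (hm1 hz), γ.extend_one, γ.extend_zero, inv_div])
  refine ⟨s, ⟨ht.1, ht.2⟩, c, hp, k, ?_, ?_⟩
  · refine Metric.mem_closure_iff.2 fun ε hε => ?_
    obtain ⟨z, hz, -, hzg⟩ := h0 (min ε (min η η')) (lt_min hε (lt_min hη hη'))
    have hzm := Metric.ball_subset_ball (min_le_right _ _) hz.1
    refine ⟨z, ?_, ?_⟩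
    · refine (hasWinding_trans_iff γ c z k).2 ⟨?_, (hexp z (hm2 hzm)).1, ?_⟩
      · rw [← path_image_extend]; exact hz.2
      · rw [hzg, hk z hzm]; ring
    · rw [dist_comm]; exact Metric.ball_subset_ball (min_le_left _ _) hz.1
  · refine Metric.mem_closure_iff.2 fun ε hε => ?_
    obtain ⟨z, hz, hzf, hzg⟩ := h1 (min ε (min η η')) (lt_min hε (lt_min hη hη'))
    have hzm := Metric.ball_subset_ball (min_le_right _ _) hz.1
    refine ⟨z, ⟨hzf, ?_⟩, ?_⟩
    · refine (hasWinding_trans_iff γ c z (k + 1)).2 ⟨?_, (hexp z (hm2 hzm)).1, ?_⟩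
      · rw [← path_image_extend]; exact hz.2
      · rw [hzg, hk z hzm]; push_cast; ring
    · rw [dist_comm]; exact Metric.ball_subset_ball (min_le_left _ _) hz.1

/-! ### The faces on the two sides of an arc -/

/-- The components of `Zᶜ` on the right-hand side and on the left-hand side of the arc `γ`, near its
point `p`, are `f₀` and `f₁`. -/
def SidePair (Z : Set ℂ) (γ : ℝ → ℂ) (p : ℂ) (f₀ f₁ : Set ℂ) : Prop :=
  ∃ η > 0, ∃ g : ℂ → ℂ, ContinuousOn g (Metric.ball p η) ∧
    (∀ z ∈ Metric.ball p η, exp (g z) = (γ 1 - z) / (γ 0 - z)) ∧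
    (∀ ε > 0, ∃ z ∈ Metric.ball p ε \ γ '' Icc 0 1, logInc γ 0 1 z = g z) ∧
    (∀ ε > 0, ∃ z ∈ Metric.ball p ε \ γ '' Icc 0 1, logInc γ 0 1 z = g z + 2 * Real.pi * I) ∧
    ∀ z ∈ Metric.ball p η \ γ '' Icc 0 1, z ∉ Z ∧
      ((logInc γ 0 1 z = g z ∧ connectedComponentIn Zᶜ z = f₀) ∨
      (logInc γ 0 1 z = g z + 2 * Real.pi * I ∧ connectedComponentIn Zᶜ z = f₁))

section

variable {γ : ℝ → ℂ} {t : ℝ} {Z : Set ℂ} {p : ℂ} {f₀ f₁ : Set ℂ}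

/-- The two bases differ by `2πik`. A point on the right leaves `k = 0` or `-1`, a point on the left
`k = 1` or `0`. So the base of a two-sided description is unique. -/
theorem eq_of_exp_eq_of_sides {p : ℂ} {η : ℝ} {A : Set ℂ} {g g' L : ℂ → ℂ}
    (hg : ContinuousOn g (Metric.ball p η)) (hg' : ContinuousOn g' (Metric.ball p η))
    (he : ∀ z ∈ Metric.ball p η, exp (g z) = exp (g' z))
    (h0 : ∃ z ∈ Metric.ball p η \ A, L z = g' z)
    (h1 : ∃ z ∈ Metric.ball p η \ A, L z = g' z + 2 * Real.pi * I)
    (hL : ∀ z ∈ Metric.ball p η \ A, L z = g z ∨ L z = g z + 2 * Real.pi * I) :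
    ∀ z ∈ Metric.ball p η, g' z = g z := by
  obtain ⟨k, hk⟩ := (convex_ball p η).isPreconnected.eq_add_of_exp_eq hg hg' he
  have key : ∀ m n : ℤ, (2 * Real.pi * I * m : ℂ) = 2 * Real.pi * I * n → m = n := fun m n h => by
    exact_mod_cast mul_left_cancel₀ two_pi_I_ne_zero' h
  obtain ⟨z, hz, hzg⟩ := h0
  obtain ⟨w, hw, hwg⟩ := h1
  have e0 : k = 0 ∨ k = -1 := by
    rcases hL z hz with h | h
    · left; apply key; rw [hzg, hk z hz.1] at h; push_cast; linear_combination -h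
    · right; apply key; rw [hzg, hk z hz.1] at h; push_cast; linear_combination -h
  have e1 : k = 1 ∨ k = 0 := by
    rcases hL w hw with h | h
    · left; apply key; rw [hwg, hk w hw.1] at h; push_cast; linear_combination -h
    · right; apply key; rw [hwg, hk w hw.1] at h; push_cast; linear_combination -h
  have : k = 0 := by omega
  intro x hx
  rw [hk x hx, this]; simp

/-- The rest `S` of the drawing stays away from a small disc around `γ t`, so connections found
within the disc off the arc are connections off `Z`. -/
theorem exists_sidePair (hγ : Continuous γ) (hinj : InjOn γ (Icc 0 1)) (ht : t ∈ Ioo (0:ℝ) 1)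
    {S : Set ℂ} (hS : IsClosed S) (hp : γ t ∉ S) (hZ : Z = γ '' Icc 0 1 ∪ S) :
    ∃ f₀ f₁, SidePair Z γ (γ t) f₀ f₁ := by
  have ht' : t ∈ Icc (0:ℝ) 1 := ⟨ht.1.le, ht.2.le⟩
  have h0 : γ t ≠ γ 0 := fun h => ht.1.ne' (hinj ht' (by simp) h)
  have h1 : γ t ≠ γ 1 := fun h => ht.2.ne (hinj ht' (by simp) h)
  obtain ⟨η, hη, hB⟩ := Metric.isOpen_iff.1
    ((hS.isOpen_compl.inter (isOpen_compl_singleton (x := γ 0))).inter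
      (isOpen_compl_singleton (x := γ 1))) (γ t) ⟨⟨hp, h0⟩, h1⟩
  have hr : ContinuousOn (fun z => (γ 1 - z) / (γ 0 - z)) (Metric.ball (γ t) η) :=
    ContinuousOn.div (by fun_prop) (by fun_prop) fun z hz h => (hB hz).1.2 (sub_eq_zero.1 h).symm
  obtain ⟨g, hg, hge⟩ := (convex_ball (γ t) η).hasLogOn Metric.isOpen_ball hr
    fun z hz => div_ne_zero (fun h => (hB hz).2 (sub_eq_zero.1 h).symm)
      (fun h => (hB hz).1.2 (sub_eq_zero.1 h).symm)
  obtain ⟨k, δ, hδ, hδη, htwo, hacc0, hacc1, hconn⟩ := exists_sides hγ hinj ht hη hg hge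
  obtain ⟨a, ha, hak⟩ := hacc0 δ hδ
  obtain ⟨b, hb, hbk⟩ := hacc1 δ hδ
  have hsub : Metric.ball (γ t) η \ γ '' Icc 0 1 ⊆ Zᶜ := by
    rintro z hz hzZ
    rw [hZ] at hzZ
    exact hzZ.elim hz.2 (hB hz.1).1.1
  have hδη' : Metric.ball (γ t) δ ⊆ Metric.ball (γ t) η := Metric.ball_subset_ball hδη.le
  have hcc : ∀ z ∈ Metric.ball (γ t) δ \ γ '' Icc 0 1, ∀ w ∈ Metric.ball (γ t) δ \ γ '' Icc 0 1,
      logInc γ 0 1 z - g z = logInc γ 0 1 w - g w →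
      connectedComponentIn Zᶜ z = connectedComponentIn Zᶜ w := by
    intro z hz w hw hzw
    exact connectedComponentIn_eq (connectedComponentIn_mono _ hsub (hconn z hz w hw hzw))
  refine ⟨connectedComponentIn Zᶜ a, connectedComponentIn Zᶜ b, δ, hδ,
    fun z => g z + 2 * Real.pi * I * k, (hg.mono hδη').add continuousOn_const, ?_, ?_, ?_, ?_⟩
  · intro z hz
    rw [exp_add_two_pi_mul_int, hge z (hδη' hz)]
  · exact hacc0
  · intro ε hε
    obtain ⟨z, hz, hzk⟩ := hacc1 ε hε
    exact ⟨z, hz, by rw [hzk]; ring⟩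
  · intro z hz
    refine ⟨hsub ⟨hδη' hz.1, hz.2⟩, ?_⟩
    rcases htwo z hz with h | h
    · exact Or.inl ⟨h, hcc z hz a ha (by rw [h, hak]; ring)⟩
    · exact Or.inr ⟨by rw [h]; ring, hcc z hz b hb (by rw [h, hbk]; ring)⟩

theorem SidePair.exists_of_twoSided (h : SidePair Z γ p f₀ f₁) {F₀ F₁ : Set ℂ}
    (h' : TwoSided γ p F₀ F₁) :
    (∃ z ∈ F₀, z ∉ Z ∧ connectedComponentIn Zᶜ z = f₀) ∧
      ∃ z ∈ F₁, z ∉ Z ∧ connectedComponentIn Zᶜ z = f₁ := by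
  obtain ⟨η, hη, g, hg, hge, h0, h1, hL⟩ := h
  obtain ⟨η', hη', g', hg', hge', h0', h1'⟩ := h'
  have hm1 : Metric.ball p (min η η') ⊆ Metric.ball p η := Metric.ball_subset_ball (min_le_left _ _)
  have hm2 : Metric.ball p (min η η') ⊆ Metric.ball p η' := Metric.ball_subset_ball (min_le_right _ _)
  obtain ⟨a, ha, haF, hag⟩ := h0' _ (lt_min hη hη')
  obtain ⟨b, hb, hbF, hbg⟩ := h1' _ (lt_min hη hη')
  have heq := eq_of_exp_eq_of_sides (hg.mono hm1) (hg'.mono hm2)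
    (fun z hz => by rw [hge z (hm1 hz), hge' z (hm2 hz)]) ⟨a, ha, hag⟩ ⟨b, hb, hbg⟩
    (fun z hz => (hL z ⟨hm1 hz.1, hz.2⟩).2.imp And.left And.left)
  constructor
  · refine ⟨a, haF, (hL a ⟨hm1 ha.1, ha.2⟩).1, ?_⟩
    rcases (hL a ⟨hm1 ha.1, ha.2⟩).2 with h | h
    · exact h.2
    · have h3 := h.1
      rw [hag, heq a ha.1] at h3
      exact absurd (by linear_combination -h3) two_pi_I_ne_zero'
  · refine ⟨b, hbF, (hL b ⟨hm1 hb.1, hb.2⟩).1, ?_⟩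
    rcases (hL b ⟨hm1 hb.1, hb.2⟩).2 with h | h
    · have h3 := h.1
      rw [hbg, heq b hb.1] at h3
      exact absurd (by linear_combination h3) two_pi_I_ne_zero'
    · exact h.2

theorem SidePair.twoSided (h : SidePair Z γ p f₀ f₁) : TwoSided γ p f₀ f₁ := by
  obtain ⟨η, hη, g, hg, hge, h0, h1, hL⟩ := h
  refine ⟨η, hη, g, hg, hge, fun ε hε => ?_, fun ε hε => ?_⟩
  · obtain ⟨z, hz, hzg⟩ := h0 (min ε η) (lt_min hε hη)
    refine ⟨z, ⟨Metric.ball_subset_ball (min_le_left _ _) hz.1, hz.2⟩, ?_, hzg⟩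
    obtain ⟨hzZ, h⟩ := hL z ⟨Metric.ball_subset_ball (min_le_right _ _) hz.1, hz.2⟩
    rcases h with h | h
    · rw [← h.2]; exact mem_connectedComponentIn hzZ
    · have h3 := h.1
      rw [hzg] at h3
      exact absurd (by linear_combination -h3) two_pi_I_ne_zero'
  · obtain ⟨z, hz, hzg⟩ := h1 (min ε η) (lt_min hε hη)
    refine ⟨z, ⟨Metric.ball_subset_ball (min_le_left _ _) hz.1, hz.2⟩, ?_, hzg⟩
    obtain ⟨hzZ, h⟩ := hL z ⟨Metric.ball_subset_ball (min_le_right _ _) hz.1, hz.2⟩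
    rcases h with h | h
    · have h3 := h.1
      rw [hzg] at h3
      exact absurd (by linear_combination h3) two_pi_I_ne_zero'
    · rw [← h.2]; exact mem_connectedComponentIn hzZ

theorem TwoSided.mono {F₀ F₁ F₀' F₁' : Set ℂ} (h : TwoSided γ p F₀ F₁) (h0 : F₀ ⊆ F₀')
    (h1 : F₁ ⊆ F₁') : TwoSided γ p F₀' F₁' := by
  obtain ⟨η, hη, g, hg, hge, ha, hb⟩ := h
  refine ⟨η, hη, g, hg, hge, fun ε hε => ?_, fun ε hε => ?_⟩
  · obtain ⟨z, hz, hzf, hzg⟩ := ha ε hε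
    exact ⟨z, hz, h0 hzf, hzg⟩
  · obtain ⟨z, hz, hzf, hzg⟩ := hb ε hε
    exact ⟨z, hz, h1 hzf, hzg⟩

theorem SidePair.unique (h : SidePair Z γ p f₀ f₁) {f₀' f₁' : Set ℂ}
    (h' : SidePair Z γ p f₀' f₁') : f₀' = f₀ ∧ f₁' = f₁ := by
  obtain ⟨η, hη, g, hg, hge, h0, h1, hL⟩ := h'
  have ht : TwoSided γ p {z | z ∉ Z → connectedComponentIn Zᶜ z = f₀'}
      {z | z ∉ Z → connectedComponentIn Zᶜ z = f₁'} := by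
    refine ⟨η, hη, g, hg, hge, fun ε hε => ?_, fun ε hε => ?_⟩
    · obtain ⟨z, hz, hzg⟩ := h0 (min ε η) (lt_min hε hη)
      refine ⟨z, ⟨Metric.ball_subset_ball (min_le_left _ _) hz.1, hz.2⟩, fun _ => ?_, hzg⟩
      obtain ⟨hzZ, h⟩ := hL z ⟨Metric.ball_subset_ball (min_le_right _ _) hz.1, hz.2⟩
      rcases h with h | h
      · exact h.2
      · have h3 := h.1
        rw [hzg] at h3
        exact absurd (by linear_combination -h3) two_pi_I_ne_zero'
    · obtain ⟨z, hz, hzg⟩ := h1 (min ε η) (lt_min hε hη)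
      refine ⟨z, ⟨Metric.ball_subset_ball (min_le_left _ _) hz.1, hz.2⟩, fun _ => ?_, hzg⟩
      obtain ⟨hzZ, h⟩ := hL z ⟨Metric.ball_subset_ball (min_le_right _ _) hz.1, hz.2⟩
      rcases h with h | h
      · have h3 := h.1
        rw [hzg] at h3
        exact absurd (by linear_combination h3) two_pi_I_ne_zero'
      · exact h.2
  obtain ⟨⟨z, hz, hzZ, hz0⟩, w, hw, hwZ, hw1⟩ := h.exists_of_twoSided ht
  exact ⟨(hz hzZ).symm.trans hz0, (hw hwZ).symm.trans hw1⟩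

/-- The base `g` at `γ t` also serves nearby points of the arc. There `exists_sides` gives a base up
to some `2πik`, and the dichotomy already known forces `k = 0`. -/
theorem SidePair.eventually (hγ : Continuous γ) (hinj : InjOn γ (Icc 0 1))
    (h : SidePair Z γ (γ t) f₀ f₁) :
    ∀ᶠ s in 𝓝 t, s ∈ Ioo (0:ℝ) 1 → SidePair Z γ (γ s) f₀ f₁ := by
  obtain ⟨η, hη, g, hg, hge, -, -, hL⟩ := h
  filter_upwards [hγ.continuousAt (Metric.ball_mem_nhds _ hη)] with s hs hs01
  obtain ⟨η', hη', hsub⟩ := Metric.isOpen_iff.1 Metric.isOpen_ball (γ s) hs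
  obtain ⟨k, δ, hδ, hδη, htwo, hacc0, hacc1, -⟩ := exists_sides hγ hinj hs01 hη' (hg.mono hsub)
    (fun z hz => hge z (hsub hz))
  have heq := eq_of_exp_eq_of_sides (A := γ '' Icc 0 1) (L := logInc γ 0 1) (hg.mono hsub)
    (g' := fun z => g z + 2 * Real.pi * I * k)
    ((hg.mono hsub).add continuousOn_const) (fun z hz => by rw [exp_add_two_pi_mul_int])
    (hacc0 _ hη') (by
      obtain ⟨z, hz, hzk⟩ := hacc1 _ hη'
      exact ⟨z, hz, by rw [hzk]; ring⟩) (fun z hz => (hL z ⟨hsub hz.1, hz.2⟩).2.imp And.left And.left)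
  have hk : (2 * Real.pi * I * k : ℂ) = 0 := by
    have := heq (γ s) (Metric.mem_ball_self hη')
    linear_combination this
  refine ⟨η', hη', g, hg.mono hsub, fun z hz => hge z (hsub hz), ?_, ?_,
    fun z hz => hL z ⟨hsub hz.1, hz.2⟩⟩
  · intro ε hε
    obtain ⟨z, hz, hzk⟩ := hacc0 ε hε
    exact ⟨z, hz, by rw [hzk, hk, add_zero]⟩
  · intro ε hε
    obtain ⟨z, hz, hzk⟩ := hacc1 ε hε
    exact ⟨z, hz, by rw [hzk]; linear_combination hk⟩

/-- The components on the two sides do not change along the arc. -/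
theorem exists_sidePair_forall (hγ : Continuous γ) (hinj : InjOn γ (Icc 0 1))
    {S : Set ℂ} (hS : IsClosed S) (hp : ∀ t ∈ Ioo (0:ℝ) 1, γ t ∉ S) (hZ : Z = γ '' Icc 0 1 ∪ S) :
    ∃ f₀ f₁, ∀ t ∈ Ioo (0:ℝ) 1, SidePair Z γ (γ t) f₀ f₁ := by
  have hex : ∀ t ∈ Ioo (0:ℝ) 1, ∃ F : Set ℂ × Set ℂ, SidePair Z γ (γ t) F.1 F.2 := fun t ht => by
    obtain ⟨f₀, f₁, h⟩ := exists_sidePair hγ hinj ht hS (hp t ht) hZ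
    exact ⟨(f₀, f₁), h⟩
  choose! F hF using hex
  have : PreconnectedSpace (Ioo (0:ℝ) 1) := isPreconnected_iff_preconnectedSpace.1 isPreconnected_Ioo
  have hloc : IsLocallyConstant fun t : Ioo (0:ℝ) 1 => F t := by
    rw [IsLocallyConstant.iff_eventually_eq]
    intro t
    have := (hF t t.2).eventually hγ hinj
    filter_upwards [continuous_subtype_val.continuousAt.eventually this] with s hs
    have := (hs s.2).unique (hF s s.2)
    exact Prod.ext this.1 this.2
  have hhalf : (1/2 : ℝ) ∈ Ioo (0:ℝ) 1 := by norm_num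
  refine ⟨(F (1/2)).1, (F (1/2)).2, fun t ht => ?_⟩
  have := hloc.apply_eq_of_preconnectedSpace ⟨t, ht⟩ ⟨1/2, hhalf⟩
  simp only at this
  rw [← this]
  exact hF t ht

end

/-! ### Faces of plane graphs -/

namespace Graph

variable {α β : Type*} {G : Graph α β}

namespace PlaneEmbedding

variable (Γ : G.PlaneEmbedding) (K : G.Orientation)

/-- A parametrisation of the arc of an edge, from its tail to its head. -/
def curve (e : E(G)) : ℝ → ℂ := (Γ.exists_path e _ _ (K.isLink e)).choose.extend

theorem continuous_curve (e : E(G)) : Continuous (Γ.curve K e) := Path.continuous_extend _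

theorem injOn_curve (e : E(G)) : InjOn (Γ.curve K e) (Icc 0 1) :=
  path_injOn_extend (Γ.exists_path e _ _ (K.isLink e)).choose_spec.1

theorem image_curve (e : E(G)) : Γ.curve K e '' Icc 0 1 = Γ.arc e := by
  rw [curve, path_image_extend, (Γ.exists_path e _ _ (K.isLink e)).choose_spec.2]

theorem curve_zero (e : E(G)) : Γ.curve K e 0 = Γ.pos (K.tail e) := Path.extend_zero _

theorem curve_one (e : E(G)) : Γ.curve K e 1 = Γ.pos (K.head e) := Path.extend_one _

theorem isCompact_arc (e : E(G)) : IsCompact (Γ.arc e) := by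
  obtain ⟨x, y, h⟩ := exists_isLink_of_mem_edgeSet e.2
  obtain ⟨γ, -, hγ⟩ := Γ.exists_path e ⟨x, h.left_mem⟩ ⟨y, h.right_mem⟩ h
  rw [← hγ]
  exact isCompact_range γ.continuous

theorem not_isLink_self (Γ : G.PlaneEmbedding) (e : E(G)) (x : V(G)) : ¬ G.IsLink e x x := by
  intro h
  obtain ⟨γ, hγ, -⟩ := Γ.exists_path e x x h
  have := hγ (γ.source.trans γ.target.symm)
  exact zero_ne_one this

theorem tail_ne_head (Γ : G.PlaneEmbedding) (K : G.Orientation) (e : E(G)) :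
    K.tail e ≠ K.head e := fun h =>
  Γ.not_isLink_self e (K.head e) (by have := K.isLink e; rwa [h] at this)

/-- The vertices and the arcs of the edges in `S`. -/
def subSupport (S : Set E(G)) : Set ℂ := range Γ.pos ∪ ⋃ e ∈ S, Γ.arc e

theorem subSupport_univ : Γ.subSupport univ = Γ.support := by
  simp [subSupport, support]

theorem subSupport_mono {S T : Set E(G)} (h : S ⊆ T) : Γ.subSupport S ⊆ Γ.subSupport T :=
  union_subset_union_right _ (biUnion_subset_biUnion_left h)

theorem subSupport_subset_support (S : Set E(G)) : Γ.subSupport S ⊆ Γ.support := by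
  rw [← subSupport_univ]; exact Γ.subSupport_mono (subset_univ _)

theorem subSupport_insert (S : Set E(G)) (e : E(G)) :
    Γ.subSupport (insert e S) = Γ.arc e ∪ Γ.subSupport S := by
  simp only [subSupport, biUnion_insert]
  rw [union_left_comm]

theorem curve_notMem_subSupport {S : Set E(G)} {e : E(G)} (he : e ∉ S) {t : ℝ}
    (ht : t ∈ Ioo (0:ℝ) 1) : Γ.curve K e t ∉ Γ.subSupport S := by
  have ht' : t ∈ Icc (0:ℝ) 1 := ⟨ht.1.le, ht.2.le⟩
  have hm : Γ.curve K e t ∈ Γ.arc e := by rw [← Γ.image_curve K]; exact ⟨t, ht', rfl⟩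
  have hv : Γ.curve K e t ∉ range Γ.pos := by
    rintro ⟨v, hv⟩
    rcases (Γ.inc_of_mem e v (hv ▸ hm)).eq_or_eq_of_isLink (K.isLink e) with h | h
    · rw [Subtype.ext h, ← Γ.curve_zero K] at hv
      exact ht.1.ne (Γ.injOn_curve K e (by simp) ht' hv)
    · rw [Subtype.ext h, ← Γ.curve_one K] at hv
      exact ht.2.ne' (Γ.injOn_curve K e (by simp) ht' hv)
  rintro (h | h)
  · exact hv h
  · simp only [mem_iUnion] at h
    obtain ⟨e', he', hm'⟩ := h
    exact hv (Γ.inter_subset e e' (fun h => he (h ▸ he')) ⟨hm, hm'⟩)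

theorem exists_curve_eq {e : E(G)} {z : ℂ} (hz : z ∈ Γ.arc e) (hv : z ∉ range Γ.pos) :
    ∃ t ∈ Ioo (0:ℝ) 1, Γ.curve K e t = z := by
  rw [← Γ.image_curve K] at hz
  obtain ⟨t, ht, rfl⟩ := hz
  refine ⟨t, ⟨lt_of_le_of_ne ht.1 ?_, lt_of_le_of_ne ht.2 ?_⟩, rfl⟩
  · rintro rfl; exact hv ⟨_, (Γ.curve_zero K e).symm⟩
  · rintro rfl; exact hv ⟨_, (Γ.curve_one K e).symm⟩

theorem IsFace.eq_of_mem {Γ : G.PlaneEmbedding} {f : Set ℂ} (hf : Γ.IsFace f) {z : ℂ} (hz : z ∈ f) :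
    f = connectedComponentIn Γ.supportᶜ z := by
  obtain ⟨w, -, rfl⟩ := hf
  exact connectedComponentIn_eq hz

variable [Finite V(G)] [Finite E(G)]

theorem isCompact_subSupport (S : Set E(G)) : IsCompact (Γ.subSupport S) :=
  (finite_range _).isCompact.union (S.toFinite.isCompact_biUnion fun e _ => Γ.isCompact_arc e)

theorem isCompact_support : IsCompact Γ.support := by
  rw [← subSupport_univ]; exact Γ.isCompact_subSupport _

theorem exists_faces (e : E(G)) : ∃ f₀ f₁, ∀ t ∈ Ioo (0:ℝ) 1,
    SidePair Γ.support (Γ.curve K e) (Γ.curve K e t) f₀ f₁ := by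
  refine exists_sidePair_forall (Γ.continuous_curve K e) (Γ.injOn_curve K e)
    (Γ.isCompact_subSupport {e}ᶜ).isClosed (fun t ht => Γ.curve_notMem_subSupport K (by simp) ht) ?_
  rw [image_curve, ← subSupport_insert, ← subSupport_univ]
  congr 1
  ext x
  simp [em]

/-- The face on the right-hand side of an edge. -/
def right (e : E(G)) : Set ℂ := (Γ.exists_faces K e).choose

/-- The face on the left-hand side of an edge. -/
def left (e : E(G)) : Set ℂ := (Γ.exists_faces K e).choose_spec.choose

theorem sidePair (e : E(G)) {t : ℝ} (ht : t ∈ Ioo (0:ℝ) 1) :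
    SidePair Γ.support (Γ.curve K e) (Γ.curve K e t) (Γ.right K e) (Γ.left K e) :=
  (Γ.exists_faces K e).choose_spec.choose_spec t ht

theorem half_mem_Ioo : (1 / 2 : ℝ) ∈ Ioo (0:ℝ) 1 := by norm_num

theorem isFace_right (e : E(G)) : Γ.IsFace (Γ.right K e) := by
  have h := Γ.sidePair K e half_mem_Ioo
  obtain ⟨⟨z, -, hz, hf⟩, -⟩ := h.exists_of_twoSided h.twoSided
  exact ⟨z, hz, hf.symm⟩

theorem isFace_left (e : E(G)) : Γ.IsFace (Γ.left K e) := by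
  have h := Γ.sidePair K e half_mem_Ioo
  obtain ⟨-, z, -, hz, hf⟩ := h.exists_of_twoSided h.twoSided
  exact ⟨z, hz, hf.symm⟩

/-- This removes every choice in `IsOnLeft`: the parametrisation, the point of the arc, the closing
curve and `k` all lead to the one face fixed by `left`. -/
theorem isOnLeft_iff_left {e : E(G)} {a b : ℂ} {γ : Path a b} (hγ : Function.Injective γ)
    (hr : range γ = Γ.arc e) (ha : a = Γ.pos (K.tail e)) (hb : b = Γ.pos (K.head e)) {f : Set ℂ}
    (hf : Γ.IsFace f) : IsOnLeft γ f ↔ f = Γ.left K e := by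
  have him : γ.extend '' Icc 0 1 = Γ.curve K e '' Icc 0 1 := by
    rw [path_image_extend, image_curve, hr]
  have h0 : γ.extend 0 = Γ.curve K e 0 := by rw [γ.extend_zero, curve_zero, ha]
  have h1 : γ.extend 1 = Γ.curve K e 1 := by rw [γ.extend_one, curve_one, hb]
  have hmem : ∀ t ∈ Ioo (0:ℝ) 1, ∃ s ∈ Ioo (0:ℝ) 1, Γ.curve K e s = γ.extend t := by
    intro t ht
    have ht' : t ∈ Icc (0:ℝ) 1 := ⟨ht.1.le, ht.2.le⟩
    obtain ⟨s, hs, hst⟩ : γ.extend t ∈ Γ.curve K e '' Icc 0 1 := him ▸ ⟨t, ht', rfl⟩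
    refine ⟨s, ⟨lt_of_le_of_ne hs.1 ?_, lt_of_le_of_ne hs.2 ?_⟩, hst⟩
    · rintro rfl
      exact ht.1.ne' (path_injOn_extend hγ ht' (by simp) (hst.symm.trans h0.symm))
    · rintro rfl
      exact ht.2.ne (path_injOn_extend hγ ht' (by simp) (hst.symm.trans h1.symm))
  constructor
  · intro h
    obtain ⟨t, ht, h⟩ := h.exists_twoSided
    obtain ⟨s, hs, hst⟩ := hmem t ht
    have h' := h.of_image_eq γ.continuous_extend (Γ.continuous_curve K e) (path_injOn_extend hγ)
      him.symm h0.symm h1.symm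
    rw [← hst] at h'
    obtain ⟨-, z, hz, -, hzf⟩ := (Γ.sidePair K e hs).exists_of_twoSided h'
    rw [← hzf]
    exact hf.eq_of_mem hz
  · rintro rfl
    obtain ⟨s, hs, hst⟩ := hmem _ half_mem_Ioo
    have h' := ((Γ.sidePair K e hs).twoSided.of_image_eq (Γ.continuous_curve K e)
      γ.continuous_extend (Γ.injOn_curve K e) him h0 h1).mono (subset_univ _) Subset.rfl
    rw [hst] at h'
    exact h'.isOnLeft hγ half_mem_Ioo

theorem isOnLeft_iff_right {e : E(G)} {a b : ℂ} {γ : Path a b} (hγ : Function.Injective γ)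
    (hr : range γ = Γ.arc e) (ha : a = Γ.pos (K.head e)) (hb : b = Γ.pos (K.tail e)) {f : Set ℂ}
    (hf : Γ.IsFace f) : IsOnLeft γ f ↔ f = Γ.right K e := by
  have him : γ.extend '' Icc 0 1 = Γ.curve K e '' Icc 0 1 := by
    rw [path_image_extend, image_curve, hr]
  have h0 : γ.extend 0 = Γ.curve K e 1 := by rw [γ.extend_zero, curve_one, ha]
  have h1 : γ.extend 1 = Γ.curve K e 0 := by rw [γ.extend_one, curve_zero, hb]
  have hmem : ∀ t ∈ Ioo (0:ℝ) 1, ∃ s ∈ Ioo (0:ℝ) 1, Γ.curve K e s = γ.extend t := by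
    intro t ht
    have ht' : t ∈ Icc (0:ℝ) 1 := ⟨ht.1.le, ht.2.le⟩
    obtain ⟨s, hs, hst⟩ : γ.extend t ∈ Γ.curve K e '' Icc 0 1 := him ▸ ⟨t, ht', rfl⟩
    refine ⟨s, ⟨lt_of_le_of_ne hs.1 ?_, lt_of_le_of_ne hs.2 ?_⟩, hst⟩
    · rintro rfl
      exact ht.2.ne (path_injOn_extend hγ ht' (by simp) (hst.symm.trans h1.symm))
    · rintro rfl
      exact ht.1.ne' (path_injOn_extend hγ ht' (by simp) (hst.symm.trans h0.symm))
  constructor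
  · intro h
    obtain ⟨t, ht, h⟩ := h.exists_twoSided
    obtain ⟨s, hs, hst⟩ := hmem t ht
    have h' := h.of_image_eq_of_reverse γ.continuous_extend (Γ.continuous_curve K e)
      (path_injOn_extend hγ) him.symm h1.symm h0.symm
    rw [← hst] at h'
    obtain ⟨⟨z, hz, -, hzf⟩, -⟩ := (Γ.sidePair K e hs).exists_of_twoSided h'
    rw [← hzf]
    exact hf.eq_of_mem hz
  · rintro rfl
    obtain ⟨s, hs, hst⟩ := hmem _ half_mem_Ioo
    have h' := ((Γ.sidePair K e hs).twoSided.of_image_eq_of_reverse (Γ.continuous_curve K e)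
      γ.continuous_extend (Γ.injOn_curve K e) him h0 h1).mono (subset_univ _) Subset.rfl
    rw [hst] at h'
    exact h'.isOnLeft hγ half_mem_Ioo

theorem boundaryAgainst_iff_right {K' : G.Orientation} {e : E(G)} (ht : K'.tail e = K.tail e)
    (hh : K'.head e = K.head e) {f : Set ℂ} (hf : Γ.IsFace f) :
    Γ.BoundaryAgainst K' f e ↔ f = Γ.right K e := by
  constructor
  · rintro ⟨γ, hγ, hr, h⟩
    exact (Γ.isOnLeft_iff_right K hγ hr (by rw [hh]) (by rw [ht]) hf).1 h
  · intro h
    obtain ⟨γ, hγ, hr⟩ := Γ.exists_path e _ _ (K'.isLink e).symm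
    exact ⟨γ, hγ, hr, (Γ.isOnLeft_iff_right K hγ hr (by rw [hh]) (by rw [ht]) hf).2 h⟩

theorem boundaryAgainst_iff_left {K' : G.Orientation} {e : E(G)} (ht : K'.tail e = K.head e)
    (hh : K'.head e = K.tail e) {f : Set ℂ} (hf : Γ.IsFace f) :
    Γ.BoundaryAgainst K' f e ↔ f = Γ.left K e := by
  constructor
  · rintro ⟨γ, hγ, hr, h⟩
    exact (Γ.isOnLeft_iff_left K hγ hr (by rw [hh]) (by rw [ht]) hf).1 h
  · intro h
    obtain ⟨γ, hγ, hr⟩ := Γ.exists_path e _ _ (K'.isLink e).symm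
    exact ⟨γ, hγ, hr, (Γ.isOnLeft_iff_left K hγ hr (by rw [hh]) (by rw [ht]) hf).2 h⟩

/-- Traversing an edge from head to tail exchanges its sides, so only the face on its right counts
it. Each edge is thus counted for exactly one face. -/
theorem nBoundary_eq {f : Set ℂ} (hf : Γ.IsFace f) :
    Γ.nBoundary K f = Nat.card {e : E(G) // Γ.right K e = f} := by
  refine Nat.card_congr (Equiv.subtypeEquivRight fun e => ?_)
  rw [Γ.boundaryAgainst_iff_right K rfl rfl hf, eq_comm]

/-- A function of the faces which takes equal values on both sides of every edge outside of `S` is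
constant on the components of the complement of `S`. -/
theorem apply_eq_of_connected {X : Type*} (φ : Set ℂ → X) {S : Set E(G)}
    (hφ : ∀ e ∉ S, φ (Γ.right K e) = φ (Γ.left K e)) {z w : ℂ} (hz : z ∉ Γ.support)
    (hw : w ∉ Γ.support) {U : Set ℂ} (hU : IsPreconnected U) (hUS : U ⊆ (Γ.subSupport S)ᶜ)
    (hzU : z ∈ U) (hwU : w ∈ U) :
    φ (connectedComponentIn Γ.supportᶜ z) = φ (connectedComponentIn Γ.supportᶜ w) := by
  set F : ℂ → X := fun y => φ (connectedComponentIn Γ.supportᶜ y) with hF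
  -- `O c` collects the points near which `φ` is `c` off the drawing. On `U` these open sets are
  -- disjoint and cover, so a preconnected `U` meets only one of them.
  set O : X → Set ℂ := fun c => {y | ∀ᶠ x in 𝓝 y, x ∉ Γ.support → F x = c} with hO
  have hOo : ∀ c, IsOpen (O c) := fun c => by
    rw [isOpen_iff_mem_nhds]
    intro y hy
    exact eventually_eventually_nhds.2 hy
  have hloc : ∀ y, y ∉ Γ.support → y ∈ O (F y) := by
    intro y hy
    have ho := Γ.isCompact_support.isClosed.isOpen_compl.connectedComponentIn (x := y)
    filter_upwards [ho.mem_nhds (mem_connectedComponentIn hy)] with x hx _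
    simp only [hF, connectedComponentIn_eq hx]
  have hside : ∀ y ∈ U, y ∈ Γ.support → ∃ e ∉ S, ∃ t ∈ Ioo (0:ℝ) 1, Γ.curve K e t = y := by
    intro y hy hys
    have hyn : y ∉ range Γ.pos := fun h => hUS hy (Or.inl h)
    obtain ⟨e, he⟩ := mem_iUnion.1 (hys.resolve_left hyn)
    have heS : e ∉ S := fun h => hUS hy (Or.inr (mem_biUnion h he))
    obtain ⟨t, ht, hty⟩ := Γ.exists_curve_eq K he hyn
    exact ⟨e, heS, t, ht, hty⟩
  have hcov : ∀ y ∈ U, ∃ c, y ∈ O c := by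
    intro y hy
    by_cases hys : y ∈ Γ.support
    · obtain ⟨e, he, t, ht, rfl⟩ := hside y hy hys
      obtain ⟨η, hη, g, -, -, -, -, hL⟩ := Γ.sidePair K e ht
      refine ⟨φ (Γ.right K e), ?_⟩
      filter_upwards [Metric.ball_mem_nhds _ hη] with x hx hxs
      have hxA : x ∉ Γ.curve K e '' Icc 0 1 := fun h => hxs (by
        rw [image_curve] at h
        exact Or.inr (mem_iUnion.2 ⟨e, h⟩))
      rcases (hL x ⟨hx, hxA⟩).2 with h | h
      · simp only [hF, h.2]
      · simp only [hF, h.2, hφ e he]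
    · exact ⟨_, hloc y hys⟩
  have hdense : ∀ y ∈ U, ∀ c c', y ∈ O c → y ∈ O c' → c = c' := by
    intro y hy c c' h h'
    have hev : ∃ᶠ x in 𝓝 y, x ∉ Γ.support := by
      by_cases hys : y ∈ Γ.support
      · obtain ⟨e, he, t, ht, rfl⟩ := hside y hy hys
        obtain ⟨η, hη, g, -, -, h0, -, hL⟩ := Γ.sidePair K e ht
        rw [Metric.nhds_basis_ball.frequently_iff]
        intro ε hε
        obtain ⟨x, hx, -⟩ := h0 (min ε η) (lt_min hε hη)
        exact ⟨x, Metric.ball_subset_ball (min_le_left _ _) hx.1,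
          (hL x ⟨Metric.ball_subset_ball (min_le_right _ _) hx.1, hx.2⟩).1⟩
      · exact Filter.Eventually.frequently (Γ.isCompact_support.isClosed.isOpen_compl.mem_nhds hys)
    obtain ⟨x, hx, h1, h2⟩ := (hev.and_eventually (h.and h')).exists
    rw [← h1 hx, ← h2 hx]
  by_contra hne
  have hsub : U ⊆ O (F z) ∪ ⋃ c ≠ F z, O c := by
    intro y hy
    obtain ⟨c, hc⟩ := hcov y hy
    by_cases h : c = F z
    · exact Or.inl (h ▸ hc)
    · exact Or.inr (mem_biUnion h hc)
  obtain ⟨y, hyU, hy1, hy2⟩ := hU _ _ (hOo _) (isOpen_biUnion fun c _ => hOo c) hsub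
    ⟨z, hzU, hloc z hz⟩ ⟨w, hwU, mem_biUnion (Ne.symm hne) (hloc w hw)⟩
  simp only [mem_iUnion] at hy2
  obtain ⟨c, hc, hyc⟩ := hy2
  exact hc (hdense y hyU _ _ hyc hy1)

end PlaneEmbedding
end Graph

/-! ### Existence of Kasteleyn orientations -/

/-- If the range were proper, a nonzero functional would vanish on it, and its coefficients would be
a dependency between the rows. -/
theorem exists_sum_mul_eq {k ι κ : Type*} [Field k] [Fintype ι] [Fintype κ]
    (M : ι → κ → k) (h : ∀ φ : ι → k, (∀ e, ∑ i, φ i * M i e = 0) → φ = 0) (n : ι → k) :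
    ∃ x : κ → k, ∀ i, ∑ e, M i e * x e = n i := by
  classical
  set T : (κ → k) →ₗ[k] (ι → k) := Matrix.mulVecLin (Matrix.of M) with hT
  have htop : LinearMap.range T = ⊤ := by
    by_contra hne
    obtain ⟨f, hf0, hf⟩ := Submodule.exists_le_ker_of_lt_top _ (lt_top_iff_ne_top.2 hne)
    have hfs : ∀ v : ι → k, f v = ∑ i, f (Pi.single i 1) * v i := by
      intro v
      conv_lhs => rw [← Finset.univ_sum_single v]
      rw [map_sum]
      refine Finset.sum_congr rfl fun i _ => ?_
      have : (Pi.single i (v i) : ι → k) = v i • Pi.single i 1 := by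
        rw [← Pi.single_smul, smul_eq_mul, mul_one]
      rw [this, map_smul, smul_eq_mul, mul_comm]
    have hφ := h (fun i => f (Pi.single i 1)) fun e => by
      have := hf ⟨Pi.single e 1, rfl⟩
      rw [LinearMap.mem_ker, hfs] at this
      simpa [hT] using this
    apply hf0
    ext i
    simpa using congrFun hφ i
  obtain ⟨x, hx⟩ := LinearMap.range_eq_top.1 htop n
  exact ⟨x, fun i => by simpa [hT, Matrix.mulVec, dotProduct] using congrFun hx i⟩

namespace Graph

variable {α β : Type*} {G : Graph α β}

theorem exists_orientation (G : Graph α β) : Nonempty G.Orientation := by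
  have h : ∀ e : E(G), ∃ p : V(G) × V(G), G.IsLink e p.1 p.2 := by
    intro e
    obtain ⟨x, y, h⟩ := exists_isLink_of_mem_edgeSet e.2
    exact ⟨(⟨x, h.left_mem⟩, ⟨y, h.right_mem⟩), h⟩
  choose p hp using h
  exact ⟨fun e => (p e).1, fun e => (p e).2, hp⟩

namespace PlaneEmbedding

variable (Γ : G.PlaneEmbedding) (K : G.Orientation) [Finite V(G)]

theorem isPreconnected_compl_pos : IsPreconnected (Γ.subSupport ∅)ᶜ := by
  have : Γ.subSupport ∅ = range Γ.pos := by simp [subSupport]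
  rw [this]
  exact ((finite_range Γ.pos).countable.isConnected_compl_of_one_lt_rank
    (rank_real_complex ▸ Nat.one_lt_ofNat)).isPreconnected

variable [Finite E(G)]

theorem exists_notMem_support_of_isBounded {f : Set ℂ} (hf : Bornology.IsBounded f) :
    ∃ w, w ∉ Γ.support ∧ w ∉ f := by
  by_contra! hcon
  have : (univ : Set ℂ) ⊆ Γ.support ∪ f := fun w _ => by
    by_cases h : w ∈ Γ.support
    · exact Or.inl h
    · exact Or.inr (hcon w h)
  exact NormedSpace.unbounded_univ ℝ ℂ ((Γ.isCompact_support.isBounded.union hf).subset this)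

/-- If no edge bordered `f`, its indicator would be equal across all edges, hence constant on all
faces, although `f` does not fill the complement of the drawing. This bounds the number of bounded
faces. -/
theorem eq_right_or_left {f : Set ℂ} (hf : Γ.IsFace f) (hb : Bornology.IsBounded f) :
    f ∈ range (Γ.right K) ∪ range (Γ.left K) := by
  by_contra hn
  rw [mem_union, not_or] at hn
  obtain ⟨w, hw, hwf⟩ := Γ.exists_notMem_support_of_isBounded hb
  obtain ⟨z, hz, rfl⟩ := id hf
  have := Γ.apply_eq_of_connected K (fun F => F = connectedComponentIn Γ.supportᶜ z) (S := ∅)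
    (fun e _ => by
      rw [eq_iff_iff]
      exact ⟨fun h => absurd ⟨e, h⟩ hn.1, fun h => absurd ⟨e, h⟩ hn.2⟩) hz hw
    Γ.isPreconnected_compl_pos Subset.rfl (fun h => hz (Γ.subSupport_subset_support _ h))
    (fun h => hw (Γ.subSupport_subset_support _ h))
  have heq : connectedComponentIn Γ.supportᶜ w = connectedComponentIn Γ.supportᶜ z := this.mp rfl
  exact hwf (heq ▸ mem_connectedComponentIn hw)

/-- The bounded faces. -/
abbrev BoundedFace := {f : Set ℂ // Γ.IsFace f ∧ Bornology.IsBounded f}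

instance finite_boundedFace : Finite Γ.BoundedFace := by
  obtain ⟨K⟩ := G.exists_orientation
  exact ((finite_range (Γ.right K)).union (finite_range (Γ.left K))).subset
    fun f hf => Γ.eq_right_or_left K hf.1 hf.2

theorem exists_isKasteleyn : ∃ K : G.Orientation, Γ.IsKasteleyn K := by
  classical
  obtain ⟨K⟩ := G.exists_orientation
  have := Fintype.ofFinite E(G)
  have := Fintype.ofFinite Γ.BoundedFace
  -- Effect of reversing `e` on the count at `f`. If `f` lies on both sides of `e`, the two
  -- contributions cancel modulo 2.
  set M : Γ.BoundedFace → E(G) → ZMod 2 := fun f e =>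
    (if Γ.right K e = f then 1 else 0) + (if Γ.left K e = f then 1 else 0) with hM
  obtain ⟨x, hx⟩ := exists_sum_mul_eq M (by
    intro φ hφ
    -- Extension of the dependency by zero to the unbounded face.
    set ψ : Set ℂ → ZMod 2 := fun F => ∑ f : Γ.BoundedFace, φ f * (if F = f then 1 else 0) with hψ
    have hψf : ∀ f : Γ.BoundedFace, ψ f = φ f := by
      intro f
      simp only [hψ]
      rw [Finset.sum_eq_single f]
      · simp
      · intro b _ hb
        rw [if_neg (fun h => hb (Subtype.ext h.symm)), mul_zero]
      · simp
    have key : ∀ e ∉ (∅ : Set E(G)), ψ (Γ.right K e) = ψ (Γ.left K e) := by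
      intro e _
      have := hφ e
      simp only [hM, mul_add, Finset.sum_add_distrib] at this
      rwa [CharTwo.add_eq_zero] at this
    funext f
    obtain ⟨w, hw, hwf⟩ : ∃ w, w ∉ Γ.support ∧ w ∉ ⋃ f : Γ.BoundedFace, (f : Set ℂ) :=
      Γ.exists_notMem_support_of_isBounded (Bornology.isBounded_iUnion.2 fun f => f.2.2)
    obtain ⟨z, hz, hzf⟩ := f.2.1
    have h1 := Γ.apply_eq_of_connected K ψ key hz hw
      Γ.isPreconnected_compl_pos Subset.rfl (fun h => hz (Γ.subSupport_subset_support _ h))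
      (fun h => hw (Γ.subSupport_subset_support _ h))
    rw [← hzf, hψf] at h1
    rw [h1]
    simp only [hψ]
    refine Finset.sum_eq_zero fun b _ => ?_
    rw [if_neg, mul_zero]
    intro h
    exact hwf (mem_iUnion.2 ⟨b, h ▸ mem_connectedComponentIn hw⟩))
    -- The required change: added to the present count it gives `1` in characteristic two.
    (fun f => (Γ.nBoundary K f : ZMod 2) + 1)
  let K' : G.Orientation :=
    { tail := fun e => if x e = 0 then K.tail e else K.head e
      head := fun e => if x e = 0 then K.head e else K.tail e
      isLink := fun e => by
        split_ifs
        · exact K.isLink e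
        · exact (K.isLink e).symm }
  have hx01 : ∀ e, x e = 0 ∨ x e = 1 := fun e => by
    have : ∀ a : ZMod 2, a = 0 ∨ a = 1 := by decide
    exact this _
  have hcard : ∀ (p : E(G) → Prop), (Nat.card {e // p e} : ZMod 2) = ∑ e, if p e then 1 else 0 := by
    intro p
    rw [Nat.card_eq_fintype_card, Fintype.card_subtype, Finset.card_filter]
    push_cast
    rfl
  refine ⟨K', fun f hf hb => ?_⟩
  rw [← ZMod.natCast_eq_one_iff_odd]
  have h1 := hx ⟨f, hf, hb⟩
  simp only [Γ.nBoundary_eq K hf, hcard] at h1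
  rw [nBoundary, hcard]
  have h2 : ∀ e, (if Γ.BoundaryAgainst K' f e then (1 : ZMod 2) else 0) =
      (if Γ.right K e = f then 1 else 0) + M ⟨f, hf, hb⟩ e * x e := by
    intro e
    rcases hx01 e with h | h
    · have := Γ.boundaryAgainst_iff_right K (K' := K') (e := e) (by simp [K', h]) (by simp [K', h]) hf
      simp only [this, h, mul_zero, add_zero, eq_comm]
    · have := Γ.boundaryAgainst_iff_left K (K' := K') (e := e) (by simp [K', h]) (by simp [K', h]) hf
      simp only [this, h, mul_one, hM, ← add_assoc, CharTwo.add_self_eq_zero, zero_add, eq_comm]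
  rw [Finset.sum_congr rfl fun e _ => h2 e, Finset.sum_add_distrib, h1]
  have h3 : ∀ a : ZMod 2, a + (a + 1) = 1 := by decide
  convert h3 _

end PlaneEmbedding
end Graph

/-! ### Winding numbers of integral chains -/

namespace Graph

variable {α β : Type*} {G : Graph α β}

theorem Orientation.isLink_iff (K : G.Orientation) {e : E(G)} {u v : V(G)} (h : G.IsLink e u v) :
    (K.tail e = u ∧ K.head e = v) ∨ (K.tail e = v ∧ K.head e = u) := by
  rcases (K.isLink e).eq_and_eq_or_eq_and_eq h with ⟨h1, h2⟩ | ⟨h1, h2⟩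
  · exact Or.inl ⟨Subtype.ext h1, Subtype.ext h2⟩
  · exact Or.inr ⟨Subtype.ext h1, Subtype.ext h2⟩

section Chain

variable [Fintype E(G)]

/-- The boundary of the integral chain `x` is `v - u`. -/
def Orientation.IsChain (K : G.Orientation) (x : E(G) → ℤ) (u v : V(G)) : Prop :=
  ∀ A : V(G) → ℂ, ∑ e, (x e : ℂ) * (A (K.head e) - A (K.tail e)) = A v - A u

variable {K : G.Orientation} {x y : E(G) → ℤ} {u v w : V(G)}

theorem Orientation.IsChain.zero (u : V(G)) : K.IsChain 0 u u := fun A => by simp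

theorem Orientation.IsChain.add (hx : K.IsChain x u v) (hy : K.IsChain y v w) :
    K.IsChain (x + y) u w := fun A => by
  have h1 := hx A
  have h2 := hy A
  simp only [Pi.add_apply, Int.cast_add, add_mul, Finset.sum_add_distrib, h1, h2]
  ring

theorem Orientation.IsChain.neg (hx : K.IsChain x u v) : K.IsChain (-x) v u := fun A => by
  have h1 := hx A
  simp only [Pi.neg_apply, Int.cast_neg, neg_mul, Finset.sum_neg_distrib, h1]
  ring

open Classical in
theorem Orientation.IsChain.single (e : E(G)) :
    K.IsChain (Pi.single e 1) (K.tail e) (K.head e) := fun A => by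
  rw [Finset.sum_eq_single e]
  · simp
  · intro b _ hb; simp [hb]
  · simp

theorem Orientation.exists_isChain_of_isLink (K : G.Orientation) {e : E(G)} {u v : V(G)}
    (h : G.IsLink e u v) : ∃ x : E(G) → ℤ, (∀ e', e' ≠ e → x e' = 0) ∧ K.IsChain x u v := by
  classical
  rcases K.isLink_iff h with ⟨rfl, rfl⟩ | ⟨rfl, rfl⟩
  · exact ⟨Pi.single e 1, fun e' he' => by simp [he'], .single e⟩
  · exact ⟨-Pi.single e 1, fun e' he' => by simp [he'], (IsChain.single e).neg⟩

end Chain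

namespace PlaneEmbedding

variable (Γ : G.PlaneEmbedding) (K : G.Orientation) (x : E(G) → ℤ)

/-- The union of the arcs on which a chain does not vanish. -/
def chainSupport : Set ℂ := ⋃ e ∈ {e | x e ≠ 0}, Γ.arc e

/-- The increment of the logarithm of `· - z` along an edge. -/
def edgeInc (e : E(G)) (z : ℂ) : ℂ := logInc (Γ.curve K e) 0 1 z

variable {x}

theorem chainSupport_subset {S : Set E(G)} (hS : ∀ e ∉ S, x e = 0) :
    Γ.chainSupport x ⊆ Γ.subSupport S :=
  (biUnion_subset_biUnion_left fun e (he : x e ≠ 0) => by_contra fun h => he (hS e h)).trans subset_union_right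

theorem arc_subset_chainSupport {e : E(G)} (he : x e ≠ 0) : Γ.arc e ⊆ Γ.chainSupport x :=
  subset_biUnion_of_mem (u := fun e => Γ.arc e) (show e ∈ {e | x e ≠ 0} from he)

theorem pos_mem_arc {e : E(G)} {v : V(G)} (h : G.Inc e v) : Γ.pos v ∈ Γ.arc e := by
  obtain ⟨y, hy⟩ := h
  obtain ⟨γ, -, hγ⟩ := Γ.exists_path e v ⟨y, hy.right_mem⟩ hy
  rw [← hγ]
  exact ⟨0, γ.source⟩

theorem exp_edgeInc {e : E(G)} {z : ℂ} (hz : z ∉ Γ.arc e) :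
    exp (Γ.edgeInc K e z) = (Γ.pos (K.head e) - z) / (Γ.pos (K.tail e) - z) := by
  rw [edgeInc, exp_logInc zero_le_one (Γ.continuous_curve K e).continuousOn
    (by rwa [image_curve]), curve_zero, curve_one]

theorem continuousOn_edgeInc (e : E(G)) : ContinuousOn (Γ.edgeInc K e) (Γ.arc e)ᶜ := by
  rw [← Γ.image_curve K]
  exact continuousOn_logInc zero_le_one (Γ.continuous_curve K e).continuousOn

theorem chainSupport_subset_support : Γ.chainSupport x ⊆ Γ.support := by
  rw [← subSupport_univ]
  exact Γ.chainSupport_subset (by simp)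

theorem IsFace.subset_compl {Γ : G.PlaneEmbedding} {f : Set ℂ} (hf : Γ.IsFace f) :
    f ⊆ Γ.supportᶜ := by
  obtain ⟨z, -, rfl⟩ := hf
  exact connectedComponentIn_subset _ _

theorem IsFace.isPreconnected {Γ : G.PlaneEmbedding} {f : Set ℂ} (hf : Γ.IsFace f) :
    IsPreconnected f := by
  obtain ⟨z, -, rfl⟩ := hf
  exact isPreconnected_connectedComponentIn

variable [Fintype E(G)] (x)

theorem isClosed_chainSupport : IsClosed (Γ.chainSupport x) :=
  (Set.toFinite _).isClosed_biUnion fun e _ => (Γ.isCompact_arc e).isClosed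

/-- The total increment of the logarithm of `· - z` along a chain. -/
def chainInc (z : ℂ) : ℂ := ∑ e, (x e : ℂ) * Γ.edgeInc K e z

open Classical in
/-- The winding number of a closed chain around a point. -/
def windingNumber (z : ℂ) : ℤ :=
  if h : ∃ k : ℤ, Γ.chainInc K x z = 2 * Real.pi * I * k then h.choose else 0

variable {x} {K} {v₀ : V(G)}

theorem continuousOn_chainInc : ContinuousOn (Γ.chainInc K x) (Γ.chainSupport x)ᶜ := by
  refine continuousOn_finsetSum _ fun e _ => ?_
  by_cases he : x e = 0
  · simp only [he, Int.cast_zero, zero_mul]; exact continuousOn_const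
  · exact continuousOn_const.mul ((Γ.continuousOn_edgeInc K e).mono
      (compl_subset_compl.2 (Γ.arc_subset_chainSupport he)))

theorem exp_chainInc (hx : K.IsChain x v₀ v₀) {z : ℂ} (hz : z ∉ Γ.chainSupport x) :
    exp (Γ.chainInc K x z) = 1 := by
  -- Testing the closed chain against logarithms of the vertices makes the end factors cancel. The
  -- principal branch may jump, but only exponentials are compared.
  have h := hx fun v => log (Γ.pos v - z)
  rw [sub_self] at h
  rw [← exp_zero, ← h, chainInc, exp_sum, exp_sum]
  refine Finset.prod_congr rfl fun e _ => ?_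
  by_cases he : x e = 0
  · simp [he]
  · have hze : z ∉ Γ.arc e := fun h => hz (Γ.arc_subset_chainSupport he h)
    have hh : Γ.pos (K.head e) - z ≠ 0 := fun h => hze (by
      rw [← sub_eq_zero.1 h]; exact Γ.pos_mem_arc (K.isLink e).inc_right)
    have ht : Γ.pos (K.tail e) - z ≠ 0 := fun h => hze (by
      rw [← sub_eq_zero.1 h]; exact Γ.pos_mem_arc (K.isLink e).inc_left)
    rw [exp_int_mul, exp_int_mul, Γ.exp_edgeInc K hze, exp_sub, exp_log hh, exp_log ht]

theorem chainInc_eq (hx : K.IsChain x v₀ v₀) {z : ℂ} (hz : z ∉ Γ.chainSupport x) :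
    Γ.chainInc K x z = 2 * Real.pi * I * Γ.windingNumber K x z := by
  have h : ∃ k : ℤ, Γ.chainInc K x z = 2 * Real.pi * I * k := by
    obtain ⟨k, hk⟩ := exists_int_of_exp_eq ((Γ.exp_chainInc hx hz).trans exp_zero.symm)
    exact ⟨k, by rw [hk, zero_add]⟩
  rw [windingNumber, dif_pos h]
  exact h.choose_spec

theorem intCast_eq_of_two_pi {m n : ℤ} (h : (2 * Real.pi * I * m : ℂ) = 2 * Real.pi * I * n) :
    m = n := by
  exact_mod_cast mul_left_cancel₀ two_pi_I_ne_zero' h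

theorem windingNumber_eq (hx : K.IsChain x v₀ v₀) {U : Set ℂ} (hU : IsPreconnected U)
    (hUx : U ⊆ (Γ.chainSupport x)ᶜ) {z w : ℂ} (hz : z ∈ U) (hw : w ∈ U) :
    Γ.windingNumber K x z = Γ.windingNumber K x w := by
  have := hU.sub_eq_of_exp_eq (f := Γ.chainInc K x) (g := fun _ => 0)
    (Γ.continuousOn_chainInc.mono hUx) continuousOn_const
    (fun y hy => by rw [Γ.exp_chainInc hx (hUx hy), exp_zero]) hz hw
  rw [sub_self, sub_eq_zero, Γ.chainInc_eq hx (hUx hz), Γ.chainInc_eq hx (hUx hw)] at this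
  exact intCast_eq_of_two_pi this

theorem windingNumber_eventuallyEq (hx : K.IsChain x v₀ v₀) {z : ℂ} (hz : z ∉ Γ.chainSupport x) :
    ∀ᶠ w in 𝓝 z, Γ.windingNumber K x w = Γ.windingNumber K x z := by
  obtain ⟨ε, hε, hB⟩ := Metric.isOpen_iff.1 (Γ.isClosed_chainSupport x).isOpen_compl z hz
  filter_upwards [Metric.ball_mem_nhds z hε] with w hw
  exact Γ.windingNumber_eq hx (convex_ball z ε).isPreconnected hB hw (Metric.mem_ball_self hε)

theorem IsFace.windingNumber_eq {Γ : G.PlaneEmbedding} {f : Set ℂ} (hf : Γ.IsFace f)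
    (hx : K.IsChain x v₀ v₀) {z w : ℂ} (hz : z ∈ f) (hw : w ∈ f) :
    Γ.windingNumber K x z = Γ.windingNumber K x w :=
  Γ.windingNumber_eq hx hf.isPreconnected
    (hf.subset_compl.trans (compl_subset_compl.2 Γ.chainSupport_subset_support)) hz hw

variable [Finite V(G)]

/-- Crossing an edge from its right to its left increases the winding number of a chain by the
coefficient of the edge. -/
theorem windingNumber_left_sub_right (hx : K.IsChain x v₀ v₀) (e : E(G)) {z w : ℂ}
    (hz : z ∈ Γ.right K e) (hw : w ∈ Γ.left K e) :
    Γ.windingNumber K x w - Γ.windingNumber K x z = x e := by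
  classical
  obtain ⟨η, hη, g, hg, hge, h0, h1, hL⟩ := Γ.sidePair K e half_mem_Ioo
  set p := Γ.curve K e (1 / 2) with hp
  set y : E(G) → ℤ := fun e' => if e' = e then 0 else x e' with hy
  have hpy : p ∉ Γ.chainSupport y := fun h => Γ.curve_notMem_subSupport K (S := {e}ᶜ) (e := e)
    (by simp) half_mem_Ioo (Γ.chainSupport_subset (by
      intro e' he'; simp at he'; simp [hy, he']) h)
  have hsum : ∀ q, Γ.chainInc K x q = Γ.chainInc K y q + x e * Γ.edgeInc K e q := by
    intro q
    rw [chainInc, chainInc, ← Finset.add_sum_erase _ _ (Finset.mem_univ e),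
      ← Finset.add_sum_erase (a := e) _ (fun e' => (y e' : ℂ) * Γ.edgeInc K e' q) (Finset.mem_univ e)]
    have : ∑ e' ∈ Finset.univ.erase e, (x e' : ℂ) * Γ.edgeInc K e' q =
        ∑ e' ∈ Finset.univ.erase e, (y e' : ℂ) * Γ.edgeInc K e' q := by
      refine Finset.sum_congr rfl fun e' he' => ?_
      simp [hy, Finset.ne_of_mem_erase he']
    rw [this]
    simp [hy]; ring
  have hc : ContinuousAt (fun q => Γ.chainInc K y q + x e * g q) p :=
    (Γ.continuousOn_chainInc.continuousAt
      ((Γ.isClosed_chainSupport y).isOpen_compl.mem_nhds hpy)).add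
      (continuousAt_const.mul (hg.continuousAt (Metric.ball_mem_nhds _ hη)))
  obtain ⟨ε, hε, hB⟩ := Metric.continuousAt_iff.1 hc 1 one_pos
  obtain ⟨a, ha, hag⟩ := h0 _ (lt_min hε hη)
  obtain ⟨b, hb, hbg⟩ := h1 _ (lt_min hε hη)
  have haη := Metric.ball_subset_ball (min_le_right _ _) ha.1
  have hbη := Metric.ball_subset_ball (min_le_right _ _) hb.1
  have hae := hB (Metric.ball_subset_ball (min_le_left _ _) ha.1)
  have hbe := hB (Metric.ball_subset_ball (min_le_left _ _) hb.1)
  have har : connectedComponentIn Γ.supportᶜ a = Γ.right K e := by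
    rcases (hL a ⟨haη, ha.2⟩).2 with h | h
    · exact h.2
    · have := h.1
      rw [hag] at this
      exact absurd (by linear_combination -this) two_pi_I_ne_zero'
  have hbl : connectedComponentIn Γ.supportᶜ b = Γ.left K e := by
    rcases (hL b ⟨hbη, hb.2⟩).2 with h | h
    · have := h.1
      rw [hbg] at this
      exact absurd (by linear_combination this) two_pi_I_ne_zero'
    · exact h.2
  have has := (hL a ⟨haη, ha.2⟩).1
  have hbs := (hL b ⟨hbη, hb.2⟩).1
  rw [(Γ.isFace_right K e).windingNumber_eq hx hz (har ▸ mem_connectedComponentIn has),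
    (Γ.isFace_left K e).windingNumber_eq hx hw (hbl ▸ mem_connectedComponentIn hbs)]
  have ea := Γ.chainInc_eq hx fun h => has (Γ.chainSupport_subset_support h)
  have eb := Γ.chainInc_eq hx fun h => hbs (Γ.chainSupport_subset_support h)
  rw [hsum, edgeInc, hag] at ea
  rw [hsum, edgeInc, hbg] at eb
  -- Without the edge `e` the chain has a continuous increment at `p`. Comparing close points on the
  -- two sides leaves an error `2πi n` of modulus less than `2`, so `n = 0`.
  set n := Γ.windingNumber K x b - Γ.windingNumber K x a - x e with hn
  have hnorm : ‖(2 * Real.pi * I * n : ℂ)‖ < 2 := by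
    have : (2 * Real.pi * I * n : ℂ) = (Γ.chainInc K y b + x e * g b) -
        (Γ.chainInc K y a + x e * g a) := by
      rw [hn]; push_cast; linear_combination ea - eb
    rw [this, ← dist_eq_norm]
    calc _ ≤ _ := dist_triangle_right _ _ (Γ.chainInc K y p + x e * g p)
      _ < 2 := by linarith
  have h2 : ‖(2 * Real.pi * I * n : ℂ)‖ = 2 * Real.pi * |(n : ℝ)| := by
    rw [norm_mul, norm_mul, norm_mul]
    simp [abs_of_pos Real.pi_pos]
  rw [h2] at hnorm
  have h3 : |(n : ℝ)| < 1 := by nlinarith [Real.pi_gt_three, abs_nonneg (n : ℝ)]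
  have h4 : |n| < 1 := by exact_mod_cast h3
  rw [Int.abs_lt_one_iff] at h4
  omega

/-- Far away, `w - z` has a logarithm on a whole disc containing the drawing. The increments are
then differences of a potential, and a closed chain sums them to zero. -/
theorem exists_windingNumber_eq_zero (hx : K.IsChain x v₀ v₀) :
    ∃ R, ∀ z : ℂ, R < ‖z‖ → z ∉ Γ.support ∧ Γ.windingNumber K x z = 0 := by
  obtain ⟨R, hR0, hR⟩ := Γ.isCompact_support.isBounded.exists_pos_norm_le
  refine ⟨R + 1, fun z hz => ?_⟩
  have hzs : z ∉ Γ.support := fun h => by linarith [hR z h]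
  refine ⟨hzs, ?_⟩
  have hsub : Γ.support ⊆ Metric.ball 0 (R + 1) := fun w hw => by
    rw [mem_ball_zero_iff]; linarith [hR w hw]
  have harc : ∀ e, Γ.arc e ⊆ Metric.ball 0 (R + 1) := fun e w hw =>
    hsub (Or.inr (mem_iUnion.2 ⟨e, hw⟩))
  obtain ⟨L, hL, hLe⟩ := (convex_ball (0:ℂ) (R + 1)).hasLogOn Metric.isOpen_ball
    (g := fun w => w - z) (by fun_prop) (fun w hw h => by
      rw [sub_eq_zero.1 h, mem_ball_zero_iff] at hw; linarith)
  have hinc : ∀ e, Γ.edgeInc K e z = L (Γ.pos (K.head e)) - L (Γ.pos (K.tail e)) := by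
    intro e
    have hm : MapsTo (Γ.curve K e) (Icc 0 1) (Metric.ball 0 (R + 1)) := fun s hs =>
      harc e (by rw [← Γ.image_curve K]; exact ⟨s, hs, rfl⟩)
    rw [edgeInc, logInc_eq zero_le_one (l := fun s => L (Γ.curve K e s))
      (hL.comp (Γ.continuous_curve K e).continuousOn hm) (fun s hs => hLe _ (hm hs)),
      curve_zero, curve_one]
  have h := hx fun v => L (Γ.pos v)
  have h2 := Γ.chainInc_eq hx fun h => hzs (Γ.chainSupport_subset_support h)
  rw [chainInc] at h2
  simp only [hinc, h, sub_self] at h2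
  exact (intCast_eq_of_two_pi (by rw [← h2]; simp) : (0:ℤ) = _).symm

end PlaneEmbedding
end Graph

/-! ### Logarithms on subgraphs -/

namespace Graph

variable {α β : Type*} {G : Graph α β}

namespace PlaneEmbedding

variable (Γ : G.PlaneEmbedding) (K : G.Orientation)

theorem exists_log_arc (e : E(G)) {z : ℂ} (hz : z ∉ Γ.arc e) :
    ∃ F : ℂ → ℂ, ContinuousOn F (Γ.arc e) ∧ (∀ q ∈ Γ.arc e, exp (F q) = q - z) ∧
      Γ.edgeInc K e z = F (Γ.pos (K.head e)) - F (Γ.pos (K.tail e)) := by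
  have hγ := Γ.continuous_curve K e
  have hinj := Γ.injOn_curve K e
  rw [← Γ.image_curve K] at hz ⊢
  obtain ⟨l, hl, he⟩ := hasLogOn_curve hγ.continuousOn hz
  set F : ℂ → ℂ := fun q => l (Function.invFunOn (Γ.curve K e) (Icc 0 1) q) with hF
  have hFγ : ∀ s ∈ Icc (0:ℝ) 1, F (Γ.curve K e s) = l s := by
    intro s hs
    simp only [hF, hinj.leftInvOn_invFunOn hs]
  refine ⟨F, continuousOn_image_of_comp isCompact_Icc hγ.continuousOn (hl.congr hFγ), ?_, ?_⟩
  · rintro _ ⟨s, hs, rfl⟩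
    rw [hFγ s hs, he s hs]
  · rw [edgeInc, logInc_eq zero_le_one hl he, ← curve_zero, ← curve_one, hFγ 1 (by simp),
      hFγ 0 (by simp)]

variable [Finite V(G)] [Finite E(G)]

/-- A potential on the vertices extends to a continuous logarithm on the subgraph. -/
theorem exists_log_of_potential {z w : ℂ} (n₁ n₂ : ℤ) (A : V(G) → ℂ)
    (hA : ∀ v, exp (A v) = (Γ.pos v - z) ^ n₁ * (Γ.pos v - w) ^ n₂) (S : Set E(G))
    (hz : ∀ e ∈ S, z ∉ Γ.arc e) (hw : ∀ e ∈ S, w ∉ Γ.arc e)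
    (hS : ∀ e ∈ S, A (K.head e) - A (K.tail e) = n₁ * Γ.edgeInc K e z + n₂ * Γ.edgeInc K e w) :
    ∃ L : ℂ → ℂ, ContinuousOn L (Γ.subSupport S) ∧
      (∀ q ∈ Γ.subSupport S, exp (L q) = (q - z) ^ n₁ * (q - w) ^ n₂) ∧
      ∀ v, L (Γ.pos v) = A v := by
  induction S, S.toFinite using Set.Finite.induction_on with
  | empty =>
    have h : Γ.subSupport ∅ = range Γ.pos := by simp [subSupport]
    rw [h]
    refine ⟨Function.extend Γ.pos A 0, (finite_range _).continuousOn _, ?_,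
      fun v => Γ.pos_injective.extend_apply A 0 v⟩
    rintro _ ⟨v, rfl⟩
    rw [Γ.pos_injective.extend_apply, hA]
  | @insert e S heS _ ih =>
    obtain ⟨L, hL, hLe, hLA⟩ := ih (fun e' he' => hz e' (mem_insert_of_mem _ he'))
      (fun e' he' => hw e' (mem_insert_of_mem _ he')) (fun e' he' => hS e' (mem_insert_of_mem _ he'))
    obtain ⟨F, hF, hFe, hFi⟩ := Γ.exists_log_arc K e (hz e (mem_insert _ _))
    obtain ⟨F', hF', hFe', hFi'⟩ := Γ.exists_log_arc K e (hw e (mem_insert _ _))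
    have he := hS e (mem_insert _ _)
    rw [hFi, hFi'] at he
    have hexp : ∀ q ∈ Γ.arc e, exp (n₁ * F q + n₂ * F' q) = (q - z) ^ n₁ * (q - w) ^ n₂ := by
      intro q hq
      rw [exp_add, exp_int_mul, exp_int_mul, hFe q hq, hFe' q hq]
    have htm := Γ.pos_mem_arc (K.isLink e).inc_left
    -- The shift by `k` makes the logarithm on the new arc agree with `A` at the tail; the
    -- hypothesis on the increment gives agreement at the head.
    obtain ⟨k, hk⟩ := exists_int_of_exp_eq ((hA (K.tail e)).trans (hexp _ htm).symm)
    rw [subSupport_insert]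
    obtain ⟨M, hM, hMe, hML⟩ := exists_log_union (h := fun q => (q - z) ^ n₁ * (q - w) ^ n₂)
      (Γ.isCompact_arc e).isClosed (Γ.isCompact_subSupport S).isClosed
      (L₁ := fun q => n₁ * F q + n₂ * F' q + 2 * Real.pi * I * k) (L₂ := L) (by fun_prop) hL
      (fun q hq => by rw [exp_add_two_pi_mul_int, hexp q hq]) hLe (by
        intro q hq hqS
        by_cases hqv : q ∈ range Γ.pos
        · obtain ⟨v, rfl⟩ := hqv
          rw [hLA]
          rcases (Γ.inc_of_mem e v hq).eq_or_eq_of_isLink (K.isLink e) with h | h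
          · rw [Subtype.ext h, hk]
          · rw [Subtype.ext h]
            linear_combination -hk - he
        · obtain ⟨t, ht, rfl⟩ := Γ.exists_curve_eq K hq hqv
          exact absurd hqS (Γ.curve_notMem_subSupport K heS ht))
    exact ⟨M, hM, hMe, fun v => by rw [hML (Or.inl ⟨v, rfl⟩), hLA]⟩

end PlaneEmbedding

section Winding

variable {Γ : G.PlaneEmbedding} {K : G.Orientation} {x : E(G) → ℤ} {v₀ : V(G)}

open PlaneEmbedding

theorem PlaneEmbedding.curve_notMem_chainSupport {e : E(G)} (he : x e = 0) {t : ℝ}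
    (ht : t ∈ Ioo (0:ℝ) 1) : Γ.curve K e t ∉ Γ.chainSupport x := fun h =>
  Γ.curve_notMem_subSupport K (S := {e}ᶜ) (by simp) ht (Γ.chainSupport_subset (by
    intro e' he'; simp at he'; rw [he', he]) h)

variable [Fintype E(G)]

/-- The arc without its other end is connected and avoids the chain. -/
theorem PlaneEmbedding.windingNumber_pos_eq_curve (hx : K.IsChain x v₀ v₀) {e : E(G)}
    (he : x e = 0) {v : V(G)} (hv : G.Inc e v) (hvx : Γ.pos v ∉ Γ.chainSupport x) :
    Γ.windingNumber K x (Γ.pos v) = Γ.windingNumber K x (Γ.curve K e (1 / 2)) := by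
  rcases hv.eq_or_eq_of_isLink (K.isLink e) with h | h
  · rw [Subtype.ext h, ← Γ.curve_zero K] at hvx ⊢
    have hU : IsPreconnected (Γ.curve K e '' Ico 0 1) :=
      isPreconnected_Ico.image _ (Γ.continuous_curve K e).continuousOn
    refine Γ.windingNumber_eq hx hU ?_ ⟨0, by simp, rfl⟩ ⟨1 / 2, by norm_num, rfl⟩
    rintro _ ⟨t, ht, rfl⟩
    rcases ht.1.eq_or_lt with rfl | h0
    · exact hvx
    · exact curve_notMem_chainSupport he ⟨h0, ht.2⟩
  · rw [Subtype.ext h, ← Γ.curve_one K] at hvx ⊢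
    have hU : IsPreconnected (Γ.curve K e '' Ioc 0 1) :=
      isPreconnected_Ioc.image _ (Γ.continuous_curve K e).continuousOn
    refine Γ.windingNumber_eq hx hU ?_ ⟨1, by simp, rfl⟩ ⟨1 / 2, by norm_num, rfl⟩
    rintro _ ⟨t, ht, rfl⟩
    rcases ht.2.eq_or_lt with rfl | h1
    · exact hvx
    · exact curve_notMem_chainSupport he ⟨ht.1, h1⟩

variable [Finite V(G)]

/-- Along an edge which is not in the chain, the winding number is that of the adjacent faces. -/
theorem PlaneEmbedding.windingNumber_right_eq_curve (hx : K.IsChain x v₀ v₀) {e : E(G)}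
    (he : x e = 0) {z : ℂ} (hz : z ∈ Γ.right K e) :
    Γ.windingNumber K x z = Γ.windingNumber K x (Γ.curve K e (1 / 2)) := by
  have hp := Γ.windingNumber_eventuallyEq hx
    (curve_notMem_chainSupport (K := K) he half_mem_Ioo)
  obtain ⟨ε, hε, hB⟩ := Metric.eventually_nhds_iff_ball.1 hp
  obtain ⟨η, hη, g, -, -, h0, -⟩ := (Γ.sidePair K e half_mem_Ioo).twoSided
  obtain ⟨a, ha, har, -⟩ := h0 ε hε
  rw [(Γ.isFace_right K e).windingNumber_eq hx hz har, hB a ha.1]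

end Winding

/-! ### Spanning forests rooted at a set of vertices -/

/-- The rank `r` is the distance to `C`, and the parent is the next vertex on a shortest walk. The
parent edges form a forest rooted in `C`. -/
theorem exists_parent (hG : G.Preconnected) [Nonempty E(G)] {C : Set V(G)} (hC : C.Nonempty) :
    ∃ (r : V(G) → ℕ) (up : V(G) → V(G)) (par : V(G) → E(G)),
      ∀ v ∉ C, G.IsLink (par v) v (up v) ∧ r (up v) < r v := by
  classical
  obtain ⟨c, hc⟩ := hC
  have : Nonempty V(G) := ⟨c⟩
  let reach : ℕ → V(G) → Prop := fun n => Nat.rec (motive := fun _ => V(G) → Prop)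
    (fun v => v ∈ C) (fun _ R v => ∃ (u : V(G)) (e : β), G.IsLink e v u ∧ R u) n
  have hreach : ∀ v, ∃ n, reach n v := by
    have aux : ∀ a : α, Relation.ReflTransGen G.Adj a c → ∀ ha : a ∈ V(G), ∃ n, reach n ⟨a, ha⟩ := by
      intro a h
      induction h using Relation.ReflTransGen.head_induction_on with
      | refl => exact fun _ => ⟨0, hc⟩
      | head hab _ ih =>
        obtain ⟨e, he⟩ := hab
        obtain ⟨n, hn⟩ := ih he.right_mem
        exact fun _ => ⟨n + 1, ⟨_, he.right_mem⟩, e, he, hn⟩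
    exact fun v => aux v (hG v c) v.2
  have key : ∀ v ∉ C, ∃ p : V(G) × E(G), G.IsLink p.2 v p.1 ∧
      Nat.find (hreach p.1) < Nat.find (hreach v) := by
    intro v hv
    have h := Nat.find_spec (hreach v)
    rcases hn : Nat.find (hreach v) with _ | n
    · rw [hn] at h; exact absurd h hv
    · rw [hn] at h
      obtain ⟨u, e, he, hu⟩ := h
      exact ⟨(u, ⟨e, he.edge_mem⟩), he, Nat.lt_succ_of_le (Nat.find_min' _ hu)⟩
  choose! p hp using key
  exact ⟨fun v => Nat.find (hreach v), fun v => (p v).1, fun v => (p v).2, hp⟩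

/-- Potentials on a rooted forest: values on `C` and increments on parent edges are free, as
recursion on the rank meets no cycle. -/
theorem exists_forall_eq_add {V M : Type*} [AddGroup M] {C : Set V} {r : V → ℕ} {up : V → V}
    (h : ∀ v ∉ C, r (up v) < r v) (A₀ J : V → M) :
    ∃ A : V → M, (∀ v ∈ C, A v = A₀ v) ∧ ∀ v ∉ C, A v = A (up v) + J v := by
  classical
  let F : ∀ v, (∀ u, r u < r v → M) → M := fun v rec =>
    if hv : v ∈ C then A₀ v else rec (up v) (h v hv) + J v
  have hwf : WellFounded fun u v => r u < r v := (measure r).wf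
  refine ⟨hwf.fix F, fun v hv => ?_, fun v hv => ?_⟩
  · rw [hwf.fix_eq]; simp only [F, dif_pos hv]
  · rw [hwf.fix_eq]; simp only [F, dif_neg hv]

end Graph

/-! ### Winding numbers of cycles -/

theorem Fin.cyclic_induction {m : ℕ} [NeZero m] {P : Fin m → Prop} (h0 : P 0)
    (h : ∀ i, P i → P (i + 1)) (i : Fin m) : P i := by
  have key : ∀ n (hn : n < m), P ⟨n, hn⟩ := by
    intro n
    induction n with
    | zero => exact fun hn => h0
    | succ n ih =>
      intro hn
      have : (⟨n + 1, hn⟩ : Fin m) = ⟨n, by omega⟩ + 1 := by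
        apply Fin.ext
        rw [Fin.val_add, Fin.val_one']
        simp [Nat.mod_eq_of_lt hn]
      rw [this]
      exact h _ (ih _)
  exact key i i.2

/-- Partial sums of `J`; the vanishing total is what makes them close up modulo `m`. -/
theorem Fin.exists_sub_eq {m : ℕ} [NeZero m] {M : Type*} [AddCommGroup M] (J : Fin m → M)
    (hJ : ∑ i, J i = 0) (a : M) : ∃ B : Fin m → M, B 0 = a ∧ ∀ i, B (i + 1) = B i + J i := by
  set J' : ℕ → M := fun n => if h : n < m then J ⟨n, h⟩ else 0 with hJ'
  have hval : ∀ i : Fin m, J' i = J i := fun i => by simp [hJ']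
  refine ⟨fun i => a + ∑ n ∈ Finset.range i, J' n, by simp, fun i => ?_⟩
  have hv : ((i + 1 : Fin m) : ℕ) = (i + 1) % m := by
    rw [Fin.val_add, Fin.val_one', Nat.add_mod_mod]
  simp only [hv]
  rcases lt_or_ge (i.1 + 1) m with h | h
  · rw [Nat.mod_eq_of_lt h, Finset.sum_range_succ, hval]; abel
  · have hm : i.1 + 1 = m := le_antisymm i.2 h
    rw [add_assoc, ← hval, ← Finset.sum_range_succ, hm, Nat.mod_self, Finset.sum_range_zero,
      Finset.sum_range]
    simp only [hval, hJ]

namespace Graph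

variable {α β : Type*} {G : Graph α β}

namespace Cycle

variable {m : ℕ} [NeZero m] (C : G.Cycle m) (K : G.Orientation)

open Classical in
/-- The sign of an edge of a cycle: whether it is directed along the cycle. -/
def sign (i : Fin m) : ℤ := if K.tail (C.edge i) = C.vert i then 1 else -1

theorem sign_eq_one_or (i : Fin m) : C.sign K i = 1 ∨ C.sign K i = -1 := by
  unfold sign; split_ifs <;> simp

theorem sign_mul_sub (i : Fin m) (A : V(G) → ℂ) :
    (C.sign K i : ℂ) * (A (K.head (C.edge i)) - A (K.tail (C.edge i))) =
      A (C.vert (i + 1)) - A (C.vert i) := by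
  unfold sign
  rcases K.isLink_iff (C.isLink i) with ⟨h1, h2⟩ | ⟨h1, h2⟩
  · rw [if_pos h1, h1, h2]; simp
  · split_ifs with h
    -- This would be a cycle of length one, on a loop, where both sides are zero.
    · have : C.vert (i + 1) = C.vert i := h1.symm.trans h
      rw [h1, h2, this]; simp
    · rw [h1, h2]; simp

open Classical in
/-- The chain of a cycle. -/
def chain (e : E(G)) : ℤ := ∑ i, if C.edge i = e then C.sign K i else 0

theorem chain_edge (i : Fin m) : C.chain K (C.edge i) = C.sign K i := by
  classical
  rw [chain, Finset.sum_eq_single i]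
  · simp
  · intro j _ hj
    rw [if_neg fun h => hj (C.edge_injective h)]
  · simp

theorem chain_eq_zero {e : E(G)} (he : e ∉ range C.edge) : C.chain K e = 0 :=
  Finset.sum_eq_zero fun i _ => if_neg fun h => he ⟨i, h⟩

theorem sum_chain_mul [Fintype E(G)] (f : E(G) → ℂ) :
    ∑ e, (C.chain K e : ℂ) * f e = ∑ i, (C.sign K i : ℂ) * f (C.edge i) := by
  classical
  simp only [chain, Int.cast_sum, Finset.sum_mul]
  rw [Finset.sum_comm]
  refine Finset.sum_congr rfl fun i _ => ?_
  rw [Finset.sum_eq_single (C.edge i)]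
  · simp
  · intro b _ hb
    rw [if_neg hb.symm]; simp
  · simp

theorem isChain_chain [Fintype E(G)] (v : V(G)) : K.IsChain (C.chain K) v v := fun A => by
  rw [C.sum_chain_mul K fun e => A (K.head e) - A (K.tail e)]
  simp only [sign_mul_sub, Finset.sum_sub_distrib, sub_self]
  rw [sub_eq_zero]
  exact Equiv.sum_comp (Equiv.addRight (1 : Fin m)) fun i => A (C.vert i)

/-- The edges of a cycle and the parent edges of all other vertices. -/
def frame (par : V(G) → E(G)) : Set E(G) := range C.edge ∪ par '' (range C.vert)ᶜ

theorem chain_eq_zero_of_notMem_frame {par : V(G) → E(G)} {e : E(G)} (he : e ∉ C.frame par) :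
    C.chain K e = 0 := C.chain_eq_zero K fun h => he (Or.inl h)

variable {C} {r : V(G) → ℕ} {up : V(G) → V(G)} {par : V(G) → E(G)}

/-- The frame is connected: parent edges lead to the cycle, and the cycle leads to its vertex `0`.
-/
theorem exists_isChain_frame [Fintype E(G)]
    (hpar : ∀ v ∉ range C.vert, G.IsLink (par v) v (up v) ∧ r (up v) < r v) (v : V(G)) :
    ∃ x : E(G) → ℤ, (∀ e ∉ C.frame par, x e = 0) ∧ K.IsChain x v (C.vert 0) := by
  induction hn : r v using Nat.strong_induction_on generalizing v with
  | _ n ih =>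
    by_cases hv : v ∈ range C.vert
    · obtain ⟨i, rfl⟩ := hv
      suffices ∃ x : E(G) → ℤ, (∀ e ∉ C.frame par, x e = 0) ∧ K.IsChain x (C.vert 0) (C.vert i) by
        obtain ⟨x, hx, hc⟩ := this
        exact ⟨-x, fun e he => by simp [hx e he], hc.neg⟩
      clear hn ih
      induction i using Fin.cyclic_induction with
      | h0 => exact ⟨0, by simp, .zero _⟩
      | h i ih =>
        obtain ⟨x, hx, hc⟩ := ih
        obtain ⟨y, hy, hd⟩ := K.exists_isChain_of_isLink (C.isLink i)
        refine ⟨x + y, fun e he => ?_, hc.add hd⟩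
        rw [Pi.add_apply, hx e he, hy e (by rintro rfl; exact he (Or.inl ⟨i, rfl⟩)), add_zero]
    · obtain ⟨hl, hr⟩ := hpar v hv
      obtain ⟨x, hx, hc⟩ := ih _ (hn ▸ hr) (up v) rfl
      obtain ⟨y, hy, hd⟩ := K.exists_isChain_of_isLink hl
      refine ⟨y + x, fun e he => ?_, hd.add hc⟩
      rw [Pi.add_apply, hx e he, hy e (by rintro rfl; exact he (Or.inr ⟨v, hv, rfl⟩)), add_zero]

variable (Γ : G.PlaneEmbedding)

/-- The frame has a single cycle `C`, so the total increment around `C` is the only obstruction to a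
logarithm, and `hn` says that it vanishes. A potential is built by partial sums around `C` and then
up the forest. This serves both to bound the winding numbers and to connect points with the same
winding number. -/
theorem hasLogOn_frame [Fintype E(G)] [Finite V(G)]
    (hpar : ∀ v ∉ range C.vert, G.IsLink (par v) v (up v) ∧ r (up v) < r v) {z w : ℂ}
    (hz : z ∉ Γ.subSupport (C.frame par)) (hw : w ∉ Γ.subSupport (C.frame par)) {n₁ n₂ : ℤ}
    (hn : n₁ * Γ.windingNumber K (C.chain K) z + n₂ * Γ.windingNumber K (C.chain K) w = 0) :
    HasLogOn (fun q => (q - z) ^ n₁ * (q - w) ^ n₂) (Γ.subSupport (C.frame par)) := by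
  set S := C.frame par with hS
  set I : E(G) → ℂ := fun e => n₁ * Γ.edgeInc K e z + n₂ * Γ.edgeInc K e w with hI
  set H : V(G) → ℂ := fun v => (Γ.pos v - z) ^ n₁ * (Γ.pos v - w) ^ n₂ with hH
  have hsub := Γ.chainSupport_subset (x := C.chain K) (S := S)
    fun e he => C.chain_eq_zero_of_notMem_frame K he
  have hzv : ∀ v, Γ.pos v - z ≠ 0 := fun v h => hz (Or.inl ⟨v, sub_eq_zero.1 h⟩)
  have hwv : ∀ v, Γ.pos v - w ≠ 0 := fun v h => hw (Or.inl ⟨v, sub_eq_zero.1 h⟩)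
  have hza : ∀ e ∈ S, z ∉ Γ.arc e := fun e he h => hz (Or.inr (mem_biUnion he h))
  have hwa : ∀ e ∈ S, w ∉ Γ.arc e := fun e he h => hw (Or.inr (mem_biUnion he h))
  have hH0 : ∀ v, H v ≠ 0 := fun v => mul_ne_zero (zpow_ne_zero _ (hzv v)) (zpow_ne_zero _ (hwv v))
  have hIe : ∀ e ∈ S, exp (I e) = H (K.head e) / H (K.tail e) := by
    intro e he
    rw [hI, exp_add, exp_int_mul, exp_int_mul, Γ.exp_edgeInc K (hza e he),
      Γ.exp_edgeInc K (hwa e he), hH, div_zpow, div_zpow]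
    ring
  have hCS : ∀ i, C.edge i ∈ S := fun i => Or.inl ⟨i, rfl⟩
  have hsum : ∑ i, (C.sign K i : ℂ) * I (C.edge i) = 0 := by
    rw [← C.sum_chain_mul K I]
    have h1 := Γ.chainInc_eq (C.isChain_chain K (C.vert 0)) fun h => hz (hsub h)
    have h2 := Γ.chainInc_eq (C.isChain_chain K (C.vert 0)) fun h => hw (hsub h)
    have : ∑ e, (C.chain K e : ℂ) * I e =
        n₁ * Γ.chainInc K (C.chain K) z + n₂ * Γ.chainInc K (C.chain K) w := by
      simp only [PlaneEmbedding.chainInc, hI, Finset.mul_sum, ← Finset.sum_add_distrib]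
      exact Finset.sum_congr rfl fun e _ => by ring
    rw [this, h1, h2]
    have : (n₁ * Γ.windingNumber K (C.chain K) z + n₂ * Γ.windingNumber K (C.chain K) w : ℂ) = 0 := by
      exact_mod_cast hn
    linear_combination 2 * Real.pi * Complex.I * this
  obtain ⟨B, hB0, hB⟩ := Fin.exists_sub_eq _ hsum (log (H (C.vert 0)))
  obtain ⟨A, hAC, hA⟩ := exists_forall_eq_add (fun v hv => (hpar v hv).2)
    (Function.extend C.vert B 0) (open Classical in
      fun v => if K.head (par v) = v then I (par v) else - I (par v))
  have hAv : ∀ i, A (C.vert i) = B i := fun i => by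
    rw [hAC _ ⟨i, rfl⟩, C.vert_injective.extend_apply]
  have hdiff : ∀ e ∈ S, A (K.head e) - A (K.tail e) = I e := by
    rintro e (⟨i, rfl⟩ | ⟨v, hv, rfl⟩)
    · have h1 := C.sign_mul_sub K i A
      rw [hAv, hAv, hB, add_sub_cancel_left] at h1
      have hs : (C.sign K i : ℂ) ≠ 0 := by
        rcases C.sign_eq_one_or K i with h | h <;> simp [h]
      exact mul_left_cancel₀ hs h1
    · have h1 := hA v hv
      obtain ⟨hl, hr⟩ := hpar v hv
      rcases K.isLink_iff hl with ⟨h2, h3⟩ | ⟨h2, h3⟩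
      · have hne : up v ≠ v := fun h => by rw [h] at hr; exact lt_irrefl _ hr
        rw [if_neg (by rw [h3]; exact hne)] at h1
        rw [h2, h3, h1]; ring
      · rw [if_pos h3] at h1
        rw [h2, h3, h1]; ring
  have hexp : ∀ v, exp (A v) = H v := by
    intro v
    induction hn : r v using Nat.strong_induction_on generalizing v with
    | _ n ih =>
      by_cases hv : v ∈ range C.vert
      · obtain ⟨i, rfl⟩ := hv
        clear hn ih
        induction i using Fin.cyclic_induction with
        | h0 => rw [hAv, hB0, exp_log (hH0 _)]
        | h i ih =>
          have h1 := hIe _ (hCS i)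
          rw [← hdiff _ (hCS i), exp_sub] at h1
          have e1 := exp_ne_zero (A (C.vert i))
          have e2 := hH0 (C.vert i)
          rcases K.isLink_iff (C.isLink i) with ⟨h2, h3⟩ | ⟨h2, h3⟩
          · rw [h2, h3, ih, div_left_inj' e2] at h1
            exact h1
          · rw [h2, h3, ih, div_eq_mul_inv, div_eq_mul_inv] at h1
            exact inv_injective (mul_left_cancel₀ e2 h1)
      · obtain ⟨hl, hr⟩ := hpar v hv
        have ih' := ih _ (hn ▸ hr) (up v) rfl
        have hS' : par v ∈ S := Or.inr ⟨v, hv, rfl⟩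
        have h1 := hIe _ hS'
        rw [← hdiff _ hS', exp_sub] at h1
        have e2 := hH0 (up v)
        rcases K.isLink_iff hl with ⟨h2, h3⟩ | ⟨h2, h3⟩
        · rw [h2, h3, ih', div_eq_mul_inv, div_eq_mul_inv] at h1
          exact inv_injective (mul_left_cancel₀ e2 h1)
        · rw [h2, h3, ih', div_left_inj' e2] at h1
          exact h1
  obtain ⟨L, hL, hLe, -⟩ := Γ.exists_log_of_potential K n₁ n₂ A hexp S hza hwa hdiff
  exact ⟨L, hL, hLe⟩

/-- The Jordan curve theorem for a cycle: the winding number takes only two values outside of the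
drawing, zero and a sign. -/
theorem exists_windingNumber_values [Fintype E(G)] [Finite V(G)]
    (hpar : ∀ v ∉ range C.vert, G.IsLink (par v) v (up v) ∧ r (up v) < r v) :
    ∃ ε : ℤ, (ε = 1 ∨ ε = -1) ∧ ∀ z ∉ Γ.support,
      Γ.windingNumber K (C.chain K) z = 0 ∨ Γ.windingNumber K (C.chain K) z = ε := by
  set S := C.frame par with hS
  have hx := C.isChain_chain K (C.vert 0)
  have hsub := Γ.chainSupport_subset (x := C.chain K) (S := S)
    fun e he => C.chain_eq_zero_of_notMem_frame K he
  have hSs : ∀ {z}, z ∉ Γ.support → z ∉ Γ.subSupport S := fun hz h =>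
    hz (Γ.subSupport_subset_support _ h)
  have hcl := (Γ.isCompact_subSupport S).isClosed
  set wn := Γ.windingNumber K (C.chain K) with hwn
  have hcomp : ∀ {z w}, z ∉ Γ.support → w ∈ connectedComponentIn (Γ.subSupport S)ᶜ z → wn w = wn z :=
    fun {z w} hz hw => Γ.windingNumber_eq hx isPreconnected_connectedComponentIn
      ((connectedComponentIn_subset _ _).trans (compl_subset_compl.2 hsub)) hw
      (mem_connectedComponentIn (hSs hz))
  have hbdd : ∀ z ∉ Γ.support, wn z ≠ 0 →
      Bornology.IsBounded (connectedComponentIn (Γ.subSupport S)ᶜ z) := by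
    intro z hz hz0
    obtain ⟨R, hR⟩ := Γ.exists_windingNumber_eq_zero hx
    refine isBounded_iff_forall_norm_le.2 ⟨R, fun w hw => ?_⟩
    by_contra! hlt
    exact hz0 ((hcomp hz hw).symm.trans (hR w hlt).2)
  have huniq : ∀ z ∉ Γ.support, ∀ w ∉ Γ.support, wn z ≠ 0 → wn w ≠ 0 → wn z = wn w := by
    intro z hz w hw hz0 hw0
    by_contra hne
    -- Two different nonzero values, used crosswise as exponents, cancel the obstruction;
    -- Eilenberg's criterion then makes one of them zero.
    have hlog := hasLogOn_frame K Γ hpar (hSs hz) (hSs hw) (n₁ := wn w) (n₂ := - wn z) (by ring)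
    have hnot : w ∉ connectedComponentIn (Γ.subSupport S)ᶜ z := fun h => hne (hcomp hz h).symm
    exact hw0 (eq_zero_of_hasLogOn hcl (hSs hz) (hSs hw) (hSs hw) (hbdd z hz hz0) hnot hnot
      (n₁ := wn w) (n₂ := -wn z) (n₃ := 0) (by simpa using hlog))
  obtain ⟨a, ha, hfa⟩ := Γ.isFace_right K (C.edge 0)
  obtain ⟨b, hb, hfb⟩ := Γ.isFace_left K (C.edge 0)
  -- The jump across an edge of the cycle is `±1`, so exactly one of its sides has winding number
  -- `0` and the other has `±1`.
  have hjump := Γ.windingNumber_left_sub_right hx (C.edge 0)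
    (hfa ▸ mem_connectedComponentIn ha) (hfb ▸ mem_connectedComponentIn hb)
  rw [C.chain_edge] at hjump
  have hs := C.sign_eq_one_or K 0
  rw [← hwn] at hjump
  by_cases ha0 : wn a = 0
  · have hb0 : wn b ≠ 0 := by omega
    refine ⟨wn b, by omega, fun z hz => ?_⟩
    by_cases hz0 : wn z = 0
    · exact Or.inl hz0
    · exact Or.inr (huniq z hz b hb hz0 hb0)
  · have hb0 : wn b = 0 := by
      by_contra hb0
      have := huniq a ha b hb ha0 hb0
      omega
    refine ⟨wn a, by omega, fun z hz => ?_⟩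
    by_cases hz0 : wn z = 0
    · exact Or.inl hz0
    · exact Or.inr (huniq z hz a ha hz0 ha0)

end Cycle
end Graph

/-! ### Counting the faces inside a cycle -/

theorem ZMod.natCast_card_subtype {n : ℕ} {ι : Type*} [Fintype ι] (p : ι → Prop) [DecidablePred p] :
    (Nat.card {i // p i} : ZMod n) = ∑ i, if p i then 1 else 0 := by
  rw [Nat.card_eq_fintype_card, Fintype.card_subtype, Finset.card_filter]
  push_cast
  rfl

theorem ZMod.sum_ite_eq_zero_of_involution {ι : Type*} [Fintype ι] {p : ι → Prop} [DecidablePred p]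
    (g : ι → ι) (hp : ∀ i, p i → p (g i)) (hne : ∀ i, p i → g i ≠ i)
    (hg : ∀ i, p i → g (g i) = i) : ∑ i, (if p i then 1 else 0 : ZMod 2) = 0 := by
  rw [← Finset.sum_filter]
  refine Finset.sum_involution (fun i _ => g i) ?_ ?_ ?_ ?_
  · intro i _; decide
  · intro i hi _; exact hne i (Finset.mem_filter.1 hi).2
  · intro i hi; exact Finset.mem_filter.2 ⟨Finset.mem_univ _, hp i (Finset.mem_filter.1 hi).2⟩
  · intro i hi; exact hg i (Finset.mem_filter.1 hi).2

namespace Graph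

variable {α β : Type*} {G : Graph α β}

theorem IsDimer.exists_mate {G : Graph α β} {D : Set E(G)} (hD : G.IsDimer D)
    (hG : ∀ (e : E(G)) (x : V(G)), ¬ G.IsLink e x x) :
    ∃ mate : V(G) → V(G), ∀ v : V(G), (∃ e : E(G), e ∈ D ∧ G.IsLink e v (mate v)) ∧ mate v ≠ v ∧
      mate (mate v) = v := by
  have h : ∀ v : V(G), ∃ u : V(G), ∃ e : E(G), e ∈ D ∧ G.IsLink e v u := by
    intro v
    obtain ⟨e, ⟨heD, u, hu⟩, -⟩ := hD v
    exact ⟨⟨u, hu.right_mem⟩, e, heD, hu⟩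
  choose mate hm using h
  refine ⟨mate, fun v => ⟨hm v, fun h => ?_, ?_⟩⟩
  · obtain ⟨e, -, he⟩ := hm v
    rw [h] at he
    exact hG e v he
  · obtain ⟨e, heD, he⟩ := hm v
    obtain ⟨e', heD', he'⟩ := hm (mate v)
    have : e = e' := (hD (mate v)).unique ⟨heD, he.inc_right⟩ ⟨heD', he'.inc_left⟩
    subst this
    rcases he.eq_and_eq_or_eq_and_eq he' with ⟨h1, h2⟩ | ⟨h1, h2⟩
    · exact Subtype.ext (h2.symm.trans h1.symm)
    · exact Subtype.ext h1.symm

theorem exists_mate_of_deleteVerts {X : Set V(G)} (hG : ∀ (e : E(G)) (x : V(G)), ¬ G.IsLink e x x)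
    {D : Set E(G.deleteVerts (Subtype.val '' X))}
    (hD : (G.deleteVerts (Subtype.val '' X)).IsDimer D) :
    ∃ mate : V(G) → V(G), ∀ v ∉ X, mate v ∉ X ∧ (∃ e : E(G), G.IsLink e v (mate v)) ∧
      mate v ≠ v ∧ mate (mate v) = v := by
  classical
  obtain ⟨mate, hm⟩ := hD.exists_mate (fun e x h => by
    rw [deleteVerts_isLink] at h
    exact hG ⟨e, h.1.edge_mem⟩ ⟨x, h.1.left_mem⟩ h.1)
  have hmem : ∀ v : V(G), v ∉ X ↔ (v : α) ∈ V(G.deleteVerts (Subtype.val '' X)) := by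
    intro v
    rw [vertexSet_deleteVerts]
    simp
  have hmem' : ∀ v : V(G.deleteVerts (Subtype.val '' X)), (v : α) ∈ V(G) := fun v =>
    ((Set.ext_iff.1 (vertexSet_deleteVerts G _) v).1 v.2).1
  refine ⟨fun v => if h : v ∈ X then v else ⟨mate ⟨v, (hmem v).1 h⟩, hmem' _⟩, fun v hv => ?_⟩
  have hX : (⟨mate ⟨v, (hmem v).1 hv⟩, hmem' _⟩ : V(G)) ∉ X :=
    (hmem _).2 (mate ⟨v, (hmem v).1 hv⟩).2
  obtain ⟨⟨e, -, he⟩, h2, h3⟩ := hm ⟨v, (hmem v).1 hv⟩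
  rw [deleteVerts_isLink] at he
  simp only [dif_neg hv, dif_neg hX]
  refine ⟨hX, ⟨⟨e, he.1.edge_mem⟩, he.1⟩, fun h => h2 (Subtype.ext (congrArg (fun u : V(G) => (u : α)) h)), ?_⟩
  exact Subtype.ext (congrArg (fun u : V(G.deleteVerts (Subtype.val '' X)) => (u : α)) h3)

namespace PlaneEmbedding

theorem IsFace.nonempty {Γ : G.PlaneEmbedding} {f : Set ℂ} (hf : Γ.IsFace f) : f.Nonempty := by
  obtain ⟨z, hz, rfl⟩ := hf
  exact ⟨z, mem_connectedComponentIn hz⟩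

variable (Γ : G.PlaneEmbedding) (K : G.Orientation) [Fintype E(G)] (x : E(G) → ℤ)

open Classical in
/-- The winding number of a closed chain around a face. -/
def faceWinding (f : Set ℂ) : ℤ := if h : f.Nonempty then Γ.windingNumber K x h.some else 0

variable {x} {K} {v₀ : V(G)}

theorem IsFace.faceWinding_eq {Γ : G.PlaneEmbedding} {f : Set ℂ} (hf : Γ.IsFace f)
    (hx : K.IsChain x v₀ v₀) {z : ℂ} (hz : z ∈ f) :
    Γ.faceWinding K x f = Γ.windingNumber K x z := by
  have hne : f.Nonempty := ⟨z, hz⟩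
  rw [faceWinding, dif_pos hne]
  exact hf.windingNumber_eq hx hne.some_mem hz

variable [Finite V(G)]

theorem faceWinding_left (hx : K.IsChain x v₀ v₀) (e : E(G)) :
    Γ.faceWinding K x (Γ.left K e) = Γ.faceWinding K x (Γ.right K e) + x e := by
  obtain ⟨z, hz⟩ := (Γ.isFace_right K e).nonempty
  obtain ⟨w, hw⟩ := (Γ.isFace_left K e).nonempty
  rw [(Γ.isFace_left K e).faceWinding_eq hx hw, (Γ.isFace_right K e).faceWinding_eq hx hz,
    ← Γ.windingNumber_left_sub_right hx e hz hw]
  ring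

theorem faceWinding_right_eq_pos (hx : K.IsChain x v₀ v₀) {e : E(G)} (he : x e = 0) {v : V(G)}
    (hv : G.Inc e v) (hvx : Γ.pos v ∉ Γ.chainSupport x) :
    Γ.faceWinding K x (Γ.right K e) = Γ.windingNumber K x (Γ.pos v) := by
  obtain ⟨z, hz⟩ := (Γ.isFace_right K e).nonempty
  rw [(Γ.isFace_right K e).faceWinding_eq hx hz, windingNumber_right_eq_curve hx he hz,
    windingNumber_pos_eq_curve hx he hv hvx]

theorem isBounded_of_faceWinding_ne_zero (hx : K.IsChain x v₀ v₀) {f : Set ℂ} (hf : Γ.IsFace f)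
    (h : Γ.faceWinding K x f ≠ 0) : Bornology.IsBounded f := by
  obtain ⟨R, hR⟩ := Γ.exists_windingNumber_eq_zero hx
  refine isBounded_iff_forall_norm_le.2 ⟨R, fun w hw => ?_⟩
  by_contra! hlt
  exact h ((hf.faceWinding_eq hx hw).trans (hR w hlt).2)

end PlaneEmbedding

/-! ### The tree of faces inside a cycle -/

namespace Cycle

variable {m : ℕ} [NeZero m] (C : G.Cycle m) (K : G.Orientation) [Fintype E(G)]
  [Finite V(G)] (Γ : G.PlaneEmbedding) (ε : ℤ)

/-- The faces with a given winding number. -/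
abbrev InnerFace := {f : Set ℂ // Γ.IsFace f ∧ Γ.faceWinding K (C.chain K) f = ε}

/-- The edges outside of the frame that lie inside of the cycle. -/
abbrev InnerEdge (par : V(G) → E(G)) :=
  {e : E(G) // e ∉ C.frame par ∧ Γ.faceWinding K (C.chain K) (Γ.right K e) = ε}

variable {C} {r : V(G) → ℕ} {up : V(G) → V(G)} {par : V(G) → E(G)} {ε}

/-- Points with equal winding number are not separated by the frame. A path between inner faces
therefore crosses only edges outside the frame; those that are not inner have `φ = 0` on both sides.
Thus the inner edges connect all inner faces. -/
theorem InnerFace.eq_of_forall_edge {X : Type*} [Zero X]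
    (hpar : ∀ v ∉ range C.vert, G.IsLink (par v) v (up v) ∧ r (up v) < r v)
    (φ : Set ℂ → X) (h0 : ∀ f, Γ.IsFace f → Γ.faceWinding K (C.chain K) f ≠ ε → φ f = 0)
    (hφ : ∀ e : C.InnerEdge K Γ ε par, φ (Γ.right K e) = φ (Γ.left K e))
    (f g : C.InnerFace K Γ ε) : φ f = φ g := by
  have hx := C.isChain_chain K (C.vert 0)
  obtain ⟨f, hf, hfε⟩ := f
  obtain ⟨g, hg, hgε⟩ := g
  have hf' := hf
  have hg' := hg
  obtain ⟨z, hz, rfl⟩ := hf'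
  obtain ⟨w, hw, rfl⟩ := hg'
  have hz' : z ∉ Γ.subSupport (C.frame par) := fun h => hz (Γ.subSupport_subset_support _ h)
  have hw' : w ∉ Γ.subSupport (C.frame par) := fun h => hw (Γ.subSupport_subset_support _ h)
  rw [hf.faceWinding_eq hx (mem_connectedComponentIn hz)] at hfε
  rw [hg.faceWinding_eq hx (mem_connectedComponentIn hw)] at hgε
  have hlog := hasLogOn_frame K Γ hpar hz' hw' (n₁ := 1) (n₂ := -1) (by rw [hfε, hgε]; ring)
  have hcc := connectedComponentIn_eq_of_hasLogOn (Γ.isCompact_subSupport _) hz' hw'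
    (by simpa [div_eq_mul_inv] using hlog)
  refine Γ.apply_eq_of_connected K φ (S := C.frame par) (fun e he => ?_) hz hw
    isPreconnected_connectedComponentIn (connectedComponentIn_subset _ z)
    (mem_connectedComponentIn hz') (hcc ▸ mem_connectedComponentIn hw')
  by_cases h : Γ.faceWinding K (C.chain K) (Γ.right K e) = ε
  · exact hφ ⟨e, he, h⟩
  · rw [h0 _ (Γ.isFace_right K e) h, h0 _ (Γ.isFace_left K e)]
    rwa [Γ.faceWinding_left hx, C.chain_eq_zero_of_notMem_frame K he, add_zero]

/-- The edge `e` closes up through the connected frame to a closed chain. Its winding number jumps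
by one across `e` and not at all across the other edges outside the frame, so `e` cannot lie on a
cycle of adjacent faces. -/
theorem exists_face_function (hpar : ∀ v ∉ range C.vert, G.IsLink (par v) v (up v) ∧ r (up v) < r v)
    {e : E(G)} (he : e ∉ C.frame par) : ∃ φ : Set ℂ → ℤ, φ (Γ.left K e) = φ (Γ.right K e) + 1 ∧
      ∀ e' ∉ C.frame par, e' ≠ e → φ (Γ.left K e') = φ (Γ.right K e') := by
  classical
  obtain ⟨x, hx0, hx⟩ := exists_isChain_frame K hpar (K.head e)
  obtain ⟨y, hy0, hy⟩ := exists_isChain_frame K hpar (K.tail e)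
  have hc := ((Orientation.IsChain.single (K := K) e).add hx).add hy.neg
  refine ⟨Γ.faceWinding K (Pi.single e 1 + x + -y), ?_, fun e' he' hne => ?_⟩
  · rw [Γ.faceWinding_left hc]
    simp [hx0 e he, hy0 e he]
  · rw [Γ.faceWinding_left hc]
    simp [hx0 e' he', hy0 e' he', hne]

variable [Finite (C.InnerFace K Γ ε)]

/-- Euler's relation inside the cycle. For the coboundary map `T` from functions on faces to
functions on inner edges, connectedness leaves only constants in the kernel, and acyclicity gives
surjectivity; then ranks are counted. -/
theorem card_innerFace (hpar : ∀ v ∉ range C.vert, G.IsLink (par v) v (up v) ∧ r (up v) < r v)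
    [Nonempty (C.InnerFace K Γ ε)] :
    Nat.card (C.InnerFace K Γ ε) = Nat.card (C.InnerEdge K Γ ε par) + 1 := by
  classical
  have := Fintype.ofFinite (C.InnerFace K Γ ε)
  have hx := C.isChain_chain K (C.vert 0)
  let R : C.InnerEdge K Γ ε par → C.InnerFace K Γ ε := fun e =>
    ⟨Γ.right K e, Γ.isFace_right K e, e.2.2⟩
  let L : C.InnerEdge K Γ ε par → C.InnerFace K Γ ε := fun e =>
    ⟨Γ.left K e, Γ.isFace_left K e, by
      rw [Γ.faceWinding_left hx, C.chain_eq_zero_of_notMem_frame K e.2.1, add_zero, e.2.2]⟩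
  let T : (C.InnerFace K Γ ε → ℚ) →ₗ[ℚ] (C.InnerEdge K Γ ε par → ℚ) :=
    { toFun := fun φ e => φ (L e) - φ (R e)
      map_add' := fun φ ψ => by funext e; simp only [Pi.add_apply]; ring
      map_smul' := fun c φ => by funext e; simp [mul_sub] }
  have hker : LinearMap.ker T = Submodule.span ℚ {fun _ => (1 : ℚ)} := by
    ext φ
    rw [Submodule.mem_span_singleton, LinearMap.mem_ker]
    constructor
    · intro hφ
      obtain ⟨f₀⟩ := ‹Nonempty (C.InnerFace K Γ ε)›
      let ψ : Set ℂ → ℚ := fun F =>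
        if h : Γ.IsFace F ∧ Γ.faceWinding K (C.chain K) F = ε then φ ⟨F, h⟩ else 0
      have hψ : ∀ f : C.InnerFace K Γ ε, ψ f = φ f := fun f => dif_pos f.2
      refine ⟨φ f₀, funext fun f => ?_⟩
      rw [Pi.smul_apply, smul_eq_mul, mul_one, ← hψ, ← hψ]
      refine InnerFace.eq_of_forall_edge K Γ hpar ψ (fun F _ hF => dif_neg fun h => hF h.2)
        (fun e => ?_) _ _
      have : φ (L e) - φ (R e) = 0 := congrFun hφ e
      rw [← hψ, ← hψ] at this
      exact (sub_eq_zero.1 this).symm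
    · rintro ⟨c, rfl⟩
      funext e
      simp [T]
  have hrange : LinearMap.range T = ⊤ := by
    rw [eq_top_iff]
    intro y _
    rw [← Finset.univ_sum_single y]
    refine Submodule.sum_mem _ fun e _ => ?_
    obtain ⟨φ, h1, h2⟩ := exists_face_function K Γ hpar e.2.1
    refine ⟨fun f => y e * φ f, funext fun e' => ?_⟩
    change y e * φ (Γ.left K e') - y e * φ (Γ.right K e') = _
    by_cases h : e' = e
    · subst h; rw [h1]; simp; ring
    · rw [h2 e' e'.2.1 (fun h' => h (Subtype.ext h')), Pi.single_eq_of_ne h, sub_self]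
  have h1 := LinearMap.finrank_range_add_finrank_ker T
  rw [hrange, hker, finrank_top, Module.finrank_fintype_fun_eq_card,
    Module.finrank_fintype_fun_eq_card, finrank_span_singleton] at h1
  · rw [Nat.card_eq_fintype_card, Nat.card_eq_fintype_card, h1]
  · intro h
    obtain ⟨f₀⟩ := ‹Nonempty (C.InnerFace K Γ ε)›
    exact one_ne_zero (congrFun h f₀)

end Cycle
end Graph

/-! ### Parity of edges, vertices and faces inside a cycle -/

namespace Graph

variable {α β : Type*} {G : Graph α β}

namespace Cycle

variable {m : ℕ} [NeZero m] (C : G.Cycle m) (K : G.Orientation)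

theorem mem_range_vert_of_inc (i : Fin m) {v : V(G)} (h : G.Inc (C.edge i) v) :
    v ∈ range C.vert := by
  rcases h.eq_or_eq_of_isLink (C.isLink i) with h | h
  · exact ⟨i, Subtype.ext h.symm⟩
  · exact ⟨i + 1, Subtype.ext h.symm⟩

variable {C}

theorem sign_eq_neg_one_iff {i : Fin m} (hne : K.tail (C.edge i) ≠ K.head (C.edge i)) :
    C.sign K i = -1 ↔ K.tail (C.edge i) = C.vert (i + 1) ∧ K.head (C.edge i) = C.vert i := by
  unfold sign
  rcases K.isLink_iff (C.isLink i) with ⟨h1, h2⟩ | ⟨h1, h2⟩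
  · rw [if_pos h1, h2]
    rw [h1, h2] at hne
    simp [hne.symm]
  · rw [h1, h2] at hne
    rw [h1, h2, if_neg hne]
    simp

variable (Γ : G.PlaneEmbedding)

theorem pos_notMem_chainSupport {v : V(G)} (hv : v ∉ range C.vert) :
    Γ.pos v ∉ Γ.chainSupport (C.chain K) := by
  intro h
  simp only [PlaneEmbedding.chainSupport, mem_iUnion, mem_ofPred_eq] at h
  obtain ⟨e, he, hm⟩ := h
  by_cases h' : e ∈ range C.edge
  · obtain ⟨i, rfl⟩ := h'
    exact hv (C.mem_range_vert_of_inc i (Γ.inc_of_mem _ _ hm))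
  · exact he (C.chain_eq_zero K h')

variable [Fintype E(G)] [Fintype V(G)] {ε : ℤ} {r : V(G) → ℕ}
  {up : V(G) → V(G)} {par : V(G) → E(G)}

open Classical in
/-- The edges with a face inside the cycle on their right: those on the cycle, the parent edges of
the vertices inside, and the remaining edges inside. -/
theorem sum_edges_eq (hpar : ∀ v ∉ range C.vert, G.IsLink (par v) v (up v) ∧ r (up v) < r v) :
    ∑ e, (if Γ.faceWinding K (C.chain K) (Γ.right K e) = ε then 1 else 0 : ZMod 2) =
      ∑ i, (if Γ.faceWinding K (C.chain K) (Γ.right K (C.edge i)) = ε then 1 else 0) +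
      ∑ v, (if v ∉ range C.vert ∧ Γ.windingNumber K (C.chain K) (Γ.pos v) = ε then 1 else 0) +
      Nat.card (C.InnerEdge K Γ ε par) := by
  have hx := C.isChain_chain K (C.vert 0)
  set F : E(G) → ZMod 2 := fun e =>
    if Γ.faceWinding K (C.chain K) (Γ.right K e) = ε then 1 else 0 with hF
  have hpC : ∀ v ∉ range C.vert, par v ∉ range C.edge := by
    rintro v hv ⟨i, hi⟩
    exact hv (C.mem_range_vert_of_inc i (hi ▸ (hpar v hv).1.inc_left))
  -- An edge that is the parent edge of both its ends would make the rank decrease in both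
  -- directions.
  have hinj : InjOn par (range C.vert)ᶜ := by
    intro u hu v hv huv
    by_contra hne
    have h1 := (hpar u hu).1
    rw [huv] at h1
    rcases h1.eq_and_eq_or_eq_and_eq (hpar v hv).1 with ⟨h, -⟩ | ⟨h2, h3⟩
    · exact hne (Subtype.ext h)
    · have h4 := (hpar u hu).2
      have h5 := (hpar v hv).2
      rw [Subtype.ext h3] at h4
      rw [← Subtype.ext h2] at h5
      omega
  have h1 : ∑ e, F e = ∑ e, (if e ∈ range C.edge then F e else 0) +
      ∑ e, (if e ∈ par '' (range C.vert)ᶜ then F e else 0) +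
      ∑ e, (if e ∉ C.frame par ∧ Γ.faceWinding K (C.chain K) (Γ.right K e) = ε then 1 else 0) := by
    rw [← Finset.sum_add_distrib, ← Finset.sum_add_distrib]
    refine Finset.sum_congr rfl fun e _ => ?_
    by_cases ha : e ∈ range C.edge
    · have hb : e ∉ par '' (range C.vert)ᶜ := by
        rintro ⟨v, hv, rfl⟩; exact hpC v hv ha
      simp [frame, ha, hb]
    · by_cases hb : e ∈ par '' (range C.vert)ᶜ
      · have : e ∈ C.frame par := Or.inr hb
        rw [if_neg ha, if_pos hb, if_neg fun h => h.1 this]; simp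
      · have : e ∉ C.frame par := fun h => h.elim ha hb
        rw [if_neg ha, if_neg hb]; simp [this, hF]
  have h2 : ∑ e, (if e ∈ range C.edge then F e else 0) = ∑ i, F (C.edge i) := by
    rw [← Finset.sum_filter, ← Finset.sum_image (s := Finset.univ) (g := C.edge)
      fun i _ j _ h => C.edge_injective h]
    refine Finset.sum_congr ?_ fun _ _ => rfl
    ext e; simp
  have h3 : ∑ e, (if e ∈ par '' (range C.vert)ᶜ then F e else 0) =
      ∑ v, (if v ∉ range C.vert ∧ Γ.windingNumber K (C.chain K) (Γ.pos v) = ε then 1 else 0) := by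
    have : Finset.univ.filter (fun e => e ∈ par '' (range C.vert)ᶜ) =
        (Finset.univ.filter fun v => v ∉ range C.vert).image par := by
      ext e; simp
    rw [← Finset.sum_filter, this, Finset.sum_image fun u hu v hv h =>
      hinj (by simpa using hu) (by simpa using hv) h, Finset.sum_filter]
    refine Finset.sum_congr rfl fun v _ => ?_
    by_cases hv : v ∈ range C.vert
    · rw [if_neg (fun h => h hv), if_neg (fun h => h.1 hv)]
    · have := Γ.faceWinding_right_eq_pos hx (C.chain_eq_zero K (hpC v hv)) (hpar v hv).1.inc_left
        (pos_notMem_chainSupport K Γ hv)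
      simp only [hv, not_false_eq_true, if_true, true_and, hF, this]
  rw [h1, h2, h3, ZMod.natCast_card_subtype]

open Classical in
theorem sum_nBoundary_eq [Fintype (C.InnerFace K Γ ε)] :
    ∑ f : C.InnerFace K Γ ε, (Γ.nBoundary K f : ZMod 2) =
      ∑ e, (if Γ.faceWinding K (C.chain K) (Γ.right K e) = ε then 1 else 0) := by
  have : ∀ f : C.InnerFace K Γ ε, (Γ.nBoundary K f : ZMod 2) =
      ∑ e, if Γ.right K e = f then 1 else 0 := fun f => by
    rw [Γ.nBoundary_eq K f.2.1, ZMod.natCast_card_subtype]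
  simp only [this]
  rw [Finset.sum_comm]
  refine Finset.sum_congr rfl fun e _ => ?_
  split_ifs with h
  · rw [Finset.sum_eq_single ⟨_, Γ.isFace_right K e, h⟩]
    · simp
    · intro b _ hb
      rw [if_neg fun h' => hb (Subtype.ext h'.symm)]
    · simp
  · refine Finset.sum_eq_zero fun f _ => if_neg fun h' => h ?_
    rw [h']; exact f.2.2

open Classical in
-- The winding number changes by `sign` from right to left. For `ε = 1` the inside lies on the right
-- of exactly the edges directed against `C`; for `ε = -1`, of exactly the others. As `m` is even,
-- the two counts have the same parity.
theorem nCycle_eq_sum (hm : Even m) (hε : ε = 1 ∨ ε = -1)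
    (hv : ∀ z ∉ Γ.support, Γ.windingNumber K (C.chain K) z = 0 ∨
      Γ.windingNumber K (C.chain K) z = ε) :
    (K.nCycle C : ZMod 2) =
      ∑ i, (if Γ.faceWinding K (C.chain K) (Γ.right K (C.edge i)) = ε then 1 else 0) := by
  have hx := C.isChain_chain K (C.vert 0)
  have hval : ∀ f, Γ.IsFace f → Γ.faceWinding K (C.chain K) f = 0 ∨
      Γ.faceWinding K (C.chain K) f = ε := by
    intro f hf
    obtain ⟨z, hz⟩ := hf.nonempty
    rw [hf.faceWinding_eq hx hz]
    exact hv z (hf.subset_compl hz)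
  have hi : ∀ i, Γ.faceWinding K (C.chain K) (Γ.right K (C.edge i)) = ε ↔ C.sign K i = - ε := by
    intro i
    have h1 := hval _ (Γ.isFace_right K (C.edge i))
    have h2 := hval _ (Γ.isFace_left K (C.edge i))
    have h3 := Γ.faceWinding_left hx (C.edge i)
    have h4 := C.sign_eq_one_or K i
    rw [C.chain_edge] at h3
    omega
  rw [Orientation.nCycle, ZMod.natCast_card_subtype]
  simp only [← sign_eq_neg_one_iff K (Γ.tail_ne_head K (C.edge _)), hi]
  rcases hε with rfl | rfl
  · rfl
  · have : ∀ i, (if C.sign K i = -(-1) then 1 else 0 : ZMod 2) =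
        (if C.sign K i = -1 then 1 else 0) + 1 := by
      intro i
      rcases C.sign_eq_one_or K i with h | h <;> rw [h] <;> decide
    rw [Finset.sum_congr rfl fun i _ => this i, Finset.sum_add_distrib]
    have h0 : ((m : ℕ) : ZMod 2) = 0 := (ZMod.natCast_eq_zero_iff_even).2 hm
    simp [h0]

end Cycle

/-- Summing the odd boundary counts over the inner faces gives their number modulo 2. The same sum
counts edges with the inside on their right: `nCycle`, plus the inner vertices through their parent
edges, plus the inner edges, one fewer than the faces. -/
theorem PlaneEmbedding.IsKasteleyn.isPfaffian [Fintype E(G)] [Fintype V(G)]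
    {Γ : G.PlaneEmbedding} (hG : G.Preconnected) {K : G.Orientation} (hK : Γ.IsKasteleyn K) :
    K.IsPfaffian := by
  classical
  intro m _ hm C hD
  have hx := C.isChain_chain K (C.vert 0)
  have : Nonempty E(G) := ⟨C.edge 0⟩
  obtain ⟨r, up, par, hpar⟩ := exists_parent hG (range_nonempty C.vert)
  obtain ⟨ε, hε, hval⟩ := Cycle.exists_windingNumber_values K Γ hpar
  have hε0 : ε ≠ 0 := by omega
  have hb : ∀ f : C.InnerFace K Γ ε, Bornology.IsBounded (f : Set ℂ) := fun f =>
    Γ.isBounded_of_faceWinding_ne_zero hx f.2.1 (f.2.2.symm ▸ hε0)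
  have : Finite (C.InnerFace K Γ ε) :=
    Finite.of_injective (fun f => (⟨f, f.2.1, hb f⟩ : Γ.BoundedFace)) fun f g h =>
      Subtype.ext (congrArg (fun F : Γ.BoundedFace => (F : Set ℂ)) h)
  have := Fintype.ofFinite (C.InnerFace K Γ ε)
  have : Nonempty (C.InnerFace K Γ ε) := by
    have hj := Γ.faceWinding_left hx (C.edge 0)
    rw [C.chain_edge] at hj
    obtain ⟨z, hz⟩ := (Γ.isFace_right K (C.edge 0)).nonempty
    obtain ⟨w, hw⟩ := (Γ.isFace_left K (C.edge 0)).nonempty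
    have h1 := hval z ((Γ.isFace_right K (C.edge 0)).subset_compl hz)
    have h2 := hval w ((Γ.isFace_left K (C.edge 0)).subset_compl hw)
    rw [← (Γ.isFace_right K (C.edge 0)).faceWinding_eq hx hz] at h1
    rw [← (Γ.isFace_left K (C.edge 0)).faceWinding_eq hx hw] at h2
    have h3 := C.sign_eq_one_or K 0
    rcases h1 with h1 | h1
    · exact ⟨⟨_, Γ.isFace_left K (C.edge 0), by omega⟩⟩
    · exact ⟨⟨_, Γ.isFace_right K (C.edge 0), h1⟩⟩
  have hX : (range fun i => (C.vert i : α)) = Subtype.val '' range C.vert := by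
    rw [← range_comp]; rfl
  rw [hX] at hD
  obtain ⟨D, hD⟩ := hD
  obtain ⟨mate, hmate⟩ := exists_mate_of_deleteVerts Γ.not_isLink_self hD
  -- Partners lie on the same side of `C`: their edge is not in the chain, so both have the winding
  -- number of its right-hand face. The inner vertices thus fall into pairs.
  have hV : ∑ v, (if v ∉ range C.vert ∧ Γ.windingNumber K (C.chain K) (Γ.pos v) = ε
      then 1 else 0 : ZMod 2) = 0 := by
    refine ZMod.sum_ite_eq_zero_of_involution mate (fun v ⟨hv, hvε⟩ => ⟨(hmate v hv).1, ?_⟩)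
      (fun v hv => (hmate v hv.1).2.2.1) fun v hv => (hmate v hv.1).2.2.2
    obtain ⟨hv', ⟨e, he⟩, -, -⟩ := hmate v hv
    have hx0 : C.chain K e = 0 := C.chain_eq_zero K (by
      rintro ⟨i, rfl⟩
      exact hv (C.mem_range_vert_of_inc i he.inc_left))
    rw [← hvε, ← Γ.faceWinding_right_eq_pos hx hx0 he.inc_left
      (Cycle.pos_notMem_chainSupport K Γ hv), ← Γ.faceWinding_right_eq_pos hx hx0 he.inc_right
      (Cycle.pos_notMem_chainSupport K Γ hv')]
  have hsum : ∑ f : C.InnerFace K Γ ε, (Γ.nBoundary K f : ZMod 2) =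
      Nat.card (C.InnerFace K Γ ε) := by
    rw [Finset.sum_congr rfl fun (f : C.InnerFace K Γ ε) _ =>
      ZMod.natCast_eq_one_iff_odd.2 (hK f f.2.1 (hb f))]
    simp
  rw [Cycle.sum_nBoundary_eq, Cycle.sum_edges_eq K Γ hpar, Cycle.card_innerFace K Γ hpar, hV,
    ← Cycle.nCycle_eq_sum K Γ hm hε hval] at hsum
  rw [← ZMod.natCast_eq_one_iff_odd]
  push_cast at hsum
  rw [add_zero, add_comm] at hsum
  exact add_left_cancel hsum

end Graph

/-! ### Alternating walks -/

section AlternatingWalk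

variable {V : Type*} (μ μ' : V → V)

open Classical in
/-- The walk from `v` that applies `μ` and `μ'` in turn. -/
def altWalk (v : V) : ℕ → V
  | 0 => v
  | n + 1 => if Even n then μ (altWalk v n) else μ' (altWalk v n)

variable {μ μ'} {v : V}

theorem altWalk_succ_of_even {n : ℕ} (hn : Even n) :
    altWalk μ μ' v (n + 1) = μ (altWalk μ μ' v n) := if_pos hn

theorem altWalk_succ_of_odd {n : ℕ} (hn : Odd n) :
    altWalk μ μ' v (n + 1) = μ' (altWalk μ μ' v n) := if_neg (Nat.not_even_iff_odd.2 hn)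

theorem altWalk_two_mul (k : ℕ) : altWalk μ μ' v (2 * k) = (μ' ∘ μ)^[k] v := by
  induction k with
  | zero => rfl
  | succ k ih =>
    rw [Function.iterate_succ_apply', ← ih, show 2 * (k + 1) = 2 * k + 1 + 1 by ring,
      altWalk_succ_of_odd (odd_two_mul_add_one k), altWalk_succ_of_even (even_two_mul k)]
    rfl

/-- In a coincidence at odd distance, the first and the last step apply the same involution.
Removing both shortens the distance by two, down to a fixed point. -/
theorem altWalk_ne_of_odd_sub
    (hμ : Function.Involutive μ) (hμ' : Function.Involutive μ') (h1 : ∀ v, μ v ≠ v)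
    (h1' : ∀ v, μ' v ≠ v) (d i : ℕ) :
    altWalk μ μ' v i ≠ altWalk μ μ' v (i + (2 * d + 1)) := by
  induction d generalizing i with
  | zero =>
    rcases Nat.even_or_odd i with h | h
    · exact fun h' => h1 _ ((altWalk_succ_of_even h).symm.trans h'.symm)
    · exact fun h' => h1' _ ((altWalk_succ_of_odd h).symm.trans h'.symm)
  | succ d ih =>
    intro h
    apply ih (i + 1)
    rw [show i + (2 * (d + 1) + 1) = i + 1 + (2 * d + 1) + 1 by ring] at h
    rcases Nat.even_or_odd i with hi | hi
    · have hi' : Even (i + 1 + (2 * d + 1)) := by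
        rw [show i + 1 + (2 * d + 1) = i + 2 * (d + 1) by ring]
        exact hi.add (even_two_mul _)
      rw [altWalk_succ_of_even hi'] at h
      rw [altWalk_succ_of_even hi, h, hμ]
    · have hi' : Odd (i + 1 + (2 * d + 1)) := by
        rw [show i + 1 + (2 * d + 1) = i + 2 * (d + 1) by ring]
        exact hi.add_even (even_two_mul _)
      rw [altWalk_succ_of_odd hi'] at h
      rw [altWalk_succ_of_odd hi, h, hμ']

theorem altWalk_ne
    (hμ : Function.Involutive μ) (hμ' : Function.Involutive μ') (h1 : ∀ v, μ v ≠ v)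
    (h1' : ∀ v, μ' v ≠ v) {i j : ℕ} (h : ¬ (Even i ↔ Even j)) : altWalk μ μ' v i ≠ altWalk μ μ' v j := by
  wlog hij : i ≤ j generalizing i j
  · exact (this (fun h' => h h'.symm) (by omega)).symm
  obtain ⟨d, rfl⟩ := Nat.exists_eq_add_of_le hij
  have hd : Odd d := by
    rw [Nat.even_add] at h
    rw [← Nat.not_even_iff_odd]
    tauto
  obtain ⟨e, rfl⟩ := hd
  exact altWalk_ne_of_odd_sub hμ hμ' h1 h1' e i

/-- Here `k` is the minimal period of `μ' ∘ μ` at `v`. Positions of different parity never coincide,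
and equal parities reduce to iterates of `μ' ∘ μ`. -/
theorem exists_altWalk_period [Finite V]
    (hμ : Function.Involutive μ) (hμ' : Function.Involutive μ') (h1 : ∀ v, μ v ≠ v)
    (h1' : ∀ v, μ' v ≠ v) (v : V) :
    ∃ k > 0, Function.Periodic (altWalk μ μ' v) (2 * k) ∧ InjOn (altWalk μ μ' v) (Iio (2 * k)) := by
  set f := μ' ∘ μ with hf
  have hinj : Function.Injective f := hμ'.injective.comp hμ.injective
  have hv : v ∈ Function.periodicPts f := hinj.mem_periodicPts v
  have hk := Function.minimalPeriod_pos_of_mem_periodicPts hv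
  set k := Function.minimalPeriod f v with hkdef
  have hper : ∀ n, altWalk μ μ' v (n + 2 * k) = altWalk μ μ' v n := by
    intro n
    induction n with
    | zero => rw [zero_add, altWalk_two_mul]; exact Function.iterate_minimalPeriod
    | succ n ih =>
      rw [show n + 1 + 2 * k = n + 2 * k + 1 by ring]
      rcases Nat.even_or_odd n with h | h
      · rw [altWalk_succ_of_even (h.add (even_two_mul k)), altWalk_succ_of_even h, ih]
      · rw [altWalk_succ_of_odd (h.add_even (even_two_mul k)), altWalk_succ_of_odd h, ih]
  refine ⟨k, hk, hper, fun i hi j hj hij => ?_⟩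
  have hpar : Even i ↔ Even j := by
    by_contra h
    exact altWalk_ne hμ hμ' h1 h1' h hij
  have key : ∀ a b, 2 * a < 2 * k → 2 * b < 2 * k →
      altWalk μ μ' v (2 * a) = altWalk μ μ' v (2 * b) → a = b := by
    intro a b ha hb hab
    rw [altWalk_two_mul, altWalk_two_mul] at hab
    exact Function.iterate_injOn_Iio_minimalPeriod (show a < k by omega) (show b < k by omega) hab
  rw [mem_Iio] at hi hj
  rcases Nat.even_or_odd i with h | h
  · obtain ⟨a, rfl⟩ := h.two_dvd
    obtain ⟨b, rfl⟩ := (hpar.1 h).two_dvd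
    rw [key a b hi hj hij]
  · obtain ⟨a, rfl⟩ := h
    have hj' : Odd j := by
      rw [← Nat.not_even_iff_odd, ← hpar, Nat.not_even_iff_odd]; exact odd_two_mul_add_one a
    obtain ⟨b, rfl⟩ := hj'
    rw [altWalk_succ_of_even (even_two_mul a), altWalk_succ_of_even (even_two_mul b)] at hij
    rw [key a b (by omega) (by omega) (hμ.injective hij)]

end AlternatingWalk

/-! ### Rearrangements of pairs -/

/-- Permute pairs, and interchange the two members of some pairs. -/
def pairShuffle {n : ℕ} (π : Equiv.Perm (Fin n)) (b : Fin n → Bool) :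
    Equiv.Perm (Fin n × Bool) :=
  (Equiv.prodCongrRight fun i => if b i then Equiv.swap false true else Equiv.refl Bool).trans
    (Equiv.prodCongrLeft fun _ => π)

theorem pairShuffle_apply {n : ℕ} (π : Equiv.Perm (Fin n)) (b : Fin n → Bool) (i : Fin n)
    (t : Bool) : pairShuffle π b (i, t) = (π i, t ^^ b i) := by
  cases h : b i <;> cases t <;> simp [pairShuffle, h, Equiv.prodCongrRight, Equiv.prodCongrLeft]

/-- Permuting the pairs moves the first and the second members alike, so it is an even permutation;
only the interchanges count. -/
theorem sign_pairShuffle {n : ℕ} (π : Equiv.Perm (Fin n)) (b : Fin n → Bool) :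
    (Equiv.Perm.sign (pairShuffle π b) : ℤ) = ∏ i, if b i then -1 else 1 := by
  rw [pairShuffle, Equiv.Perm.sign_trans, Equiv.Perm.sign_prodCongrLeft,
    Equiv.Perm.sign_prodCongrRight, Fintype.prod_bool, Int.units_mul_self, one_mul]
  push_cast
  refine Finset.prod_congr rfl fun i _ => ?_
  split_ifs with h
  · rw [Equiv.Perm.sign_swap (by decide)]; rfl
  · rw [Equiv.Perm.sign_refl]; rfl

theorem pairShuffle_injective {n : ℕ} {π π' : Equiv.Perm (Fin n)} {b b' : Fin n → Bool}
    (h : pairShuffle π b = pairShuffle π' b') : π = π' ∧ b = b' := by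
  have h' : ∀ i, π i = π' i ∧ b i = b' i := by
    intro i
    have := congrArg (fun e => e (i, false)) h
    simpa [pairShuffle_apply] using this
  exact ⟨Equiv.ext fun i => (h' i).1, funext fun i => (h' i).2⟩

namespace Graph

variable {α β : Type*} {G : Graph α β} {n : ℕ}

/-- The vertices are enumerated as the ends of a sequence of edges. -/
def IsPairing (G : Graph α β) {n : ℕ} (τ : Fin n × Bool ≃ V(G)) (c : Fin n → E(G)) : Prop :=
  ∀ i, G.IsLink (c i) (τ (i, false)) (τ (i, true))

open Classical in
/-- The sign of an edge directed away from one of its ends. -/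
def Orientation.coeff (K : G.Orientation) (e : E(G)) (v : V(G)) : ℤ := if K.tail e = v then 1 else -1

theorem Orientation.coeff_mul_self (K : G.Orientation) (e : E(G)) (v : V(G)) :
    K.coeff e v * K.coeff e v = 1 := by
  unfold Orientation.coeff; split_ifs <;> rfl

theorem Orientation.coeff_eq_neg (K : G.Orientation) {e : E(G)} {u v : V(G)} (h : G.IsLink e u v)
    (hne : u ≠ v) : K.coeff e v = - K.coeff e u := by
  unfold Orientation.coeff
  rcases K.isLink_iff h with ⟨h1, -⟩ | ⟨h1, -⟩
  · rw [h1, if_neg hne, if_pos rfl]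
  · rw [h1, if_pos rfl, if_neg hne.symm]; rfl

/-- The sign of a sequence of edges that enumerates the vertices. -/
def Orientation.pairingSign (K : G.Orientation) (τ₀ τ : Fin n × Bool ≃ V(G)) (c : Fin n → E(G)) : ℤ :=
  Equiv.Perm.sign (τ.trans τ₀.symm) * ∏ i, K.coeff (c i) (τ (i, false))

namespace IsPairing

variable {τ τ' τ₀ : Fin n × Bool ≃ V(G)} {c c' : Fin n → E(G)}

theorem ne (τ : Fin n × Bool ≃ V(G)) (i : Fin n) : τ (i, false) ≠ τ (i, true) := fun h => by
  simpa using τ.injective h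

theorem fst_eq_of_inc (h : G.IsPairing τ c) {i : Fin n} {v : V(G)} (hv : G.Inc (c i) v) :
    (τ.symm v).1 = i := by
  rcases hv.eq_or_eq_of_isLink (h i) with h' | h' <;>
  · rw [Subtype.ext h', Equiv.symm_apply_apply]

theorem inc (h : G.IsPairing τ c) (p : Fin n × Bool) : G.Inc (c p.1) (τ p) := by
  obtain ⟨i, _ | _⟩ := p
  · exact (h i).inc_left
  · exact (h i).inc_right

theorem injective (h : G.IsPairing τ c) : Function.Injective c := by
  intro i j hij
  have h1 := h.fst_eq_of_inc (h.inc (i, false))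
  have h2 := h.fst_eq_of_inc (i := j) (v := τ (i, false)) (by
    have := h.inc (i, false)
    rw [← hij]; exact this)
  exact h1.symm.trans h2

theorem isDimer (h : G.IsPairing τ c) : G.IsDimer (range c) := by
  intro v
  refine ⟨c (τ.symm v).1, ⟨⟨_, rfl⟩, ?_⟩, ?_⟩
  · simpa using h.inc (τ.symm v)
  · rintro _ ⟨⟨i, rfl⟩, hi⟩
    rw [h.fst_eq_of_inc hi]

theorem shuffle (h : G.IsPairing τ c) (π : Equiv.Perm (Fin n)) (b : Fin n → Bool) :
    G.IsPairing ((pairShuffle π b).trans τ) (c ∘ π) := by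
  intro i
  rw [Equiv.trans_apply, Equiv.trans_apply, pairShuffle_apply, pairShuffle_apply]
  cases b i
  · exact h (π i)
  · exact (h (π i)).symm

/-- Interchanging the ends of an edge reverses both its orientation sign and the sign of the
permutation, so the sign depends only on the dimer configuration. -/
theorem pairingSign_shuffle (h : G.IsPairing τ c) (K : G.Orientation) (π : Equiv.Perm (Fin n))
    (b : Fin n → Bool) :
    K.pairingSign τ₀ ((pairShuffle π b).trans τ) (c ∘ π) = K.pairingSign τ₀ τ c := by
  have h1 : ∏ i, K.coeff ((c ∘ π) i) (((pairShuffle π b).trans τ) (i, false)) =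
      (∏ i, if b i then -1 else 1) * ∏ i, K.coeff (c i) (τ (i, false)) := by
    rw [← Equiv.prod_comp π fun i => K.coeff (c i) (τ (i, false)), ← Finset.prod_mul_distrib]
    refine Finset.prod_congr rfl fun i _ => ?_
    rw [Equiv.trans_apply, pairShuffle_apply, Function.comp_apply]
    cases b i
    · simp
    · simp [K.coeff_eq_neg (h (π i)) (ne τ _)]
  rw [Orientation.pairingSign, h1, Equiv.trans_assoc, Equiv.Perm.sign_trans, Units.val_mul,
    sign_pairShuffle, Orientation.pairingSign]
  have h2 : (∏ i, if b i then (-1 : ℤ) else 1) * (∏ i, if b i then (-1 : ℤ) else 1) = 1 := by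
    rw [← Finset.prod_mul_distrib]
    refine Finset.prod_eq_one fun i _ => ?_
    split_ifs <;> rfl
  linear_combination (Equiv.Perm.sign (τ.trans τ₀.symm) : ℤ) *
    (∏ i, K.coeff (c i) (τ (i, false))) * h2

theorem exists_shuffle (h : G.IsPairing τ c) (h' : G.IsPairing τ' c') (hr : range c' = range c) :
    ∃ π b, τ' = (pairShuffle π b).trans τ ∧ c' = c ∘ π := by
  have h1 : ∀ i, ∃ j, c j = c' i := fun i => by
    have : c' i ∈ range c := hr ▸ mem_range_self i
    exact this
  choose p hp using h1
  have hpi : Function.Injective p := fun i j hij => h'.injective (by rw [← hp, ← hp, hij])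
  let π : Equiv.Perm (Fin n) := Equiv.ofBijective p (Finite.injective_iff_bijective.1 hpi)
  have h2 : ∀ i, ∃ t : Bool, ∀ s, τ' (i, s) = τ (π i, s ^^ t) := by
    intro i
    have h3 := h (p i)
    rw [hp] at h3
    rcases (h' i).eq_and_eq_or_eq_and_eq h3 with ⟨h4, h5⟩ | ⟨h4, h5⟩
    · refine ⟨false, fun s => ?_⟩
      cases s
      · exact Subtype.ext h4
      · exact Subtype.ext h5
    · refine ⟨true, fun s => ?_⟩
      cases s
      · exact Subtype.ext h4
      · exact Subtype.ext h5
  choose b hb using h2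
  refine ⟨π, b, Equiv.ext fun ⟨i, s⟩ => ?_, funext fun i => (hp i).symm⟩
  rw [Equiv.trans_apply, pairShuffle_apply, hb]

end IsPairing

open Classical in
-- Each dimer configuration is listed in `n!` orders, with `2` directions for each edge; these are
-- the shuffles of one listing.
theorem IsPairing.card_filter_range_eq [Fintype V(G)] [Fintype E(G)] {τ : Fin n × Bool ≃ V(G)}
    {c : Fin n → E(G)} (h : G.IsPairing τ c) :
    (Finset.univ.filter fun p : (Fin n × Bool ≃ V(G)) × (Fin n → E(G)) =>
      G.IsPairing p.1 p.2 ∧ range p.2 = range c).card = 2 ^ n * n.factorial := by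
  have : Finset.univ.filter (fun p : (Fin n × Bool ≃ V(G)) × (Fin n → E(G)) =>
      G.IsPairing p.1 p.2 ∧ range p.2 = range c) =
      (Finset.univ : Finset (Equiv.Perm (Fin n) × (Fin n → Bool))).image
        fun q => ((pairShuffle q.1 q.2).trans τ, c ∘ q.1) := by
    ext ⟨τ', c'⟩
    simp only [Finset.mem_filter, Finset.mem_univ, true_and, Finset.mem_image, Prod.mk.injEq]
    constructor
    · rintro ⟨h', hr⟩
      obtain ⟨π, b, h1, h2⟩ := h.exists_shuffle h' hr
      exact ⟨(π, b), h1.symm, h2.symm⟩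
    · rintro ⟨⟨π, b⟩, rfl, rfl⟩
      exact ⟨h.shuffle π b, π.surjective.range_comp c⟩
  rw [this, Finset.card_image_of_injective]
  · simp [Fintype.card_perm, mul_comm]
  · rintro ⟨π, b⟩ ⟨π', b'⟩ hq
    have h1 := (Prod.mk.injEq _ _ _ _ ▸ hq).1
    obtain ⟨rfl, rfl⟩ := pairShuffle_injective (Equiv.ext fun p =>
      τ.injective (congrArg (fun e => e p) h1))
    rfl

end Graph

/-! ### Exchanging dimers along an alternating cycle -/

theorem Fin.even_val_add_one {m : ℕ} [NeZero m] (hm : Even m) (i : Fin m) :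
    Even (i + 1).val ↔ ¬ Even i.val := by
  rw [Fin.val_add, Fin.val_one', Nat.add_mod_mod, hm.mod_even_iff]
  exact Nat.even_add_one

namespace Graph

variable {α β : Type*} {G : Graph α β} {n : ℕ}

/-- The edge of a pairing at a vertex. -/
def edgeAt (τ : Fin n × Bool ≃ V(G)) (c : Fin n → E(G)) (v : V(G)) : E(G) := c (τ.symm v).1

/-- The vertex that is paired with a given one. -/
def mate (τ : Fin n × Bool ≃ V(G)) (v : V(G)) : V(G) := τ ((τ.symm v).1, !(τ.symm v).2)

variable {τ τ' τ₀ : Fin n × Bool ≃ V(G)} {c c' : Fin n → E(G)}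

theorem mate_apply (i : Fin n) (t : Bool) : mate τ (τ (i, t)) = τ (i, !t) := by simp [mate]

theorem edgeAt_apply (i : Fin n) (t : Bool) : edgeAt τ c (τ (i, t)) = c i := by simp [edgeAt]

theorem mate_involutive (τ : Fin n × Bool ≃ V(G)) : Function.Involutive (mate τ) := fun v => by
  simp [mate]

theorem mate_ne (v : V(G)) : mate τ v ≠ v := by
  obtain ⟨⟨i, t⟩, rfl⟩ := τ.surjective v
  rw [mate_apply]
  intro h
  have := τ.injective h
  simp at this

theorem edgeAt_mate (v : V(G)) : edgeAt τ c (mate τ v) = edgeAt τ c v := by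
  obtain ⟨⟨i, t⟩, rfl⟩ := τ.surjective v
  rw [mate_apply, edgeAt_apply, edgeAt_apply]

namespace IsPairing

theorem isLink_edgeAt (h : G.IsPairing τ c) (v : V(G)) : G.IsLink (edgeAt τ c v) v (mate τ v) := by
  obtain ⟨⟨i, _ | _⟩, rfl⟩ := τ.surjective v
  · rw [mate_apply, edgeAt_apply]; exact h i
  · rw [mate_apply, edgeAt_apply]; exact (h i).symm

theorem edgeAt_eq (h : G.IsPairing τ c) {i : Fin n} {v : V(G)} (hv : G.Inc (c i) v) :
    edgeAt τ c v = c i := by rw [edgeAt, h.fst_eq_of_inc hv]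

theorem exists_isDimer_deleteVerts (h : G.IsPairing τ c) {X : Set V(G)}
    (hX : ∀ v ∉ X, mate τ v ∉ X) : ∃ D, (G.deleteVerts (Subtype.val '' X)).IsDimer D := by
  refine ⟨{e | ∃ i, (c i : β) = e}, fun v => ?_⟩
  have hv := (Set.ext_iff.1 (vertexSet_deleteVerts G (Subtype.val '' X)) v).1 v.2
  obtain ⟨w, hw⟩ : ∃ w : V(G), (w : α) = v := ⟨⟨v, hv.1⟩, rfl⟩
  have hwX : w ∉ X := fun hwX => hv.2 ⟨w, hwX, hw⟩
  have hl : (G.deleteVerts (Subtype.val '' X)).IsLink (edgeAt τ c w) w (mate τ w) := by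
    rw [deleteVerts_isLink]
    refine ⟨h.isLink_edgeAt w, ?_, ?_⟩
    · simpa using hwX
    · simpa using hX w hwX
  rw [hw] at hl
  refine ⟨⟨edgeAt τ c w, hl.edge_mem⟩, ⟨⟨_, rfl⟩, hl.inc_left⟩, ?_⟩
  rintro ⟨e, he⟩ ⟨⟨i, hi⟩, hinc⟩
  obtain ⟨u, hu⟩ := hinc
  rw [deleteVerts_isLink] at hu
  change (c i : β) = e at hi
  subst hi
  exact Subtype.ext (congrArg (fun f : E(G) => (f : β)) (h.edgeAt_eq (hw ▸ hu.1.inc_left)).symm)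

/-- Two different pairings have an alternating cycle through every vertex at which they differ. -/
theorem exists_cycle [Finite V(G)] (h : G.IsPairing τ c) (h' : G.IsPairing τ' c') {v : V(G)}
    (hv : edgeAt τ c v ≠ edgeAt τ' c' v) :
    ∃ (m : ℕ) (_ : NeZero m) (C : G.Cycle m), Even m ∧ v ∈ range C.vert ∧
      (∀ i, Even i.val → C.edge i = edgeAt τ c (C.vert i) ∧ C.vert (i + 1) = mate τ (C.vert i)) ∧
      ∀ i, ¬ Even i.val →
        C.edge i = edgeAt τ' c' (C.vert i) ∧ C.vert (i + 1) = mate τ' (C.vert i) := by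
  classical
  obtain ⟨k, hk, hper, hinj⟩ := exists_altWalk_period (mate_involutive τ) (mate_involutive τ')
    mate_ne mate_ne v
  set u := altWalk (mate τ) (mate τ') v with hu
  have : NeZero (2 * k) := ⟨by omega⟩
  have hval : ∀ i : Fin (2 * k), u (i + 1 : Fin (2 * k)).val = u (i.val + 1) := by
    intro i
    rw [Fin.val_add, Fin.val_one', Nat.add_mod_mod, hper.map_mod_nat]
  let ed : ℕ → E(G) := fun j => if Even j then edgeAt τ c (u j) else edgeAt τ' c' (u j)
  -- The disagreement spreads along the walk: if the two pairings used the same edge at one end of a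
  -- step, they would use it at the other end too.
  have hdiff : ∀ j, edgeAt τ c (u j) ≠ edgeAt τ' c' (u j) := by
    intro j
    induction j with
    | zero => exact hv
    | succ j ih =>
      intro heq
      apply ih
      rcases Nat.even_or_odd j with hj | hj
      · have e1 : u (j + 1) = mate τ (u j) := altWalk_succ_of_even hj
        rw [e1, edgeAt_mate] at heq
        have hl := h.isLink_edgeAt (u j)
        rw [heq] at hl
        rw [heq]
        exact (h'.edgeAt_eq hl.inc_left).symm
      · have e1 : u (j + 1) = mate τ' (u j) := altWalk_succ_of_odd hj
        rw [e1, edgeAt_mate] at heq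
        have hl := h'.isLink_edgeAt (u j)
        rw [← heq] at hl
        rw [← heq]
        exact h.edgeAt_eq hl.inc_left
  have hlink : ∀ j, G.IsLink (ed j) (u j) (u (j + 1)) := by
    intro j
    rcases Nat.even_or_odd j with hj | hj
    · simp only [ed, if_pos hj, hu, altWalk_succ_of_even hj]
      exact h.isLink_edgeAt _
    · simp only [ed, if_neg (Nat.not_even_iff_odd.2 hj), hu, altWalk_succ_of_odd hj]
      exact h'.isLink_edgeAt _
  have hne : ∀ i j, ¬ (Even i ↔ Even j) → u i ≠ u j := fun i j =>
    altWalk_ne (mate_involutive τ) (mate_involutive τ') mate_ne mate_ne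
  have hmix : ∀ i j, edgeAt τ c (u i) ≠ edgeAt τ' c' (u j) := by
    intro i j hij
    have hl := h.isLink_edgeAt (u i)
    apply hdiff i
    rw [hij] at hl ⊢
    exact (h'.edgeAt_eq hl.inc_left).symm
  have hedinj : ∀ i j, ed i = ed j → u i = u j := by
    intro i j hij
    have hl := hlink j
    rw [← hij] at hl
    by_cases hpar : Even i ↔ Even j
    · rcases (hlink i).eq_and_eq_or_eq_and_eq hl with ⟨e1, -⟩ | ⟨e1, -⟩
      · exact Subtype.ext e1
      · refine absurd (Subtype.ext e1) (hne i (j + 1) ?_)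
        rw [Nat.even_add_one]; tauto
    · by_cases hi : Even i
      · have hj : ¬ Even j := by tauto
        simp only [ed, if_pos hi, if_neg hj] at hij
        exact absurd hij (hmix i j)
      · have hj : Even j := by tauto
        simp only [ed, if_neg hi, if_pos hj] at hij
        exact absurd hij.symm (hmix j i)
  refine ⟨2 * k, this,
    { vert := fun i => u i
      edge := fun i => ed i
      isLink := fun i => by rw [hval]; exact hlink i
      vert_injective := fun i j hij => Fin.ext (hinj i.2 j.2 hij)
      edge_injective := fun i j hij => Fin.ext (hinj i.2 j.2 (hedinj _ _ hij)) },
    even_two_mul k, ⟨0, rfl⟩, fun i hi => ⟨if_pos hi, ?_⟩, fun i hi => ⟨if_neg hi, ?_⟩⟩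
  · exact (hval i).trans (altWalk_succ_of_even hi)
  · exact (hval i).trans (altWalk_succ_of_odd (Nat.not_even_iff_odd.1 hi))

end IsPairing

open Classical in
theorem Cycle.prod_sign {m : ℕ} [NeZero m] (C : G.Cycle m) (hm : Even m)
    (hloop : ∀ (e : E(G)) (x : V(G)), ¬ G.IsLink e x x) {K : G.Orientation} (hK : K.IsPfaffian)
    {X : Set V(G)} (hX : X = range C.vert)
    (hD : ∃ D, (G.deleteVerts (Subtype.val '' X)).IsDimer D) : ∏ i, C.sign K i = -1 := by
  subst hX
  have hX : (range fun i => (C.vert i : α)) = Subtype.val '' range C.vert := by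
    rw [← range_comp]; rfl
  have hodd := hK m hm C (by rw [hX]; exact hD)
  have h1 : ∏ i, C.sign K i = ∏ i, if C.sign K i = -1 then (-1) else 1 := by
    refine Finset.prod_congr rfl fun i _ => ?_
    rcases C.sign_eq_one_or K i with h | h <;> rw [h] <;> rfl
  have hne : ∀ e, K.tail e ≠ K.head e := fun e he => hloop e (K.head e) (by
    have := K.isLink e
    rwa [he] at this)
  rw [h1, Finset.prod_ite, Finset.prod_const, Finset.prod_const_one, mul_one]
  rw [Orientation.nCycle, Nat.card_eq_fintype_card, Fintype.card_subtype] at hodd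
  simp only [← Cycle.sign_eq_neg_one_iff K (hne (C.edge _))] at hodd
  exact hodd.neg_one_pow

namespace IsPairing

variable [Fintype V(G)]

open Classical in
-- All vertices of `C` are rotated by one step, which turns the edges of `τ` on `C` into those of
-- `τ'`. The rotation of an even cycle has sign `-1`, and the product of the orientation signs
-- around `C` is `-1` as well, so the pairing sign is unchanged. The hypothesis `hO` directs the
-- pairs on `C` along `C`.
theorem exists_exchange_of_cycle (hloop : ∀ (e : E(G)) (x : V(G)), ¬ G.IsLink e x x)
    {K : G.Orientation} (hK : K.IsPfaffian) (h : G.IsPairing τ c) (h' : G.IsPairing τ' c')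
    {m : ℕ} [NeZero m] (C : G.Cycle m) (hm : Even m)
    (he : ∀ i, Even i.val → C.edge i = edgeAt τ c (C.vert i) ∧ C.vert (i + 1) = mate τ (C.vert i))
    (ho : ∀ i, ¬ Even i.val →
      C.edge i = edgeAt τ' c' (C.vert i) ∧ C.vert (i + 1) = mate τ' (C.vert i))
    (hO : ∀ i a, τ (i, false) = C.vert a → Even a.val) :
    ∃ (τ'' : Fin n × Bool ≃ V(G)) (c'' : Fin n → E(G)), G.IsPairing τ'' c'' ∧
      K.pairingSign τ₀ τ'' c'' = K.pairingSign τ₀ τ c ∧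
      (∀ w ∈ range C.vert, edgeAt τ'' c'' w = edgeAt τ' c' w) ∧
      ∀ w ∉ range C.vert, edgeAt τ'' c'' w = edgeAt τ c w := by
  have hclosed : ∀ w, w ∈ range C.vert → mate τ w ∈ range C.vert := by
    rintro _ ⟨a, rfl⟩
    by_cases ha : Even a.val
    · exact ⟨a + 1, (he a ha).2⟩
    · have h1 : Even (a - 1).val := by
        have := Fin.even_val_add_one hm (a - 1)
        rw [sub_add_cancel] at this
        tauto
      refine ⟨a - 1, ?_⟩
      have h2 := (he _ h1).2
      rw [sub_add_cancel] at h2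
      rw [h2, mate_involutive τ]
  have hclosed' : ∀ w, w ∉ range C.vert → mate τ w ∉ range C.vert := fun w hw hw' =>
    hw (mate_involutive τ w ▸ hclosed _ hw')
  have htrue : ∀ i, τ (i, true) = mate τ (τ (i, false)) := fun i => (mate_apply i false).symm
  have hpair : ∀ i, (∃ a, Even a.val ∧ τ (i, false) = C.vert a ∧ τ (i, true) = C.vert (a + 1)) ∨
      (τ (i, false) ∉ range C.vert ∧ τ (i, true) ∉ range C.vert) := by
    intro i
    by_cases hi : τ (i, false) ∈ range C.vert
    · obtain ⟨a, ha⟩ := hi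
      have hae := hO i a ha.symm
      exact Or.inl ⟨a, hae, ha.symm, by rw [htrue, ← ha, (he a hae).2]⟩
    · exact Or.inr ⟨hi, htrue i ▸ hclosed' _ hi⟩
  set ζ : Equiv.Perm V(G) := (finRotate m).viaFintypeEmbedding ⟨C.vert, C.vert_injective⟩ with hζ
  have hζv : ∀ a, ζ (C.vert a) = C.vert (a + 1) := by
    intro a
    have := (finRotate m).viaFintypeEmbedding_apply_image ⟨C.vert, C.vert_injective⟩ a
    rw [finRotate_apply] at this
    exact this
  have hζn : ∀ w ∉ range C.vert, ζ w = w := fun w hw =>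
    (finRotate m).viaFintypeEmbedding_apply_notMem_range ⟨C.vert, C.vert_injective⟩ hw
  have hζs : Equiv.Perm.sign ζ = -1 := by
    rw [hζ, Equiv.Perm.viaFintypeEmbedding_sign, sign_finRotate]
    refine Odd.neg_one_pow ?_
    have := NeZero.ne m
    rw [Nat.odd_sub (by omega)]
    simp [hm]
  -- A pair at positions `a`, `a + 1` moves to `a + 1`, `a + 2`. The new edge is `C.edge (a + 1)`,
  -- the edge of `τ'` at the old second member.
  let c'' : Fin n → E(G) := fun i =>
    if τ (i, false) ∈ range C.vert then edgeAt τ' c' (τ (i, true)) else c i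
  have hc1 : ∀ i a, Even a.val → τ (i, false) = C.vert a → τ (i, true) = C.vert (a + 1) →
      c'' i = C.edge (a + 1) := by
    intro i a ha h1 h2
    have : τ (i, false) ∈ range C.vert := ⟨a, h1.symm⟩
    simp only [c'', if_pos this, h2]
    exact ((ho (a + 1) (by rw [Fin.even_val_add_one hm]; tauto)).1).symm
  have hc2 : ∀ i, τ (i, false) ∉ range C.vert → c'' i = c i := fun i hi => if_neg hi
  have h'' : G.IsPairing (τ.trans ζ) c'' := by
    intro i
    rw [Equiv.trans_apply, Equiv.trans_apply]
    rcases hpair i with ⟨a, ha, h1, h2⟩ | ⟨h1, h2⟩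
    · rw [hc1 i a ha h1 h2, h1, h2, hζv, hζv]
      exact C.isLink (a + 1)
    · rw [hc2 i h1, hζn _ h1, hζn _ h2]
      exact h i
  refine ⟨τ.trans ζ, c'', h'', ?_, ?_, ?_⟩
  -- At a vertex of `C` this is the sign of the edge by which `C` leaves it. A pair on `C`
  -- contributes its old coefficient at one end and its new one at the other, so the product of all
  -- old and new coefficients is that of the signs around `C`.
  · let q : V(G) → ℤ := fun w =>
      if w ∈ range C.vert then
        K.coeff (if ∃ a, ¬ Even a.val ∧ C.vert a = w then edgeAt τ' c' w else edgeAt τ c w) w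
      else 1
    have hqv : ∀ a, q (C.vert a) = C.sign K a := by
      intro a
      have hs : C.sign K a = K.coeff (C.edge a) (C.vert a) := rfl
      simp only [q, mem_range_self, if_true, hs]
      by_cases ha : Even a.val
      · rw [if_neg, (he a ha).1]
        rintro ⟨b, hb, hba⟩
        exact hb (C.vert_injective hba ▸ ha)
      · rw [if_pos ⟨a, ha, rfl⟩, (ho a ha).1]
    have hq1 : ∏ w, q w = -1 := by
      rw [← C.prod_sign hm hloop hK rfl (h.exists_isDimer_deleteVerts hclosed')]
      have : ∏ w, q w = ∏ w ∈ Finset.univ.image C.vert, q w := by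
        refine (Finset.prod_subset (Finset.subset_univ _) fun w _ hw => if_neg fun hw' => hw ?_).symm
        obtain ⟨a, rfl⟩ := hw'
        exact Finset.mem_image_of_mem _ (Finset.mem_univ a)
      rw [this, Finset.prod_image fun a _ b _ hab => C.vert_injective hab]
      exact Finset.prod_congr rfl fun a _ => hqv a
    have hq2 : (∏ i, K.coeff (c i) (τ (i, false))) *
        (∏ i, K.coeff (c'' i) ((τ.trans ζ) (i, false))) = -1 := by
      rw [← hq1, ← Equiv.prod_comp τ, Fintype.prod_prod_type, ← Finset.prod_mul_distrib]
      refine Finset.prod_congr rfl fun i _ => ?_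
      rw [Fintype.prod_bool, Equiv.trans_apply]
      rcases hpair i with ⟨a, ha, h1, h2⟩ | ⟨h1, h2⟩
      · have h3 : C.edge a = c i := by rw [(he a ha).1, ← h1, edgeAt_apply]
        rw [hc1 i a ha h1 h2, h1, h2, hqv, hqv, hζv, ← h3, mul_comm]
        rfl
      · rw [hc2 i h1, hζn _ h1, K.coeff_mul_self]
        simp only [q, if_neg h1, if_neg h2, mul_one]
    have hs : (Equiv.Perm.sign ((τ.trans ζ).trans τ₀.symm) : ℤ) =
        - (Equiv.Perm.sign (τ.trans τ₀.symm) : ℤ) := by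
      have : (τ.trans ζ).trans τ₀.symm = (τ.trans τ₀.symm).trans ((τ₀.trans ζ).trans τ₀.symm) :=
        Equiv.ext fun p => by simp
      rw [this, Equiv.Perm.sign_trans, Equiv.Perm.sign_trans_trans_symm, hζs]
      simp
    have hsq : (∏ i, K.coeff (c i) (τ (i, false))) * (∏ i, K.coeff (c i) (τ (i, false))) = 1 := by
      rw [← Finset.prod_mul_distrib]
      exact Finset.prod_eq_one fun i _ => K.coeff_mul_self _ _
    rw [Orientation.pairingSign, Orientation.pairingSign, hs]
    linear_combination -(Equiv.Perm.sign (τ.trans τ₀.symm) : ℤ) *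
      (∏ i, K.coeff (c i) (τ (i, false))) * hq2 + (Equiv.Perm.sign (τ.trans τ₀.symm) : ℤ) *
      (∏ i, K.coeff (c'' i) ((τ.trans ζ) (i, false))) * hsq
  · intro w hw
    obtain ⟨⟨i, t⟩, rfl⟩ := (τ.trans ζ).surjective w
    have hinc := h''.inc (i, t)
    rw [edgeAt_apply]
    rcases hpair i with ⟨a, ha, h1, h2⟩ | ⟨h1, h2⟩
    · have h3 : c'' i = c' (τ'.symm (τ (i, true))).1 := if_pos ⟨a, h1.symm⟩
      rw [h3] at hinc ⊢
      exact (h'.edgeAt_eq hinc).symm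
    · exfalso
      rw [Equiv.trans_apply] at hw
      cases t
      · exact h1 (by rwa [hζn _ h1] at hw)
      · exact h2 (by rwa [hζn _ h2] at hw)
  · intro w hw
    have h1 : G.Inc (c'' (τ.symm w).1) w := by
      have := h''.inc (τ.symm w)
      rwa [Equiv.trans_apply, Equiv.apply_symm_apply, hζn w hw] at this
    rw [h''.edgeAt_eq h1, hc2]
    · rfl
    · obtain ⟨⟨i, t⟩, rfl⟩ := τ.surjective w
      rw [Equiv.symm_apply_apply]
      cases t
      · exact hw
      · have := hclosed' _ hw
        rwa [mate_apply] at this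

open Classical in
theorem exists_exchange (hloop : ∀ (e : E(G)) (x : V(G)), ¬ G.IsLink e x x)
    {K : G.Orientation} (hK : K.IsPfaffian) (h : G.IsPairing τ c) (h' : G.IsPairing τ' c')
    {v : V(G)} (hv : edgeAt τ c v ≠ edgeAt τ' c' v) :
    ∃ (τ'' : Fin n × Bool ≃ V(G)) (c'' : Fin n → E(G)), G.IsPairing τ'' c'' ∧
      K.pairingSign τ₀ τ'' c'' = K.pairingSign τ₀ τ c ∧
      Finset.univ.filter (fun w => edgeAt τ'' c'' w ≠ edgeAt τ' c' w) ⊂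
        Finset.univ.filter (fun w => edgeAt τ c w ≠ edgeAt τ' c' w) := by
  obtain ⟨m, _, C, hm, hvC, he, ho⟩ := h.exists_cycle h' hv
  -- Pairs on `C` whose first member has an odd position are interchanged, to meet the condition
  -- `hO`; this does not affect the pairing sign.
  let b : Fin n → Bool := fun i => decide (∃ a, ¬ Even a.val ∧ C.vert a = τ (i, false))
  have hs := h.shuffle 1 b
  have hmate : mate ((pairShuffle 1 b).trans τ) = mate τ := by
    funext w
    obtain ⟨⟨i, t⟩, rfl⟩ := ((pairShuffle 1 b).trans τ).surjective w
    rw [mate_apply, Equiv.trans_apply, Equiv.trans_apply, pairShuffle_apply, pairShuffle_apply,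
      mate_apply]
    simp
  have hedge : edgeAt ((pairShuffle 1 b).trans τ) (c ∘ (1 : Equiv.Perm (Fin n))) = edgeAt τ c := by
    funext w
    obtain ⟨⟨i, t⟩, rfl⟩ := ((pairShuffle 1 b).trans τ).surjective w
    rw [edgeAt_apply, Equiv.trans_apply, pairShuffle_apply, edgeAt_apply]
    rfl
  obtain ⟨τ'', c'', h'', hsign, h1, h2⟩ := hs.exists_exchange_of_cycle (τ₀ := τ₀) hloop hK h' C hm
    (by rw [hmate, hedge]; exact he) ho (by
      intro i a hia
      rw [Equiv.trans_apply, pairShuffle_apply, Bool.false_xor, Equiv.Perm.one_apply] at hia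
      by_contra hodd
      by_cases hb : ∃ a, ¬ Even a.val ∧ C.vert a = τ (i, false)
      · have hbi : b i = true := decide_eq_true hb
        obtain ⟨a', ha', hva'⟩ := hb
        rw [hbi] at hia
        have h3 : mate τ (C.vert a) = C.vert a' := by
          rw [← hia, mate_apply, hva']; rfl
        have h4 : Even (a - 1).val := by
          have := Fin.even_val_add_one hm (a - 1)
          rw [sub_add_cancel] at this
          tauto
        have h5 := (he _ h4).2
        rw [sub_add_cancel] at h5
        rw [h5, mate_involutive τ] at h3
        exact ha' (C.vert_injective h3 ▸ h4)
      · have hbi : b i = false := decide_eq_false hb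
        rw [hbi] at hia
        exact hb ⟨a, hodd, hia.symm⟩)
  rw [hedge] at h2
  refine ⟨τ'', c'', h'', hsign.trans (h.pairingSign_shuffle K 1 b), ?_⟩
  rw [Finset.ssubset_iff_of_subset]
  · exact ⟨v, by simpa using hv, by simpa using h1 v hvC⟩
  · intro w hw
    by_cases hwC : w ∈ range C.vert
    · exact absurd (h1 w hwC) (by simpa using hw)
    · simpa [h2 w hwC] using hw

open Classical in
/-- For a Pfaffian orientation, all pairings have the same sign. -/
theorem pairingSign_eq (hloop : ∀ (e : E(G)) (x : V(G)), ¬ G.IsLink e x x)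
    {K : G.Orientation} (hK : K.IsPfaffian) (h : G.IsPairing τ c) (h' : G.IsPairing τ' c') :
    K.pairingSign τ₀ τ c = K.pairingSign τ₀ τ' c' := by
  induction hN : Finset.univ.filter (fun w => edgeAt τ c w ≠ edgeAt τ' c' w)
    using Finset.strongInduction generalizing τ c with
  | H N ih =>
    by_cases hv : ∃ v, edgeAt τ c v ≠ edgeAt τ' c' v
    · obtain ⟨v, hv⟩ := hv
      obtain ⟨τ'', c'', h'', hs, hlt⟩ := h.exists_exchange (τ₀ := τ₀) hloop hK h' hv
      rw [← hs]
      exact ih _ (hN ▸ hlt) h'' rfl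
    · push Not at hv
      obtain ⟨π, b, rfl, rfl⟩ := h.exists_shuffle h' (by
        ext e
        constructor
        · rintro ⟨i, rfl⟩
          have := hv (τ' (i, false))
          rw [edgeAt_apply] at this
          exact ⟨_, this⟩
        · rintro ⟨i, rfl⟩
          have := hv (τ (i, false))
          rw [edgeAt_apply] at this
          exact ⟨_, this.symm⟩)
      exact (h.pairingSign_shuffle K π b).symm

end IsPairing
end Graph

/-! ### The Pfaffian as a sum over pairings -/

/-- The pairs `(2i, 2i + 1)`. -/
def pairEquiv (n : ℕ) : Fin n × Bool ≃ Fin (2 * n) where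
  toFun p := ⟨2 * p.1.1 + if p.2 then 1 else 0, by have := p.1.2; split_ifs <;> omega⟩
  invFun k := (⟨k.1 / 2, by omega⟩, decide (k.1 % 2 = 1))
  left_inv := by
    rintro ⟨⟨i, hi⟩, _ | _⟩
    · simp
    · simp; omega
  right_inv := by
    rintro ⟨k, hk⟩
    apply Fin.ext
    simp only [decide_eq_true_eq]
    split_ifs <;> omega

namespace Graph

variable {α β : Type*} {G : Graph α β} {n : ℕ}

theorem IsDimer.exists_isPairing [Fintype V(G)] [Finite E(G)]
    (hloop : ∀ (e : E(G)) (x : V(G)), ¬ G.IsLink e x x) (hcard : Fintype.card V(G) = 2 * n)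
    {D : Set E(G)} (hD : G.IsDimer D) :
    ∃ (τ : Fin n × Bool ≃ V(G)) (c : Fin n → E(G)), G.IsPairing τ c ∧ range c = D := by
  classical
  obtain ⟨K⟩ := G.exists_orientation
  have := Fintype.ofFinite D
  let f : D × Bool → V(G) := fun p => if p.2 then K.head p.1 else K.tail p.1
  have hinc : ∀ p, G.Inc p.1 (f p) := by
    rintro ⟨e, _ | _⟩
    · exact (K.isLink e).inc_left
    · exact (K.isLink e).inc_right
  have hne : ∀ e, K.tail e ≠ K.head e := fun e he => hloop e (K.head e) (by
    have := K.isLink e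
    rwa [he] at this)
  have hf : Function.Bijective f := by
    constructor
    · rintro ⟨e, s⟩ ⟨e', s'⟩ h
      have : e = e' := Subtype.ext ((hD (f (e, s))).unique ⟨e.2, hinc (e, s)⟩
        ⟨e'.2, by rw [h]; exact hinc (e', s')⟩)
      subst this
      cases s <;> cases s'
      · rfl
      · exact absurd h (hne e)
      · exact absurd h.symm (hne e)
      · rfl
    · intro v
      obtain ⟨e, ⟨he, hv⟩, -⟩ := hD v
      rcases hv.eq_or_eq_of_isLink (K.isLink e) with h | h
      · exact ⟨(⟨e, he⟩, false), (Subtype.ext h).symm⟩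
      · exact ⟨(⟨e, he⟩, true), (Subtype.ext h).symm⟩
  have hD' : Fintype.card D = n := by
    have := Fintype.card_of_bijective hf
    rw [Fintype.card_prod, Fintype.card_bool, hcard] at this
    omega
  let g : Fin n ≃ D := (Fintype.equivFinOfCardEq hD').symm
  refine ⟨(Equiv.prodCongr g (Equiv.refl Bool)).trans (Equiv.ofBijective f hf), fun i => g i,
    fun i => K.isLink _, ?_⟩
  ext e
  constructor
  · rintro ⟨i, rfl⟩; exact (g i).2
  · intro he
    exact ⟨g.symm ⟨e, he⟩, by simp⟩

variable (K : G.Orientation)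

theorem Orientation.abs_coeff (e : E(G)) (v : V(G)) : |K.coeff e v| = 1 := by
  unfold Orientation.coeff; split_ifs <;> rfl

theorem Orientation.abs_pairingSign (τ₀ τ : Fin n × Bool ≃ V(G)) (c : Fin n → E(G)) :
    |K.pairingSign τ₀ τ c| = 1 := by
  rw [Orientation.pairingSign, abs_mul, Finset.abs_prod,
    Finset.prod_congr rfl fun i _ => K.abs_coeff _ _, Finset.prod_const_one, mul_one]
  exact Equiv.Perm.sign_abs _

variable [Fintype E(G)] (ν : E(G) → ℝ)

open Classical in
theorem Orientation.skewAdj_apply {m : ℕ} (x : Fin m ≃ V(G)) (i j : Fin m) :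
    K.skewAdj x ν i j =
      ∑ e : E(G), if G.IsLink e (x i) (x j) then (K.coeff e (x i) : ℝ) * ν e else 0 := by
  rw [Orientation.skewAdj, Matrix.of_apply]
  refine Finset.sum_congr rfl fun e _ => ?_
  by_cases h : G.IsLink e (x i) (x j)
  · have : (K.tail e = x i ∧ K.head e = x j) ↔ K.tail e = x i := by
      refine ⟨And.left, fun h1 => ⟨h1, ?_⟩⟩
      rcases K.isLink_iff h with h2 | h2
      · exact h2.2
      · rw [h2.2, ← h1, h2.1]
    rw [if_pos h, if_pos h, Orientation.coeff]
    simp only [this]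
    split_ifs <;> simp
  · rw [if_neg h, if_neg h]

variable [Fintype V(G)]

open Classical in
-- Expanding the product of matrix entries chooses one edge for each pair, so parallel edges are
-- told apart. A permutation with a compatible choice of edges is a pairing.
theorem Orientation.pfaffian_skewAdj (x : Fin (2 * n) ≃ V(G)) :
    pfaffian (K.skewAdj x ν) = 1 / (2 ^ n * (n.factorial : ℝ)) *
      ∑ p : (Fin n × Bool ≃ V(G)) × (Fin n → E(G)), if G.IsPairing p.1 p.2 then
        (K.pairingSign ((pairEquiv n).trans x) p.1 p.2 : ℝ) * ∏ i, ν (p.2 i) else 0 := by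
  rw [pfaffian, Fintype.sum_prod_type]
  congr 1
  refine Fintype.sum_equiv (Equiv.equivCongr (pairEquiv n).symm x) _ _ fun σ => ?_
  set τ := Equiv.equivCongr (pairEquiv n).symm x σ with hτ
  have h0 : ∀ i : Fin n, x (σ ⟨2 * i.1, by omega⟩) = τ (i, false) := fun i => rfl
  have h1 : ∀ i : Fin n, x (σ ⟨2 * i.1 + 1, by omega⟩) = τ (i, true) := fun i => rfl
  have hs : Equiv.Perm.sign (τ.trans ((pairEquiv n).trans x).symm) = Equiv.Perm.sign σ := by
    have : τ.trans ((pairEquiv n).trans x).symm =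
        ((pairEquiv n).trans σ).trans (pairEquiv n).symm := Equiv.ext fun p => by simp [hτ]
    rw [this, Equiv.Perm.sign_trans_trans_symm]
  simp only [K.skewAdj_apply, h0, h1]
  rw [Fintype.prod_sum, Finset.mul_sum]
  refine Finset.sum_congr rfl fun c _ => ?_
  rw [Finset.prod_ite_zero]
  simp only [Finset.mem_univ, true_implies]
  by_cases h : G.IsPairing τ c
  · have h' : ∀ i, G.IsLink (c i) (τ (i, false)) (τ (i, true)) := h
    rw [if_pos h, if_pos h', Orientation.pairingSign, hs, Finset.prod_mul_distrib]
    push_cast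
    ring
  · have h' : ¬ ∀ i, G.IsLink (c i) (τ (i, false)) (τ (i, true)) := h
    rw [if_neg h, if_neg h', mul_zero]

open Classical in
-- The pairings are grouped by their set of edges, which is a dimer configuration; each one arises
-- from `2^n n!` pairings, all of the same weight.
theorem sum_pairing_prod (hloop : ∀ (e : E(G)) (x : V(G)), ¬ G.IsLink e x x)
    (hcard : Fintype.card V(G) = 2 * n) :
    ∑ p : (Fin n × Bool ≃ V(G)) × (Fin n → E(G)),
      (if G.IsPairing p.1 p.2 then ∏ i, ν (p.2 i) else 0) =
        (2 ^ n * (n.factorial : ℝ)) * G.dimerPartition ν := by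
  have hr : ∀ (c : Fin n → E(G)), ((Finset.univ.image c : Finset E(G)) : Set E(G)) = range c :=
    fun c => by simp
  rw [← Finset.sum_filter, dimerPartition, Finset.mul_sum,
    ← Finset.sum_fiberwise_of_maps_to (t := Finset.univ.filter fun D : Finset E(G) =>
      G.IsDimer (D : Set E(G))) (g := fun p => Finset.univ.image p.2)]
  · refine Finset.sum_congr rfl fun D hD => ?_
    obtain ⟨τ, c, h, hc⟩ := (Finset.mem_filter.1 hD).2.exists_isPairing hloop hcard
    rw [Finset.filter_filter, Finset.sum_congr rfl (g := fun _ => ∏ e ∈ D, ν e), Finset.sum_const,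
      nsmul_eq_mul]
    · congr 1
      have := h.card_filter_range_eq
      rw [← Nat.cast_ofNat, ← Nat.cast_pow, ← Nat.cast_mul, ← this]
      congr 2
      ext p
      simp only [Finset.mem_filter, hc, ← hr, Finset.coe_inj]
    · intro p hp
      obtain ⟨h', rfl⟩ := (Finset.mem_filter.1 hp).2
      rw [Finset.prod_image fun i _ j _ hij => h'.injective hij]
  · intro p hp
    refine Finset.mem_filter.2 ⟨Finset.mem_univ _, ?_⟩
    rw [hr]
    exact (Finset.mem_filter.1 hp).2.isDimer

/-- For a Pfaffian orientation, the dimer partition function is the modulus of a Pfaffian. -/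
theorem Orientation.IsPfaffian.dimerPartition_eq {K : G.Orientation} (hK : K.IsPfaffian)
    (hloop : ∀ (e : E(G)) (x : V(G)), ¬ G.IsLink e x x) (x : Fin (2 * n) ≃ V(G))
    (hν : ∀ e, 0 ≤ ν e) : G.dimerPartition ν = |pfaffian (K.skewAdj x ν)| := by
  classical
  -- `s` is the common sign of all pairings. Without any pairing both sums vanish, and `1` is as
  -- good as any value.
  obtain ⟨s, hs1, hs⟩ : ∃ s : ℤ, |s| = 1 ∧ ∀ (τ : Fin n × Bool ≃ V(G)) (c : Fin n → E(G)),
      G.IsPairing τ c → K.pairingSign ((pairEquiv n).trans x) τ c = s := by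
    by_cases h : ∃ (τ : Fin n × Bool ≃ V(G)) (c : Fin n → E(G)), G.IsPairing τ c
    · obtain ⟨τ, c, h⟩ := h
      exact ⟨_, K.abs_pairingSign _ τ c, fun τ' c' h' => h'.pairingSign_eq hloop hK h⟩
    · push Not at h
      exact ⟨1, rfl, fun τ c h' => absurd h' (h τ c)⟩
  have hpos : (0 : ℝ) < 2 ^ n * (n.factorial : ℝ) := by positivity
  have hsum : pfaffian (K.skewAdj x ν) = s * G.dimerPartition ν := by
    have h1 : ∀ p : (Fin n × Bool ≃ V(G)) × (Fin n → E(G)), (if G.IsPairing p.1 p.2 then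
        (K.pairingSign ((pairEquiv n).trans x) p.1 p.2 : ℝ) * ∏ i, ν (p.2 i) else 0) =
        s * if G.IsPairing p.1 p.2 then ∏ i, ν (p.2 i) else 0 := by
      intro p
      split_ifs with h
      · rw [hs _ _ h]
      · rw [mul_zero]
    have hcard : Fintype.card V(G) = 2 * n := by
      rw [← Fintype.card_congr x, Fintype.card_fin]
    rw [K.pfaffian_skewAdj, Finset.sum_congr rfl fun p _ => h1 p, ← Finset.mul_sum,
      sum_pairing_prod ν hloop hcard]
    field_simp
  have hZ : 0 ≤ G.dimerPartition ν :=
    Finset.sum_nonneg fun D _ => Finset.prod_nonneg fun e _ => hν e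
  have hs1' : |(s : ℝ)| = 1 := by exact_mod_cast hs1
  rw [hsum, abs_mul, hs1', one_mul, abs_of_nonneg hZ]

end Graph

end

theorem theorem3p1 {α β : Type*} (G : Graph α β) [Fintype V(G)] [Fintype E(G)]
    (hG : G.Preconnected) (Γ : G.PlaneEmbedding) :
    (∃ K : G.Orientation, Γ.IsKasteleyn K) ∧
    ∀ K : G.Orientation, Γ.IsKasteleyn K →
      K.IsPfaffian ∧
      ∀ (n : ℕ) (x : Fin (2 * n) ≃ V(G)) (ν : E(G) → ℝ), (∀ e, 0 < ν e) →
        G.dimerPartition ν = |pfaffian (K.skewAdj x ν)| := by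
  refine ⟨Γ.exists_isKasteleyn, fun K hK => ⟨hK.isPfaffian hG, ?_⟩⟩
  exact fun n x ν hν => (hK.isPfaffian hG).dimerPartition_eq ν Γ.not_isLink_self x fun e => (hν e).le
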